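/- **Setting.** Let $\Omega\subset\mathbb R^d$, $d\ge 1$, be a bounded domain with Lipschitz boundary, let $V$ be a closed subspace of $H^1(\Omega)$ with $H^1_0(\Omega)\subset V$, and let $$a(w,v)=\int_\Omega \alpha\nabla w\cdot\nabla v+\sigma wv\,dx,\quad \ell(v)=\int_\Omega fv\,dx,\qquad \tilde a(w,v)=\int_\Omega \tilde\alpha\nabla w\cdot\nabla v+\tilde\sigma wv\,dx,\quad \tilde\ell(v)=\int_\Omega \tilde fv\,dx,$$ with $0<\alpha_{\min}\le\alpha\le\alpha_{\max}$, $0<\tilde\alpha_{\min}\le\tilde\alpha\le\tilde\alpha_{\max}$, $0\le\sigma,\tilde\sigma\in L^\infty(\Omega)$ and $f,\tilde f\in L^2(\Omega)$; write $\|\tilde\ell-\ell\|_{L^2(\Omega)}=\|\tilde f-f\|_{L^2(\Omega)}$. Let $a$ be coercive on $V$ and let $u\in V$ be the solution of $a(u,v)=\ell(v)$ for all $v\in V$. Let $B_1,\dots,B_m\subset\Omega$ be open and non-empty, and let $K_1,\dots,K_m\subset\overline\Omega$ be convex sets with $B_i\subset K_i$ and $\Omega\subset\bigcup_i\overline{K_i}$.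 Put $M=\max_{x\in\Omega}|\{i: x\in K_i\}|$, $r=\max_i\operatorname{diam}(B_i)$, $R=\max_i\operatorname{diam}(K_i)$, and $\eta=1$ if $B_i=K_i$ for all $i$, $\eta=3\max_i|K_i|/|B_i|$ otherwise. For points $p_i\in B_i$ and a parameter $\delta>0$ let (with $\langle v\rangle_{B}=|B|^{-1}\int_{B}v\,dx$) $$\tilde c(w,v)=\tilde a(w,v)+\delta^{-1}\sum_{i=1}^m|B_i|\,\langle w\rangle_{B_i}\,\langle v\rangle_{B_i},\qquad \tilde r(v)=\tilde\ell(v)+\delta^{-1}\sum_{i=1}^m u(p_i)\,|B_i|\,\langle v\rangle_{B_i},\qquad \tilde J(v)=\tfrac12\tilde c(v,v)-\tilde r(v).$$ **Assumptions.** * (Non-degenerate.) $\eta\le\eta_0$ and $M\le M_0$. * (Well-balanced.) $\theta\,\frac{R^2M}{\pi^2\tilde\alpha_{\min}}\le\delta\le\theta^{-1}\frac{R^2M}{\pi^2\tilde\alpha_{\min}}$ for a $\theta\in(0,1]$. * $\tilde\alpha-\alpha\in W^{1,\infty}(\Omega)$. * $u\in H^2(\Omega)\cap C^{0,\lambda}(\overline\Omega)$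 for a $\lambda\in(0,1]$; $u(p_i)$ is the value of the continuous representative. * The boundary terms vanish: $\bigl(\frac{\partial u}{\partial\nu}v\bigr)|_{\partial\Omega}=0$ for all $v\in V$ (in the sense of traces). **Claim.** There is a constant $C>0$, depending only on $d$, $\eta_0$, $M_0$, $\theta$, $\tilde\alpha_{\min}$, $\tilde\alpha_{\max}$ and on upper bounds for $\|\tilde\sigma\|_{L^\infty(\Omega)}$, $\operatorname{diam}(\Omega)$, $\|u\|_{H^2(\Omega)}$ and the $\lambda$-Hölder constant of $u$, such that the following holds. For every subset $V_h\subset V$ (not necessarily a subspace) and every $\tilde u_h\in V_h$ that minimizes $\tilde J$ over $V_h$, $$\|\tilde u_h-u\|_{L^2(\Omega)}\le CR^2\bigl(\|\tilde\ell-\ell\|_{L^2(\Omega)}+\|\tilde\sigma-\sigma\|_{L^\infty(\Omega)}+\|\tilde\alpha-\alpha\|_{W^{1,\infty}(\Omega)}\bigr)+Cr^\lambda+C\inf_{v\in V_h}\bigl(R\|\nabla(v-u)\|_{L^2(\Omega)}+\|v-u\|_{L^2(\Omega)}\bigr).$$ -/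

import Mathlib

open MeasureTheory Filter Topology Set
open scoped ENNReal NNReal ContDiff RealInnerProductSpace

namespace PDELearning

noncomputable section

/-- The space `ℝ^d` with its Euclidean norm. -/
abbrev Euc (d : ℕ) : Type := EuclideanSpace ℝ (Fin d)

/-! ### Lipschitz domains -/

/-- A bounded domain (open, connected, non-empty) whose boundary is locally the graph of a
Lipschitz function: near every boundary point `z` there are a direction `e` and a Lipschitz
function `γ`, not depending on the coordinate in direction `e`, such that the domain lies
exactly above the graph of `γ` over the hyperplane orthogonal to `e`. -/
structure IsLipschitzDomain {d : ℕ} (Ω : Set (Euc d)) : Prop where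
  isOpen : IsOpen Ω
  isConnected : IsConnected Ω
  isBounded : Bornology.IsBounded Ω
  boundary_graph : ∀ z ∈ frontier Ω, ∃ (e : Euc d) (ρ : ℝ) (L : ℝ≥0) (γ : Euc d → ℝ),
    ‖e‖ = 1 ∧ 0 < ρ ∧ LipschitzWith L γ ∧ (∀ (x : Euc d) (t : ℝ), γ (x + t • e) = γ x) ∧
    ∀ x ∈ Metric.ball z ρ, (x ∈ Ω ↔ γ x < ⟪x, e⟫)

/-- The surface measure of `∂Ω`: the `(d-1)`-dimensional Hausdorff measure on the boundary. -/
def surfaceMeasure {d : ℕ} (Ω : Set (Euc d)) : Measure (Euc d) :=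
  (Measure.hausdorffMeasure ((d : ℝ) - 1)).restrict (frontier Ω)

/-- `ν` is the outer unit normal of `Ω` at `x`: inside every cone around `ν` all points close to
`x` lie outside `Ω`, and inside every cone around `-ν` all points close to `x` lie in `Ω`.
Such a vector is unique, and on a Lipschitz domain it exists at almost every boundary point. -/
def IsOuterUnitNormal {d : ℕ} (Ω : Set (Euc d)) (x ν : Euc d) : Prop :=
  ‖ν‖ = 1 ∧ ∀ ε > (0 : ℝ), ∀ᶠ y in 𝓝 x,
    (ε * ‖y - x‖ < ⟪y - x, ν⟫ → y ∉ Ω) ∧ (⟪y - x, ν⟫ < -(ε * ‖y - x‖) → y ∈ Ω)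

/-! ### Sobolev spaces -/

/-- A test function on `Ω`: an element of `C_c^∞(Ω)`. -/
def IsTestFunction {d : ℕ} (Ω : Set (Euc d)) (φ : Euc d → ℝ) : Prop :=
  ContDiff ℝ ∞ φ ∧ HasCompactSupport φ ∧ tsupport φ ⊆ Ω

/-- `G` is the weak gradient of `v` on `Ω`. -/
def HasWeakGradient {d : ℕ} (Ω : Set (Euc d)) (v : Euc d → ℝ) (G : Euc d → Euc d) : Prop :=
  LocallyIntegrableOn v Ω ∧ LocallyIntegrableOn G Ω ∧
    ∀ φ : Euc d → ℝ, IsTestFunction Ω φ →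
      ∫ x in Ω, v x • gradient φ x = -∫ x in Ω, φ x • G x

/-- `L²(Ω) × L²(Ω; ℝ^d)`. A function `v ∈ H¹(Ω)` is represented by the pair `(v, ∇v)`. -/
abbrev L2Pair {d : ℕ} (Ω : Set (Euc d)) : Type :=
  Lp ℝ 2 (volume.restrict Ω) × Lp (Euc d) 2 (volume.restrict Ω)

/-- `H¹(Ω)`: the pairs `(v, ∇v)` with `v ∈ L²(Ω)` and weak gradient `∇v ∈ L²(Ω; ℝ^d)`. The
product topology of `L2Pair Ω` induces on it the topology of the `H¹`-norm. -/
def sobolevH1 {d : ℕ} (Ω : Set (Euc d)) : Set (L2Pair Ω) :=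
  {w | HasWeakGradient Ω w.1 w.2}

/-- `H₀¹(Ω)`: the closure of the test functions in `H¹(Ω)`. -/
def sobolevH10 {d : ℕ} (Ω : Set (Euc d)) : Set (L2Pair Ω) :=
  closure {w | ∃ φ : Euc d → ℝ, IsTestFunction Ω φ ∧
    (w.1 : Euc d → ℝ) =ᵐ[volume.restrict Ω] φ ∧
    (w.2 : Euc d → Euc d) =ᵐ[volume.restrict Ω] gradient φ}

/-- `u = (u, ∇u)` belongs to `H²(Ω)` and row `i` of its weak Hessian is `D2u i = ∇(∂ᵢ u)`. -/
def HasWeakHessian {d : ℕ} (Ω : Set (Euc d)) (u : L2Pair Ω)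
    (D2u : Fin d → Lp (Euc d) 2 (volume.restrict Ω)) : Prop :=
  u ∈ sobolevH1 Ω ∧ ∀ i, HasWeakGradient Ω (fun x => u.2 x i) (D2u i)

/-- The norm of `H²(Ω)`. -/
def normH2 {d : ℕ} {Ω : Set (Euc d)} (u : L2Pair Ω)
    (D2u : Fin d → Lp (Euc d) 2 (volume.restrict Ω)) : ℝ :=
  Real.sqrt (‖u.1‖ ^ 2 + ‖u.2‖ ^ 2 + ∑ i, ‖D2u i‖ ^ 2)

/-- The norm of `L^∞(Ω)`. -/
def normLinfty {d : ℕ} (Ω : Set (Euc d)) {F : Type*} [NormedAddCommGroup F]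
    (g : Euc d → F) : ℝ :=
  (eLpNorm g ∞ (volume.restrict Ω)).toReal

/-- `β ∈ W^{1,∞}(Ω)` with weak gradient `Dβ`. -/
def IsW1Infty {d : ℕ} (Ω : Set (Euc d)) (β : Euc d → ℝ) (Dβ : Euc d → Euc d) : Prop :=
  HasWeakGradient Ω β Dβ ∧
    MemLp β ∞ (volume.restrict Ω) ∧ MemLp Dβ ∞ (volume.restrict Ω)

/-- The norm of `W^{1,∞}(Ω)`. -/
def normW1Infty {d : ℕ} (Ω : Set (Euc d)) (β : Euc d → ℝ) (Dβ : Euc d → Euc d) : ℝ :=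
  max (normLinfty Ω β) (normLinfty Ω Dβ)

/-- `g ∈ L²(∂Ω)` is the trace on `∂Ω` of the function `w ∈ H¹(Ω)` with weak gradient `G`:
smooth functions on `ℝ^d` approximate `w` in `H¹(Ω)` while their boundary values approximate
`g` in `L²(∂Ω)`. -/
def IsTrace {d : ℕ} (Ω : Set (Euc d)) (w : Euc d → ℝ) (G : Euc d → Euc d)
    (g : Euc d → ℝ) : Prop :=
  MemLp g 2 (surfaceMeasure Ω) ∧ ∃ φ : ℕ → Euc d → ℝ, (∀ n, ContDiff ℝ ∞ (φ n)) ∧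
    Tendsto (fun n => eLpNorm (fun x => φ n x - w x) 2 (volume.restrict Ω)) atTop (𝓝 0) ∧
    Tendsto (fun n => eLpNorm (fun x => gradient (φ n) x - G x) 2 (volume.restrict Ω))
      atTop (𝓝 0) ∧
    Tendsto (fun n => eLpNorm (fun x => φ n x - g x) 2 (surfaceMeasure Ω)) atTop (𝓝 0)

/-- `((∂u/∂ν) v)|_∂Ω = 0` for all `v ∈ V`, where `u ∈ H²(Ω)`. Here `g` is the trace of `v`
and `h i` is the trace of `∂ᵢ u`, so that `∂u/∂ν = ∑ i, h i * ν i` on `∂Ω`. -/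
def BoundaryTermsVanish {d : ℕ} {Ω : Set (Euc d)} (V : Set (L2Pair Ω)) (u : L2Pair Ω)
    (D2u : Fin d → Lp (Euc d) 2 (volume.restrict Ω)) : Prop :=
  ∀ v ∈ V, ∃ (g : Euc d → ℝ) (h : Fin d → Euc d → ℝ),
    IsTrace Ω v.1 v.2 g ∧ (∀ i, IsTrace Ω (fun x => u.2 x i) (D2u i) (h i)) ∧
    ∀ᵐ x ∂(surfaceMeasure Ω), ∀ ν : Euc d, IsOuterUnitNormal Ω x ν →
      (∑ i, h i x * ν i) * g x = 0

/-! ### Bilinear forms and functionals of the PDE -/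

/-- `α` is a measurable function on `Ω` with values in `[αmin, αmax]`, where `αmin > 0`. -/
def IsDiffusionCoeff {d : ℕ} (Ω : Set (Euc d)) (α : Euc d → ℝ) (αmin αmax : ℝ) : Prop :=
  0 < αmin ∧ AEStronglyMeasurable α (volume.restrict Ω) ∧
    ∀ᵐ x ∂(volume.restrict Ω), αmin ≤ α x ∧ α x ≤ αmax

/-- `σ` is a non-negative element of `L^∞(Ω)`. -/
def IsReactionCoeff {d : ℕ} (Ω : Set (Euc d)) (σ : Euc d → ℝ) : Prop :=
  MemLp σ ∞ (volume.restrict Ω) ∧ ∀ᵐ x ∂(volume.restrict Ω), 0 ≤ σ x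

/-- `a(w,v) = ∫_Ω α ∇w · ∇v + σ w v dx`. -/
def pdeForm {d : ℕ} {Ω : Set (Euc d)} (α σ : Euc d → ℝ) (w v : L2Pair Ω) : ℝ :=
  ∫ x in Ω, (α x * ⟪w.2 x, v.2 x⟫ + σ x * w.1 x * v.1 x)

/-- `ℓ(v) = ∫_Ω f v dx`. -/
def pdeLoad {d : ℕ} {Ω : Set (Euc d)} (f : Lp ℝ 2 (volume.restrict Ω)) (v : L2Pair Ω) : ℝ :=
  ∫ x in Ω, f x * v.1 x

/-- The form `a` is coercive on `V` with respect to the `H¹`-norm. -/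
def IsCoerciveOn {d : ℕ} {Ω : Set (Euc d)} (a : L2Pair Ω → L2Pair Ω → ℝ)
    (V : Set (L2Pair Ω)) : Prop :=
  ∃ κ > (0 : ℝ), ∀ v ∈ V, κ * (‖v.1‖ ^ 2 + ‖v.2‖ ^ 2) ≤ a v v

/-! ### The data term -/

/-- The sets `B i` on which data is given and their convex extensions `K i`, which cover `Ω`.
(A bounded convex set with an interior point automatically has a Lipschitz boundary.) -/
structure IsDataCovering {d m : ℕ} (Ω : Set (Euc d)) (B K : Fin m → Set (Euc d)) : Prop where
  isOpen_B : ∀ i, IsOpen (B i)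
  nonempty_B : ∀ i, (B i).Nonempty
  B_subset : ∀ i, B i ⊆ Ω
  convex_K : ∀ i, Convex ℝ (K i)
  B_subset_K : ∀ i, B i ⊆ K i
  K_subset : ∀ i, K i ⊆ closure Ω
  cover : Ω ⊆ ⋃ i, closure (K i)

/-- The maximal overlap `M = max_{x ∈ Ω} |{i | x ∈ K i}|`. -/
def maxOverlap {d m : ℕ} (Ω : Set (Euc d)) (K : Fin m → Set (Euc d)) : ℕ :=
  ⨆ x : Ω, {i | (x : Euc d) ∈ K i}.ncard

/-- The maximal diameter of a finite family of sets. -/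
def maxDiam {d m : ℕ} (A : Fin m → Set (Euc d)) : ℝ :=
  ⨆ i, Metric.diam (A i)

open Classical in
/-- The mismatch `η`: `1` if `B i = K i` for all `i`, and `3 max_i |K i| / |B i|` otherwise. -/
def mismatch {d m : ℕ} (B K : Fin m → Set (Euc d)) : ℝ :=
  if ∀ i, B i = K i then 1 else 3 * ⨆ i, volume.real (K i) / volume.real (B i)

/-- The weight `R² M / (π² α̃_min)` with which the regularization parameter is compared. -/
def referenceWeight {d m : ℕ} (Ω : Set (Euc d)) (K : Fin m → Set (Euc d)) (αmin : ℝ) : ℝ :=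
  maxDiam K ^ 2 * maxOverlap Ω K / (Real.pi ^ 2 * αmin)

/-- `b(w,v) = ∑ i, |B i| (⨍_{B i} w) (⨍_{B i} v)`. -/
def dataForm {d m : ℕ} (B : Fin m → Set (Euc d)) (w v : Euc d → ℝ) : ℝ :=
  ∑ i, volume.real (B i) * (⨍ x in B i, w x) * (⨍ x in B i, v x)

/-- The possibly inexact data term `∑ i, b i |B i| ⨍_{B i} v` with data values `b i`. -/
def dataLoad {d m : ℕ} (B : Fin m → Set (Euc d)) (b : Fin m → ℝ) (v : Euc d → ℝ) : ℝ :=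
  ∑ i, b i * volume.real (B i) * (⨍ x in B i, v x)

/-- The augmented form `c(w,v) = a(w,v) + δ⁻¹ b(w,v)`. -/
def augmentedForm {d m : ℕ} {Ω : Set (Euc d)} (α σ : Euc d → ℝ) (δ : ℝ)
    (B : Fin m → Set (Euc d)) (w v : L2Pair Ω) : ℝ :=
  pdeForm α σ w v + δ⁻¹ * dataForm B w.1 v.1

/-- The augmented functional `ℓ(v) + δ⁻¹ ∑ i, b i |B i| ⨍_{B i} v`. -/
def augmentedLoad {d m : ℕ} {Ω : Set (Euc d)} (f : Lp ℝ 2 (volume.restrict Ω)) (δ : ℝ)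
    (B : Fin m → Set (Euc d)) (b : Fin m → ℝ) (v : L2Pair Ω) : ℝ :=
  pdeLoad f v + δ⁻¹ * dataLoad B b v.1

/-- The functional `J(v) = c(v,v)/2 - r(v)` of the PDE-regularized learning problem. -/
def objective {d m : ℕ} {Ω : Set (Euc d)} (α σ : Euc d → ℝ)
    (f : Lp ℝ 2 (volume.restrict Ω)) (δ : ℝ) (B : Fin m → Set (Euc d)) (b : Fin m → ℝ)
    (v : L2Pair Ω) : ℝ :=
  1 / 2 * augmentedForm α σ δ B v v - augmentedLoad f δ B b v

end

end PDELearning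

open PDELearning

/-!
The objective is a quadratic functional with the bilinear form `c̃` (`augmentedForm`), so the error
is estimated as in Céa's lemma with a residual. Expanding the objective around the exact solution
`u` (`objective_add`), a minimizer `uh` satisfies, in the energy norm of `c̃`,
`‖uh - u‖ ≤ ‖v - u‖ + 2 ε` for every competitor `v`, where `ε` is the norm of the residual
`e ↦ r̃(e) - c̃(u, e)` of `u` (`sqrt_energy_le_of_minimizer`). Neither linear structure nor
closedness of the set of competitors is needed.

Three facts turn this into the estimate in `L²`.

* The energy controls the `L²`-norm at the scale `R`: `‖e‖ ≤ C R √c̃(e, e)`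
  (`IsDataCovering.sq_norm_le_energy`). On each convex set `K i` a Poincaré inequality for the
  deviation from the mean over `B i` is obtained by integrating along segments, and the mean values
  themselves are what the data term measures. The constant `2 ^ d` in place of the sharp constant
  of Payne and Weinberger is harmless here.
* Conversely `R √c̃(y, y)` is at most a multiple of `R ‖∇y‖ + ‖y‖` (`IsDataCovering.energy_le`).
* The residual splits into a part from the inexact equation and a part from the data. In the first
  part, the perturbation `∫ (α̃ - α) ∇u · ∇e` is integrated by parts, so that it is bounded by the
  `L²`-norm of `e` alone, which gives the second power of `R` (`abs_pde_residual_le`). In the second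
  part, point values of `u` differ from its local means by at most a multiple of `r ^ λ`
  (`abs_data_residual_le`).

The analytic core is the integration by parts `IsLipschitzDomain.integral_by_parts` on a Lipschitz
domain, for `β = α̃ - α ∈ W^{1,∞}` and a field `e ∇u` whose normal component vanishes on the boundary
only in the sense of traces. Instead of the full divergence theorem, an inequality is enough:
`|∫ (β div Z + ∇β · Z)|` is at most a multiple of the flux of `|Z · N|` through the boundary
(`IsGraphChart.exists_flux_bound`). In a chart, `Z` is multiplied by a cut-off function of
`(⟪x, e⟫ - γ x) / s`, which is an admissible Lipschitz test field
(`HasWeakGradient.integral_lipschitz`), and as `s → 0` the derivative of the cut-off leaves the flux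
through the graph of `γ`. This flux is computed with the Lebesgue measure of the hyperplane
transported to the graph, which is dominated by the Hausdorff measure on the boundary because
projections are contractions; by Rademacher's theorem `∇γ - e` is an outer normal almost everywhere.
For smooth fields approximating `e ∇u` the fluxes therefore tend to zero
(`IsGraphChart.tendsto_flux_zero`), and a partition of unity globalizes the identity.
-/

namespace PDELearning

/-! ### Lipschitz test functions for weak gradients -/

section Mollification

open scoped Convolution
open ContinuousLinearMap (lsmul)

theorem norm_normed_convolution_le {d : ℕ} (ρ : ContDiffBump (0 : Euc d)) {g : Euc d → ℝ} {A : ℝ}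
    (hg : ∀ x, ‖g x‖ ≤ A) (x : Euc d) :
    ‖(ρ.normed volume ⋆[lsmul ℝ ℝ, volume] g) x‖ ≤ A := by
  rw [convolution_lsmul]
  have hi : Integrable (fun t => ρ.normed volume t * A) volume :=
    (ρ.contDiff_normed (n := 0)).continuous.integrable_of_hasCompactSupport
      ρ.hasCompactSupport_normed |>.mul_const A
  refine (norm_integral_le_of_norm_le hi (Eventually.of_forall fun t => ?_)).trans_eq ?_
  · rw [norm_smul, Real.norm_of_nonneg (ρ.nonneg_normed t)]
    exact mul_le_mul_of_nonneg_left (hg _) (ρ.nonneg_normed t)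
  · rw [integral_mul_const, ρ.integral_normed, one_mul]

/-- Mollification commutes with the directional derivatives of a Lipschitz function. -/
theorem lineDeriv_normed_convolution {d : ℕ} (ρ : ContDiffBump (0 : Euc d)) {ψ : Euc d → ℝ}
    {L : ℝ≥0} (hψ : LipschitzWith L ψ) (hc : HasCompactSupport ψ) (w x : Euc d) :
    lineDeriv ℝ (ρ.normed volume ⋆[lsmul ℝ ℝ, volume] ψ) x w
      = (ρ.normed volume ⋆[lsmul ℝ ℝ, volume] (fun y => lineDeriv ℝ ψ y w)) x := by
  have hρ1 : ContDiff ℝ 1 (ρ.normed volume) := ρ.contDiff_normed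
  have hρc := ρ.hasCompactSupport_normed (μ := volume)
  have hD := hρc.hasFDerivAt_convolution_left (lsmul ℝ ℝ) hρ1
    hψ.continuous.locallyIntegrable (μ := volume) x
  rw [(hD.hasLineDerivAt w).lineDeriv, convolution_def, ContinuousLinearMap.integral_apply]
  · obtain ⟨Lρ, hLρ⟩ := hρ1.lipschitzWith_of_hasCompactSupport hρc one_ne_zero
    have hg : LipschitzWith L (fun t => ψ (x - t)) := by
      have : LipschitzWith 1 (fun t : Euc d => x - t) := by
        refine LipschitzWith.of_dist_le_mul fun a b => ?_
        simp only [dist_eq_norm, NNReal.coe_one, one_mul]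
        rw [sub_sub_sub_cancel_left, norm_sub_rev]
      have h2 := hψ.comp this
      rwa [mul_one] at h2
    have hgc : HasCompactSupport (fun t => ψ (x - t)) :=
      hc.comp_homeomorph (Homeomorph.subLeft x)
    -- the derivative of the kernel is moved onto `ψ` by integration by parts
    have key := hLρ.integral_lineDeriv_mul_eq (μ := volume) hg hgc w
    rw [convolution_lsmul]
    have e1 : ∀ t, lineDeriv ℝ (ρ.normed volume) t w = fderiv ℝ (ρ.normed volume) t w :=
      fun t => (hρ1.differentiable one_ne_zero t).lineDeriv_eq_fderiv
    have e2 : ∀ t, lineDeriv ℝ (fun t => ψ (x - t)) t (-w) = lineDeriv ℝ ψ (x - t) w := by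
      intro t
      unfold lineDeriv
      congr 1
      ext s
      rw [smul_neg, ← sub_eq_add_neg]
      change ψ (x - (t - s • w)) = _
      rw [sub_sub_eq_add_sub, add_sub_right_comm]
    simp_rw [e1, e2] at key
    simp only [ContinuousLinearMap.precompL_apply, ContinuousLinearMap.lsmul_apply, smul_eq_mul]
    rw [key]
    simp_rw [mul_comm]
  · have := (hρc.fderiv ℝ).convolutionExists_left
      ((lsmul ℝ ℝ : ℝ →L[ℝ] ℝ →L[ℝ] ℝ).precompL (Euc d)) (hρ1.continuous_fderiv one_ne_zero)
      hψ.continuous.locallyIntegrable (μ := volume) x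
    exact this

theorem integrable_mul_of_locallyIntegrableOn {d : ℕ} {Ω K : Set (Euc d)} {v a : Euc d → ℝ}
    (hv : LocallyIntegrableOn v Ω) (hK : IsCompact K) (hKΩ : K ⊆ Ω)
    (ha : AEStronglyMeasurable a volume) {A : ℝ} (hA : ∀ x, ‖a x‖ ≤ A)
    (h0 : ∀ x ∉ K, a x = 0) : IntegrableOn (fun x => v x * a x) Ω := by
  have h1 : IntegrableOn (fun x => v x * a x) K :=
    (hv.integrableOn_compact_subset hKΩ hK).mul_bdd (c := A) ha.restrict (Eventually.of_forall hA)
  exact (integrableOn_iff_integrable_of_support_subset (fun x hx => by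
    by_contra h; exact hx (by simp [h0 x h]))).1 h1 |>.integrableOn

/-- The `i`-th component of the defining identity of the weak gradient. -/
theorem HasWeakGradient.integral_testFunction {d : ℕ} {Ω : Set (Euc d)} {v : Euc d → ℝ}
    {G : Euc d → Euc d} (h : HasWeakGradient Ω v G) {φ : Euc d → ℝ}
    (hφ : IsTestFunction Ω φ) (i : Fin d) :
    ∫ x in Ω, v x * lineDeriv ℝ φ x (EuclideanSpace.single i 1) = -∫ x in Ω, φ x * G x i := by
  obtain ⟨hφs, hφc, hφΩ⟩ := hφ
  have hdiff : Differentiable ℝ φ := hφs.differentiable (by simp)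
  have hgc : Continuous (gradient φ) :=
    (InnerProductSpace.toDual ℝ (Euc d)).symm.continuous.comp
      (hφs.continuous_fderiv (by simp))
  have hgs : HasCompactSupport (gradient φ) :=
    (hφc.fderiv ℝ).comp_left (g := (InnerProductSpace.toDual ℝ (Euc d)).symm) (map_zero _)
  have hcomp : ∀ x, gradient φ x i = lineDeriv ℝ φ x (EuclideanSpace.single i 1) := by
    intro x
    rw [(hdiff x).lineDeriv_eq_fderiv, ← inner_gradient_left,
      EuclideanSpace.inner_single_right]
    simp
  have h1 := congrArg (EuclideanSpace.proj (𝕜 := ℝ) i) (h.2.2 φ ⟨hφs, hφc, hφΩ⟩)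
  have hgz : ∀ x ∉ tsupport φ, gradient φ x = 0 := fun x hx => by
    unfold gradient
    rw [fderiv_of_notMem_tsupport (𝕜 := ℝ) hx, map_zero]
  have hint1 : Integrable (fun x => v x • gradient φ x) (volume.restrict Ω) := by
    obtain ⟨A, hA⟩ := hgs.exists_bound_of_continuous hgc
    have h1 : IntegrableOn (fun x => v x • gradient φ x) (tsupport φ) :=
      (h.1.integrableOn_compact_subset hφΩ hφc).smul_bdd (C := A)
        hgc.aestronglyMeasurable (Eventually.of_forall hA)
    exact (integrableOn_iff_integrable_of_support_subset (fun x hx => by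
      by_contra hh; exact hx (by simp [hgz x hh]))).1 h1 |>.integrableOn
  have hint2 : Integrable (fun x => φ x • G x) (volume.restrict Ω) := by
    obtain ⟨A, hA⟩ := hφc.exists_bound_of_continuous hφs.continuous
    have h1 : IntegrableOn (fun x => φ x • G x) (tsupport φ) :=
      (h.2.1.integrableOn_compact_subset hφΩ hφc).bdd_smul (C := A)
        hφs.continuous.aestronglyMeasurable (Eventually.of_forall hA)
    exact (integrableOn_iff_integrable_of_support_subset (fun x hx => by
      by_contra hh; exact hx (by simp [image_eq_zero_of_notMem_tsupport hh]))).1 h1 |>.integrableOn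
  rw [map_neg, ← ContinuousLinearMap.integral_comp_comm _ hint1,
    ← ContinuousLinearMap.integral_comp_comm _ hint2] at h1
  simpa [hcomp] using h1

/-- The defining identity of the weak gradient extends from test functions to Lipschitz functions
with compact support in the domain. -/
theorem HasWeakGradient.integral_lipschitz {d : ℕ} {Ω : Set (Euc d)} (hΩ : IsOpen Ω)
    {v : Euc d → ℝ} {G : Euc d → Euc d} (h : HasWeakGradient Ω v G) {ψ : Euc d → ℝ} {L : ℝ≥0}
    (hψ : LipschitzWith L ψ) (hc : HasCompactSupport ψ) (hs : tsupport ψ ⊆ Ω) (i : Fin d) :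
    ∫ x in Ω, v x * lineDeriv ℝ ψ x (EuclideanSpace.single i 1) = -∫ x in Ω, ψ x * G x i := by
  obtain ⟨δ, hδ, hKΩ⟩ := IsCompact.exists_cthickening_subset_open hc hΩ hs
  set K := Metric.cthickening δ (tsupport ψ) with hKdef
  have hK : IsCompact K := IsCompact.cthickening hc
  set w : Euc d := EuclideanSpace.single i 1 with hw
  have hw1 : ‖w‖ = 1 := by simp [hw]
  -- with kernels of radius at most `δ`, all mollifications of `ψ` are supported in `K`
  let ρ : ℕ → ContDiffBump (0 : Euc d) := fun k =>
    ⟨δ / (2 * (k + 1)), δ / (k + 1), by positivity, by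
      apply div_lt_div_of_pos_left hδ (by positivity)
      have : (0 : ℝ) ≤ k := k.cast_nonneg
      linarith⟩
  have hr0 : Tendsto (fun k => (ρ k).rOut) atTop (𝓝 0) := by
    have := (tendsto_const_div_atTop_nhds_zero_nat δ).comp (tendsto_add_atTop_nat 1)
    refine this.congr fun k => ?_
    simp [ρ]
  have hr1 : ∀ᶠ k in atTop, (ρ k).rOut ≤ 2 * (ρ k).rIn := Eventually.of_forall fun k => by
    simp only [ρ]; apply le_of_eq; field_simp
  have hr2 : ∀ k, (ρ k).rOut ≤ δ := fun k => by
    simp only [ρ]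
    exact div_le_self hδ.le (by have : (0 : ℝ) ≤ k := k.cast_nonneg
                                linarith)
  obtain ⟨A, hA⟩ := hc.exists_bound_of_continuous hψ.continuous
  have hDb : ∀ x, ‖lineDeriv ℝ ψ x w‖ ≤ L := fun x => by
    simpa [hw1] using norm_lineDeriv_le_of_lipschitz ℝ hψ (x₀ := x) (v := w)
  set ψk : ℕ → Euc d → ℝ := fun k => (ρ k).normed volume ⋆[lsmul ℝ ℝ, volume] ψ with hψk
  have hψkD : ∀ k x, lineDeriv ℝ (ψk k) x w =
      ((ρ k).normed volume ⋆[lsmul ℝ ℝ, volume] (fun y => lineDeriv ℝ ψ y w)) x :=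
    fun k x => lineDeriv_normed_convolution (ρ k) hψ hc w x
  have hsupp : ∀ k, tsupport (ψk k) ⊆ K := by
    intro k
    refine closure_minimal ?_ hK.isClosed
    refine (support_convolution_subset (lsmul ℝ ℝ)).trans ?_
    rintro _ ⟨a, ha, b, hb, rfl⟩
    rw [(ρ k).support_normed_eq, mem_ball_zero_iff] at ha
    refine Metric.mem_cthickening_of_dist_le _ b δ _ (subset_tsupport _ hb) ?_
    simpa using ha.le.trans (hr2 k)
  have hsmooth : ∀ k, ContDiff ℝ ∞ (ψk k) := fun k =>
    (ρ k).hasCompactSupport_normed.contDiff_convolution_left _ (ρ k).contDiff_normed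
      hψ.continuous.locallyIntegrable
  have htest : ∀ k, IsTestFunction Ω (ψk k) := fun k =>
    ⟨hsmooth k, HasCompactSupport.of_support_subset_isCompact hK
      ((subset_tsupport _).trans (hsupp k)), (hsupp k).trans hKΩ⟩
  have hDz : ∀ k, ∀ x ∉ K, lineDeriv ℝ (ψk k) x w = 0 := fun k x hx => by
    rw [((hsmooth k).differentiable (by simp) x).lineDeriv_eq_fderiv,
      fderiv_of_notMem_tsupport (𝕜 := ℝ) (fun hh => hx (hsupp k hh))]
    simp
  -- the derivatives of the mollifications converge only almost everywhere, but they are bounded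
  -- by the Lipschitz constant, and dominated convergence applies
  have lim1 : Tendsto (fun k => ∫ x in Ω, v x * lineDeriv ℝ (ψk k) x w) atTop
      (𝓝 (∫ x in Ω, v x * lineDeriv ℝ ψ x w)) := by
    refine tendsto_integral_of_dominated_convergence
      (fun x => ‖v x * K.indicator (fun _ => (L : ℝ)) x‖) (fun k => ?_) ?_ (fun k => ?_) ?_
    · exact h.1.aestronglyMeasurable.mul (measurable_lineDeriv
        (hsmooth k).continuous).aestronglyMeasurable
    · refine (integrable_mul_of_locallyIntegrableOn h.1 hK hKΩ
        (aestronglyMeasurable_const.indicator hK.measurableSet) (A := L) (fun x => ?_)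
        (fun x hx => by simp [hx])).norm
      by_cases hx : x ∈ K <;> simp [hx]
    · refine Eventually.of_forall fun x => ?_
      rw [norm_mul, norm_mul]
      refine mul_le_mul_of_nonneg_left ?_ (norm_nonneg _)
      by_cases hx : x ∈ K
      · rw [hψkD]
        simpa [hx] using norm_normed_convolution_le (ρ k) hDb x
      · simp [hDz k x hx]
    · have hloc : LocallyIntegrable (fun y => lineDeriv ℝ ψ y w) volume :=
        hψ.locallyIntegrable_lineDeriv w
      filter_upwards [ae_restrict_of_ae
        (ContDiffBump.ae_convolution_tendsto_right_of_locallyIntegrable hr0 hr1 hloc)] with x hx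
      simp_rw [hψkD]
      exact hx.const_mul _
  have lim2 : Tendsto (fun k => ∫ x in Ω, ψk k x * G x i) atTop (𝓝 (∫ x in Ω, ψ x * G x i)) := by
    have hGi : LocallyIntegrableOn (fun x => G x i) Ω := fun x hx => by
      obtain ⟨s, hs, hi⟩ := h.2.1 x hx
      exact ⟨s, hs, (EuclideanSpace.proj (𝕜 := ℝ) i).integrable_comp hi⟩
    refine tendsto_integral_of_dominated_convergence
      (fun x => ‖G x i * K.indicator (fun _ => A) x‖) (fun k => ?_) ?_ (fun k => ?_) ?_
    · exact (hsmooth k).continuous.aestronglyMeasurable.mul hGi.aestronglyMeasurable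
    · refine (integrable_mul_of_locallyIntegrableOn hGi hK hKΩ
        (aestronglyMeasurable_const.indicator hK.measurableSet) (A := |A|) (fun x => ?_)
        (fun x hx => by simp [hx])).norm
      by_cases hx : x ∈ K <;> simp [hx]
    · refine Eventually.of_forall fun x => ?_
      rw [norm_mul, norm_mul, mul_comm]
      refine mul_le_mul_of_nonneg_left ?_ (norm_nonneg _)
      by_cases hx : x ∈ K
      · simpa [hx] using (norm_normed_convolution_le (ρ k) hA x).trans (le_abs_self A)
      · simp [image_eq_zero_of_notMem_tsupport (fun hh => hx (hsupp k hh))]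
    · refine Eventually.of_forall fun x => ?_
      exact (ContDiffBump.convolution_tendsto_right_of_continuous hr0 hψ.continuous x).mul_const _
  exact tendsto_nhds_unique lim1 (by
    simp_rw [hw, h.integral_testFunction (htest _) i]
    exact lim2.neg)

end Mollification

/-! ### Coordinates adapted to a graph -/

/-- Orthogonal coordinates `x = ι y + t • e` adapted to a unit vector `e`: `t = ⟪x, e⟫` is the
height of `x` in direction `e`, and `y = π x` parametrizes the hyperplane orthogonal to `e`. -/
structure HeightCoordinates {n : ℕ} (e : Euc (n + 1)) where
  norm_e : ‖e‖ = 1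
  /-- The orthogonal projection onto the hyperplane. -/
  π : Euc (n + 1) →ₗ[ℝ] (Fin n → ℝ)
  /-- The embedding of the hyperplane. -/
  ι : (Fin n → ℝ) →ₗ[ℝ] Euc (n + 1)
  lipschitz_π : LipschitzWith 1 π
  continuous_ι : Continuous ι
  π_ι : ∀ y, π (ι y) = y
  π_e : π e = 0
  inner_ι : ∀ y, ⟪ι y, e⟫ = 0
  decomp : ∀ x, ι (π x) + ⟪x, e⟫ • e = x
  /-- The coordinate map preserves the volume. -/
  measurePreserving : MeasurePreserving (fun q : (Fin n → ℝ) × ℝ => ι q.1 + q.2 • e)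

theorem nonempty_heightCoordinates {n : ℕ} {e : Euc (n + 1)} (he : ‖e‖ = 1) :
    Nonempty (HeightCoordinates e) := by
  -- `e` is extended to an orthonormal basis, with index `0`
  have hort : Orthonormal ℝ (({0} : Set (Fin (n + 1))).domRestrict (fun _ => e)) := by
    rw [orthonormal_iff_ite]
    rintro ⟨i, hi⟩ ⟨j, hj⟩
    simp only [mem_singleton_iff] at hi hj
    subst hi; subst hj
    simp only [Set.domRestrict_apply, real_inner_self_eq_norm_sq, he]
    simp
  obtain ⟨b, hb⟩ := hort.exists_orthonormalBasis_extension_of_card_eq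
    (by simp)
  have hb0 : b 0 = e := hb 0 rfl
  let π : Euc (n + 1) →ₗ[ℝ] (Fin n → ℝ) :=
    { toFun := fun x j => b.repr x j.succ
      map_add' := fun x y => by ext j; simp
      map_smul' := fun c x => by ext j; simp }
  let ι : (Fin n → ℝ) →ₗ[ℝ] Euc (n + 1) :=
    { toFun := fun y => ∑ j : Fin n, y j • b j.succ
      map_add' := fun x y => by simp [add_smul, Finset.sum_add_distrib]
      map_smul' := fun c x => by simp [Finset.smul_sum, smul_smul] }
  have hdec : ∀ x, ι (π x) + ⟪x, e⟫ • e = x := fun x => by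
    conv_rhs => rw [← b.sum_repr x, Fin.sum_univ_succ]
    rw [add_comm (b.repr x 0 • b 0)]
    simp only [π, ι, LinearMap.coe_mk, AddHom.coe_mk, hb0]
    rw [b.repr_apply_apply x 0, hb0, real_inner_comm]
  refine ⟨⟨he, π, ι, ?_, ι.continuous_of_finiteDimensional, fun y => ?_, ?_, fun y => ?_, hdec, ?_⟩⟩
  · refine LipschitzWith.of_dist_le_mul fun x y => ?_
    rw [NNReal.coe_one, one_mul, dist_pi_le_iff dist_nonneg]
    intro j
    simp only [π, LinearMap.coe_mk, AddHom.coe_mk]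
    rw [← b.repr.dist_map x y]
    exact PiLp.dist_apply_le _ _ _
  · ext j
    simp only [π, ι, LinearMap.coe_mk, AddHom.coe_mk, map_sum, map_smul, b.repr_self]
    simp [Finset.sum_apply]
  · ext j
    simp only [π, LinearMap.coe_mk, AddHom.coe_mk, ← hb0, b.repr_self]
    simp
  · simp only [ι, LinearMap.coe_mk, AddHom.coe_mk, sum_inner, inner_smul_left]
    refine Finset.sum_eq_zero fun j _ => ?_
    rw [← hb0, b.inner_eq_zero (Fin.succ_ne_zero j), mul_zero]
  · have h1 := b.measurePreserving_repr_symm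
    have h2 := PiLp.volume_preserving_toLp (Fin (n + 1))
    have h3 := (volume_preserving_piFinSuccAbove (fun _ : Fin (n + 1) => ℝ) 0).symm
    have h4 : MeasurePreserving (Prod.swap : (Fin n → ℝ) × ℝ → ℝ × (Fin n → ℝ)) :=
      Measure.measurePreserving_swap
    have h5 := h1.comp (h2.comp (h3.comp h4))
    have h6 : ∀ f : Euc (n+1), b.repr.symm f = ∑ i, f i • b i := fun f => by
      conv_rhs => rw [← b.repr.apply_symm_apply f]
      exact (b.sum_repr _).symm
    have h7 : (fun q : (Fin n → ℝ) × ℝ => ι q.1 + q.2 • e) = b.repr.symm ∘ WithLp.toLp 2 ∘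
        (MeasurableEquiv.piFinSuccAbove (fun _ : Fin (n + 1) => ℝ) 0).symm ∘ Prod.swap := by
      funext q
      rw [Function.comp_apply, h6, Fin.sum_univ_succ, hb0, add_comm (_ • e)]
      rfl
    rw [h7]
    exact h5

namespace HeightCoordinates

theorem continuous_π {n : ℕ} {e : Euc (n + 1)} (c : HeightCoordinates e) : Continuous c.π :=
  c.lipschitz_π.continuous

end HeightCoordinates

/-! ### Fluxes through graphs -/

namespace HeightCoordinates

variable {n : ℕ} {e : Euc (n + 1)} (c : HeightCoordinates e)

/-- The point at height `t` above the graph of `γ` over the point `y` of the hyperplane. -/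
def shear (γ : Euc (n + 1) → ℝ) (q : (Fin n → ℝ) × ℝ) : Euc (n + 1) :=
  c.ι q.1 + (q.2 + γ (c.ι q.1)) • e

theorem continuous_shear {γ : Euc (n + 1) → ℝ} (hγ : Continuous γ) : Continuous (c.shear γ) := by
  have := c.continuous_ι
  unfold shear
  fun_prop

theorem π_shear (γ : Euc (n + 1) → ℝ) (q : (Fin n → ℝ) × ℝ) : c.π (c.shear γ q) = q.1 := by
  simp [shear, c.π_ι, c.π_e]

theorem inner_shear (γ : Euc (n + 1) → ℝ) (q : (Fin n → ℝ) × ℝ) :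
    ⟪c.shear γ q, e⟫ = q.2 + γ (c.ι q.1) := by
  simp [shear, inner_add_left, inner_smul_left, c.inner_ι, c.norm_e]

/-- Sliding points along `e` onto the graph of `γ` preserves the volume. -/
theorem measurePreserving_shear {γ : Euc (n + 1) → ℝ} (hγ : Continuous γ) :
    MeasurePreserving (c.shear γ) := by
  have hm : Measurable (Function.uncurry fun (y : Fin n → ℝ) (t : ℝ) => t + γ (c.ι y)) := by
    have := c.continuous_ι
    exact Continuous.measurable (by fun_prop)
  have h := MeasurePreserving.skew_product (MeasurePreserving.id (volume : Measure (Fin n → ℝ)))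
    (μc := (volume : Measure ℝ)) (μd := volume) hm
    (Eventually.of_forall fun y => (measurePreserving_add_right volume (γ (c.ι y))).map_eq)
  exact c.measurePreserving.comp h

/-- The image on the graph of `γ` of the Lebesgue measure of the hyperplane, for the part of the
graph that lies in `U`. -/
noncomputable def graphMeasure (γ : Euc (n + 1) → ℝ) (U : Set (Euc (n + 1))) :
    Measure (Euc (n + 1)) :=
  (volume.restrict {y | c.shear γ (y, 0) ∈ U}).map fun y => c.shear γ (y, 0)

/-- Since the projection onto the hyperplane does not increase distances, the Lebesgue measure
of the hyperplane is dominated by the surface measure of the graph. -/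
theorem graphMeasure_le_surfaceMeasure {γ : Euc (n + 1) → ℝ} (hγ : Continuous γ)
    {Ω U : Set (Euc (n + 1))}
    (hfr : ∀ y, c.shear γ (y, 0) ∈ U → c.shear γ (y, 0) ∈ frontier Ω) :
    c.graphMeasure γ U ≤ surfaceMeasure Ω := by
  have hG : Measurable fun y : Fin n → ℝ => c.shear γ (y, 0) :=
    ((c.continuous_shear hγ).comp (by fun_prop)).measurable
  refine Measure.le_iff.2 fun A hA => ?_
  rw [graphMeasure, Measure.map_apply hG hA, Measure.restrict_apply (hG hA), surfaceMeasure,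
    Measure.restrict_apply hA]
  have h1 : (fun y : Fin n → ℝ => c.shear γ (y, 0)) ⁻¹' A ∩ {y | c.shear γ (y, 0) ∈ U}
      ⊆ c.π '' (A ∩ frontier Ω) := fun y hy =>
    ⟨c.shear γ (y, 0), ⟨hy.1, hfr y hy.2⟩, c.π_shear γ _⟩
  refine (measure_mono h1).trans ?_
  rw [← hausdorffMeasure_pi_real]
  have h2 := c.lipschitz_π.hausdorffMeasure_image_le (d := (Fintype.card (Fin n) : ℝ))
    (Nat.cast_nonneg _) (A ∩ frontier Ω)
  simpa using h2

theorem apply_shear {F : Type*} {γ : Euc (n + 1) → ℝ} {N : Euc (n + 1) → F}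
    (hN : ∀ (x : Euc (n + 1)) (t : ℝ), N (x + t • e) = N x) (q : (Fin n → ℝ) × ℝ) :
    N (c.shear γ q) = N (c.ι q.1) := hN _ _

/-- The fluxes through the translates of a graph converge to the flux through the graph. -/
theorem tendsto_lintegral_shear {γ : Euc (n + 1) → ℝ} (hγ : Continuous γ)
    {Z N : Euc (n + 1) → Euc (n + 1)} (hZ : Continuous Z) (hZc : HasCompactSupport Z)
    (hN : ∀ (x : Euc (n + 1)) (t : ℝ), N (x + t • e) = N x) (hNm : Measurable N) {Λ : ℝ}
    (hΛ : ∀ x, ‖N x‖ ≤ Λ) :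
    Tendsto (fun t => ∫⁻ y, ‖⟪Z (c.shear γ (y, t)), N (c.shear γ (y, t))⟫‖ₑ) (𝓝 0)
      (𝓝 (∫⁻ y, ‖⟪Z (c.shear γ (y, 0)), N (c.shear γ (y, 0))⟫‖ₑ)) := by
  have hS := c.continuous_shear hγ
  obtain ⟨A, hA⟩ := hZc.exists_bound_of_continuous hZ
  have hΛ0 : 0 ≤ Λ := (norm_nonneg _).trans (hΛ 0)
  have hA0 : 0 ≤ A := (norm_nonneg _).trans (hA 0)
  -- `Z` vanishes outside the cylinder over the compact set `K`
  set K : Set (Fin n → ℝ) := c.π '' tsupport Z with hK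
  have hKc : IsCompact K := IsCompact.image hZc c.continuous_π
  refine tendsto_lintegral_filter_of_dominated_convergence
    (K.indicator fun _ => ENNReal.ofReal (A * Λ)) (Eventually.of_forall fun t => ?_)
    (Eventually.of_forall fun t => Eventually.of_forall fun y => ?_) ?_
    (Eventually.of_forall fun y => ?_)
  · have h1 : Measurable fun y : Fin n → ℝ => c.shear γ (y, t) :=
      (hS.comp (by fun_prop)).measurable
    exact ((hZ.measurable.comp h1).inner (hNm.comp h1)).enorm
  · by_cases hy : y ∈ K
    · rw [indicator_of_mem hy, ← ofReal_norm]
      refine ENNReal.ofReal_le_ofReal ((norm_inner_le_norm _ _).trans ?_)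
      exact mul_le_mul (hA _) (hΛ _) (norm_nonneg _) hA0
    · have : Z (c.shear γ (y, t)) = 0 := by
        refine image_eq_zero_of_notMem_tsupport fun h => hy ⟨_, h, c.π_shear γ _⟩
      simp [this]
  · rw [lintegral_indicator hKc.measurableSet, setLIntegral_const]
    exact ENNReal.mul_ne_top ENNReal.ofReal_ne_top hKc.measure_lt_top.ne
  · simp_rw [c.apply_shear hN]
    have : Continuous fun t : ℝ => ‖⟪Z (c.shear γ (y, t)), N (c.ι y)⟫‖ₑ :=
      continuous_enorm.comp ((hZ.comp (hS.comp (by fun_prop))).inner continuous_const)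
    exact this.tendsto 0

/-- The mean flux through a thin layer above the graph of `γ`, with a weight that is concentrated
on heights between `0` and `2 s`, is asymptotically bounded by the flux through the graph. -/
theorem eventually_lintegral_layer_le {γ : Euc (n + 1) → ℝ} (hγ : Continuous γ)
    (hγe : ∀ (x : Euc (n + 1)) (t : ℝ), γ (x + t • e) = γ x)
    {Z N : Euc (n + 1) → Euc (n + 1)} (hZ : Continuous Z) (hZc : HasCompactSupport Z)
    (hN : ∀ (x : Euc (n + 1)) (t : ℝ), N (x + t • e) = N x) (hNm : Measurable N) {Λ : ℝ}
    (hΛ : ∀ x, ‖N x‖ ≤ Λ) {κ : ℝ → ℝ} (hκm : Measurable κ) {C : ℝ≥0} (hκ : ∀ t, ‖κ t‖ₑ ≤ C)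
    (hκ0 : ∀ t ∉ Icc (0 : ℝ) 2, κ t = 0) {B : ℝ≥0∞}
    (hB : ∫⁻ y, ‖⟪Z (c.shear γ (y, 0)), N (c.shear γ (y, 0))⟫‖ₑ < B) :
    ∀ᶠ s in 𝓝[>] (0 : ℝ),
      ∫⁻ x, ‖s⁻¹ * κ (s⁻¹ * (⟪x, e⟫ - γ x)) * ⟪Z x, N x⟫‖ₑ ≤ 2 * C * B := by
  have hS := c.continuous_shear hγ
  have h1 := (c.tendsto_lintegral_shear hγ hZ hZc hN hNm hΛ).eventually (gt_mem_nhds hB)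
  obtain ⟨ε, hε, h2⟩ := Metric.eventually_nhds_iff.1 h1
  have h3 : ∀ᶠ s in 𝓝[>] (0 : ℝ), s < ε / 2 :=
    nhdsWithin_le_nhds (gt_mem_nhds (by positivity))
  filter_upwards [h3, self_mem_nhdsWithin] with s hs hs0
  rw [mem_Ioi] at hs0
  have hm : Measurable fun x : Euc (n + 1) =>
      ‖s⁻¹ * κ (s⁻¹ * (⟪x, e⟫ - γ x)) * ⟪Z x, N x⟫‖ₑ := by
    have h4 : Measurable fun x : Euc (n + 1) => s⁻¹ * (⟪x, e⟫ - γ x) :=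
      Continuous.measurable (by fun_prop)
    exact (((hκm.comp h4).const_mul _).mul (hZ.measurable.inner hNm)).enorm
  have hm' : Measurable fun q : (Fin n → ℝ) × ℝ =>
      ‖s⁻¹ * κ (s⁻¹ * q.2) * ⟪Z (c.shear γ q), N (c.shear γ q)⟫‖ₑ := by
    refine Measurable.enorm (Measurable.mul ?_ ?_)
    · exact (hκm.comp (measurable_snd.const_mul _)).const_mul _
    · exact (hZ.measurable.comp hS.measurable).inner (hNm.comp hS.measurable)
  -- in the coordinates `(y, t)` the weight depends only on `t`, so Tonelli's theorem reduces the
  -- claim to the fluxes through the graphs at heights `t ≤ 2 s`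
  rw [← (c.measurePreserving_shear hγ).lintegral_comp hm]
  simp_rw [c.inner_shear, c.apply_shear hγe, add_sub_cancel_right]
  rw [Measure.volume_eq_prod, lintegral_prod_symm _ hm'.aemeasurable]
  calc ∫⁻ t : ℝ, ∫⁻ y : Fin n → ℝ,
          ‖s⁻¹ * κ (s⁻¹ * t) * ⟪Z (c.shear γ (y, t)), N (c.shear γ (y, t))⟫‖ₑ
      ≤ ∫⁻ t : ℝ, (Icc 0 (2 * s)).indicator (fun _ => ENNReal.ofReal s⁻¹ * C * B) t := by
        refine lintegral_mono fun t => ?_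
        by_cases ht : t ∈ Icc 0 (2 * s)
        · rw [indicator_of_mem ht]
          simp_rw [enorm_mul]
          rw [lintegral_const_mul']
          · refine mul_le_mul' (mul_le_mul' ?_ (hκ _)) (h2 ?_).le
            · rw [Real.enorm_of_nonneg (by positivity)]
            · rw [dist_zero_right, Real.norm_of_nonneg ht.1]
              linarith [ht.2]
          · exact ENNReal.mul_ne_top enorm_ne_top enorm_ne_top
        · have : s⁻¹ * t ∉ Icc (0 : ℝ) 2 := by
            contrapose ht
            rw [← div_eq_inv_mul] at ht
            refine ⟨?_, ?_⟩
            · have := ht.1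
              rwa [le_div_iff₀ hs0, zero_mul] at this
            · exact (div_le_iff₀ hs0).1 ht.2
          rw [indicator_of_notMem ht]
          simp [hκ0 _ this]
    _ = 2 * C * B := by
        rw [lintegral_indicator measurableSet_Icc, setLIntegral_const, Real.volume_Icc, sub_zero,
          mul_comm, ← mul_assoc, ← mul_assoc, ← ENNReal.ofReal_mul (by positivity),
          mul_assoc 2, mul_inv_cancel₀ hs0.ne', mul_one, ENNReal.ofReal_ofNat]

end HeightCoordinates

/-- A smooth step from `0` to `1` between `1` and `2`, with bounded derivative. -/
theorem exists_smooth_step : ∃ (k : ℝ → ℝ) (C : ℝ≥0), ContDiff ℝ 1 k ∧ (∀ t, 0 ≤ k t) ∧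
    (∀ t, k t ≤ 1) ∧ (∀ t ≤ 1, k t = 0) ∧ (∀ t, 2 ≤ t → k t = 1) ∧ (∀ t, ‖deriv k t‖ₑ ≤ C) ∧
    (∀ t ∉ Icc (0 : ℝ) 2, deriv k t = 0) := by
  set k : ℝ → ℝ := fun t => Real.smoothTransition (t - 1) with hk
  have hk1 : ContDiff ℝ 1 k := Real.smoothTransition.contDiff.comp (contDiff_id.sub contDiff_const)
  have h0 : ∀ t ≤ 1, k t = 0 := fun t ht => Real.smoothTransition.zero_of_nonpos (by linarith)
  have h1 : ∀ t, 2 ≤ t → k t = 1 := fun t ht => Real.smoothTransition.one_of_one_le (by linarith)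
  have hd : ∀ t ∉ Icc (0 : ℝ) 2, deriv k t = 0 := by
    intro t ht
    rw [mem_Icc, not_and_or, not_le, not_le] at ht
    rcases ht with ht | ht
    · have : k =ᶠ[𝓝 t] fun _ => (0 : ℝ) := by
        filter_upwards [gt_mem_nhds ht] with s hs using h0 s (by linarith)
      rw [this.deriv_eq, deriv_const]
    · have : k =ᶠ[𝓝 t] fun _ => (1 : ℝ) := by
        filter_upwards [lt_mem_nhds ht] with s hs using h1 s hs.le
      rw [this.deriv_eq, deriv_const]
  have hc : Continuous (deriv k) := hk1.continuous_deriv le_rfl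
  obtain ⟨C, hC⟩ := (HasCompactSupport.intro isCompact_Icc hd).exists_bound_of_continuous hc
  refine ⟨k, C.toNNReal, hk1, fun t => Real.smoothTransition.nonneg _,
    fun t => Real.smoothTransition.le_one _, h0, h1, fun t => ?_, hd⟩
  rw [← ofReal_norm]
  exact ENNReal.ofReal_le_ofReal (hC t)

/-! ### Charts of the boundary -/

/-- Near `z` the set `Ω` is the part above the graph of `γ` in direction `e`. -/
structure IsGraphChart {d : ℕ} (Ω : Set (Euc d)) (z e : Euc d) (ρ : ℝ) (L : ℝ≥0)
    (γ : Euc d → ℝ) : Prop where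
  norm_e : ‖e‖ = 1
  lipschitz : LipschitzWith L γ
  invariant : ∀ (x : Euc d) (t : ℝ), γ (x + t • e) = γ x
  mem_iff : ∀ x ∈ Metric.ball z ρ, (x ∈ Ω ↔ γ x < ⟪x, e⟫)

theorem IsLipschitzDomain.exists_chart {d : ℕ} {Ω : Set (Euc d)} (hΩ : IsLipschitzDomain Ω)
    {z : Euc d} (hz : z ∈ frontier Ω) :
    ∃ (e : Euc d) (ρ : ℝ) (L : ℝ≥0) (γ : Euc d → ℝ), 0 < ρ ∧ IsGraphChart Ω z e ρ L γ := by
  obtain ⟨e, ρ, L, γ, h1, h2, h3, h4, h5⟩ := hΩ.boundary_graph z hz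
  exact ⟨e, ρ, L, γ, h2, h1, h3, h4, h5⟩

namespace IsGraphChart

variable {d : ℕ} {Ω : Set (Euc d)} {z e : Euc d} {ρ : ℝ} {L : ℝ≥0} {γ : Euc d → ℝ}

theorem inner_add_smul (h : IsGraphChart Ω z e ρ L γ) (x : Euc d) (t : ℝ) :
    ⟪x + t • e, e⟫ = ⟪x, e⟫ + t := by
  simp [inner_add_left, inner_smul_left, h.norm_e]

theorem tendsto_add_smul (e x : Euc d) : Tendsto (fun t : ℝ => x + t • e) (𝓝 0) (𝓝 x) := by
  have h : Continuous fun t : ℝ => x + t • e := by fun_prop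
  simpa using h.tendsto 0

/-- Points of the graph in the ball are boundary points: moving up along `e` leads into `Ω`. -/
theorem mem_frontier (h : IsGraphChart Ω z e ρ L γ) {x : Euc d} (hx : x ∈ Metric.ball z ρ)
    (hγ : γ x = ⟪x, e⟫) : x ∈ frontier Ω := by
  have hev : ∀ᶠ t in 𝓝[>] (0 : ℝ), x + t • e ∈ Metric.ball z ρ :=
    nhdsWithin_le_nhds ((tendsto_add_smul e x).eventually (Metric.isOpen_ball.mem_nhds hx))
  refine ⟨?_, fun hi => ?_⟩
  · refine mem_closure_of_tendsto ((tendsto_add_smul e x).mono_left nhdsWithin_le_nhds)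
      (b := 𝓝[>] (0 : ℝ)) ?_
    filter_upwards [hev, self_mem_nhdsWithin] with t ht ht0
    rw [h.mem_iff _ ht, h.invariant, h.inner_add_smul, hγ]
    exact lt_add_of_pos_right _ ht0
  · exact absurd ((h.mem_iff x hx).1 (interior_subset hi)) (by rw [hγ]; exact lt_irrefl _)

theorem notMem_interior_closure (h : IsGraphChart Ω z e ρ L γ) (hΩ : IsOpen Ω) (hρ : 0 < ρ)
    (hz : z ∈ frontier Ω) : z ∉ interior (closure Ω) := by
  intro hi
  have hzb : z ∈ Metric.ball z ρ := Metric.mem_ball_self hρ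
  have hzΩ : z ∉ Ω := fun hz' => hz.2 (by rwa [hΩ.interior_eq])
  have hle : ⟪z, e⟫ ≤ γ z := not_lt.1 fun hlt => hzΩ ((h.mem_iff z hzb).2 hlt)
  -- points just below the boundary have a neighbourhood outside the domain
  have hev : ∀ᶠ t in 𝓝[<] (0 : ℝ), z + t • e ∈ Metric.ball z ρ ∩ interior (closure Ω) :=
    nhdsWithin_le_nhds ((tendsto_add_smul e z).eventually
      ((Metric.isOpen_ball.inter isOpen_interior).mem_nhds ⟨hzb, hi⟩))
  obtain ⟨t, ht, ht0⟩ := (hev.and self_mem_nhdsWithin).exists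
  have hopen : IsOpen (Metric.ball z ρ ∩ {y | ⟪y, e⟫ < γ y}) :=
    Metric.isOpen_ball.inter (isOpen_lt (by fun_prop) h.lipschitz.continuous)
  have hmem : z + t • e ∈ Metric.ball z ρ ∩ {y | ⟪y, e⟫ < γ y} := by
    refine ⟨ht.1, ?_⟩
    rw [mem_ofPred_eq, h.invariant, h.inner_add_smul]
    linarith
  obtain ⟨y, hy, hyΩ⟩ := mem_closure_iff.1 (interior_subset ht.2) _ hopen hmem
  exact absurd ((h.mem_iff y hy.1).1 hyΩ) (not_lt.2 (le_of_lt hy.2))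

theorem gradient_add_smul (h : IsGraphChart Ω z e ρ L γ) (x : Euc d) (t : ℝ) :
    gradient γ (x + t • e) = gradient γ x := by
  unfold gradient
  rw [← fderiv_comp_add_right]
  simp_rw [h.invariant]

theorem norm_gradient_le (h : IsGraphChart Ω z e ρ L γ) (x : Euc d) : ‖gradient γ x‖ ≤ L := by
  unfold gradient
  rw [LinearIsometryEquiv.norm_map]
  exact norm_fderiv_le_of_lipschitz ℝ h.lipschitz

theorem measurable_gradient {γ : Euc d → ℝ} : Measurable (gradient γ) :=
  (InnerProductSpace.toDual ℝ (Euc d)).symm.continuous.measurable.comp (measurable_fderiv ℝ γ)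

theorem inner_gradient_self (h : IsGraphChart Ω z e ρ L γ) {x : Euc d}
    (hx : DifferentiableAt ℝ γ x) : ⟪gradient γ x, e⟫ = 0 := by
  rw [inner_gradient_left, ← hx.lineDeriv_eq_fderiv]
  simp [lineDeriv, h.invariant]

/-- Where `γ` is differentiable, `∇γ - e` is a normal of the graph that points out of `Ω`. -/
theorem isOuterUnitNormal (h : IsGraphChart Ω z e ρ L γ) {x : Euc d}
    (hx : x ∈ Metric.ball z ρ) (hγ : γ x = ⟪x, e⟫) (hd : DifferentiableAt ℝ γ x) :
    0 < ‖gradient γ x - e‖ ∧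
      IsOuterUnitNormal Ω x (‖gradient γ x - e‖⁻¹ • (gradient γ x - e)) := by
  set N := gradient γ x - e with hN
  have hN0 : 0 < ‖N‖ := by
    rw [norm_pos_iff]
    intro h0
    have h1 : ⟪N, e⟫ = -1 := by
      rw [hN, inner_sub_left, h.inner_gradient_self hd, real_inner_self_eq_norm_sq, h.norm_e]
      norm_num
    rw [h0, inner_zero_left] at h1
    norm_num at h1
  refine ⟨hN0, ?_, fun ε hε => ?_⟩
  · rw [norm_smul, norm_inv, norm_norm, inv_mul_cancel₀ hN0.ne']
  have hlo := (hd.hasGradientAt.hasFDerivAt).isLittleO.def (c := ε * ‖N‖) (by positivity)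
  filter_upwards [hlo, Metric.isOpen_ball.mem_nhds hx] with y hy hyb
  have h1 : ⟪y, e⟫ = ⟪x, e⟫ + ⟪y - x, e⟫ := by rw [inner_sub_left]; ring
  have h2 : ⟪y - x, N⟫ = ⟪gradient γ x, y - x⟫ - ⟪y - x, e⟫ := by
    rw [hN, inner_sub_right, real_inner_comm]
  rw [InnerProductSpace.toDual_apply_apply, Real.norm_eq_abs, abs_le] at hy
  rw [inner_smul_right, h.mem_iff y hyb, not_lt, ← div_eq_inv_mul, lt_div_iff₀ hN0,
    div_lt_iff₀ hN0, neg_mul]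
  constructor <;> intro h3 <;> nlinarith [hy.1, hy.2]

end IsGraphChart

/-- A Lipschitz domain has no slits: subsets of its closure that are open lie in the domain. -/
theorem IsLipschitzDomain.interior_closure {d : ℕ} {Ω : Set (Euc d)} (hΩ : IsLipschitzDomain Ω) :
    interior (closure Ω) = Ω := by
  refine Subset.antisymm (fun x hx => ?_) hΩ.isOpen.subset_interior_closure
  by_contra hxΩ
  have hfr : x ∈ frontier Ω := ⟨interior_subset hx, by rwa [hΩ.isOpen.interior_eq]⟩
  obtain ⟨e, ρ, L, γ, hρ, h⟩ := hΩ.exists_chart hfr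
  exact h.notMem_interior_closure hΩ.isOpen hρ hfr hx

/-- Almost every point of the part of the graph in the chart is a point of differentiability of
`γ`: by Rademacher's theorem in `ℝ^(n+1)` and Fubini's theorem, as differentiability of `γ` is
invariant along `e`. -/
theorem IsGraphChart.ae_graphMeasure {n : ℕ} {Ω : Set (Euc (n + 1))} {z e : Euc (n + 1)} {ρ : ℝ}
    {L : ℝ≥0} {γ : Euc (n + 1) → ℝ} (h : IsGraphChart Ω z e ρ L γ) (c : HeightCoordinates e) :
    ∀ᵐ x ∂(c.graphMeasure γ (Metric.ball z ρ)), x ∈ Metric.ball z ρ ∧ γ x = ⟪x, e⟫ ∧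
      DifferentiableAt ℝ γ x := by
  have hγ := h.lipschitz.continuous
  have hG : Measurable fun y : Fin n → ℝ => c.shear γ (y, 0) :=
    ((c.continuous_shear hγ).comp (by fun_prop)).measurable
  have hY : MeasurableSet {y | c.shear γ (y, 0) ∈ Metric.ball z ρ} :=
    hG Metric.isOpen_ball.measurableSet
  have hd : ∀ (x : Euc (n + 1)) (t : ℝ), DifferentiableAt ℝ γ (x + t • e) ↔
      DifferentiableAt ℝ γ x := fun x t => by
    rw [← differentiableAt_comp_add_right]
    simp_rw [h.invariant]
  have h1 := (c.measurePreserving_shear hγ).quasiMeasurePreserving.ae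
    (h.lipschitz.ae_differentiableAt (μ := volume))
  have h2 : ∀ᵐ q : (Fin n → ℝ) × ℝ, DifferentiableAt ℝ γ (c.ι q.1) := by
    filter_upwards [h1] with q hq
    exact (hd _ _).1 hq
  rw [Measure.volume_eq_prod] at h2
  have h3 : ∀ᵐ y : Fin n → ℝ, DifferentiableAt ℝ γ (c.ι y) := by
    filter_upwards [Measure.ae_ae_of_ae_prod h2] with y hy
    exact hy.exists.elim fun _ h => h
  have hm : MeasurableSet {x | x ∈ Metric.ball z ρ ∧ γ x = ⟪x, e⟫ ∧ DifferentiableAt ℝ γ x} :=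
    Metric.isOpen_ball.measurableSet.inter
      ((measurableSet_eq_fun hγ.measurable (by fun_prop)).inter
        (measurableSet_of_differentiableAt ℝ γ))
  rw [HeightCoordinates.graphMeasure, ae_map_iff hG.aemeasurable hm, ae_restrict_iff' hY]
  filter_upwards [h3] with y hy hyb
  refine ⟨hyb, ?_, (hd _ _).2 hy⟩
  rw [c.inner_shear, zero_add]
  exact h.invariant _ _

theorem IsGraphChart.graphMeasure_le_surfaceMeasure {n : ℕ} {Ω : Set (Euc (n + 1))}
    {z e : Euc (n + 1)} {ρ : ℝ} {L : ℝ≥0} {γ : Euc (n + 1) → ℝ}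
    (h : IsGraphChart Ω z e ρ L γ) (c : HeightCoordinates e) :
    c.graphMeasure γ (Metric.ball z ρ) ≤ surfaceMeasure Ω := by
  refine c.graphMeasure_le_surfaceMeasure h.lipschitz.continuous fun y hy =>
    h.mem_frontier hy ?_
  rw [c.inner_shear, zero_add]
  exact h.invariant _ _

/-! ### The flux estimate at the boundary -/

section FluxBound

/-- The divergence of a vector field. -/
noncomputable def divergence {d : ℕ} (Z : Euc d → Euc d) (x : Euc d) : ℝ :=
  ∑ i, fderiv ℝ Z x (EuclideanSpace.single i 1) i

theorem lipschitzWith_mul_of_bound {d : ℕ} {f g : Euc d → ℝ} {Lf Lg A B : ℝ≥0}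
    (hf : LipschitzWith Lf f) (hg : LipschitzWith Lg g) (hA : ∀ x, ‖f x‖ ≤ A)
    (hB : ∀ x, ‖g x‖ ≤ B) : LipschitzWith (A * Lg + B * Lf) (fun x => f x * g x) := by
  refine LipschitzWith.of_dist_le_mul fun x y => ?_
  have h1 := hf.dist_le_mul x y
  have h2 := hg.dist_le_mul x y
  rw [Real.dist_eq] at h1 h2 ⊢
  have : f x * g x - f y * g y = f x * (g x - g y) + g y * (f x - f y) := by ring
  rw [this]
  refine (abs_add_le _ _).trans ?_
  rw [abs_mul, abs_mul]
  have h3 := hA x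
  have h4 := hB y
  rw [Real.norm_eq_abs] at h3 h4
  push_cast
  calc |f x| * |g x - g y| + |g y| * |f x - f y|
      ≤ A * (Lg * dist x y) + B * (Lf * dist x y) := by gcongr
    _ = _ := by ring

theorem continuous_divergence {d : ℕ} {Z : Euc d → Euc d} (hZ : ContDiff ℝ 1 Z) :
    Continuous (divergence Z) := by
  refine continuous_finsetSum _ fun i _ => ?_
  exact (EuclideanSpace.proj (𝕜 := ℝ) i).continuous.comp
    ((hZ.continuous_fderiv one_ne_zero).clm_apply continuous_const)

theorem divergence_of_notMem_tsupport {d : ℕ} {Z : Euc d → Euc d} {x : Euc d}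
    (hx : x ∉ tsupport Z) : divergence Z x = 0 := by
  simp [divergence, fderiv_of_notMem_tsupport (𝕜 := ℝ) hx]

theorem integrable_mul_of_memLp_top {d : ℕ} {Ω K : Set (Euc d)} {v a : Euc d → ℝ}
    (hv : MemLp v ∞ (volume.restrict Ω)) (hK : IsCompact K) (ha : AEStronglyMeasurable a volume)
    {A : ℝ} (hA : ∀ x, ‖a x‖ ≤ A) (h0 : ∀ x ∉ K, a x = 0) :
    Integrable (fun x => v x * a x) (volume.restrict Ω) := by
  have h1 : Integrable a volume := by
    refine (integrableOn_iff_integrable_of_support_subset (s := K) fun x hx => ?_).1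
      (Measure.integrableOn_of_bounded hK.measure_lt_top.ne ha (M := A)
        (Eventually.of_forall hA))
    by_contra h
    exact hx (h0 x h)
  exact h1.restrict.mul_of_top_right hv

theorem memLp_apply {d : ℕ} {μ : Measure (Euc d)} {p : ℝ≥0∞} {G : Euc d → Euc d}
    (hG : MemLp G p μ) (i : Fin d) : MemLp (fun x => G x i) p μ :=
  (EuclideanSpace.proj (𝕜 := ℝ) i).comp_memLp' hG

theorem IsW1Infty.integrable_mul_divergence_add {d : ℕ} {Ω : Set (Euc d)} {β : Euc d → ℝ}
    {Dβ : Euc d → Euc d} (hβ : IsW1Infty Ω β Dβ) {Z : Euc d → Euc d} (hZ : ContDiff ℝ 1 Z)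
    (hZc : HasCompactSupport Z) :
    Integrable (fun x => β x * divergence Z x + ⟪Dβ x, Z x⟫) (volume.restrict Ω) := by
  have hdiv := continuous_divergence hZ
  refine Integrable.add ?_ ?_
  · obtain ⟨A, hA⟩ := (HasCompactSupport.intro (f := divergence Z) hZc
      fun x hx => divergence_of_notMem_tsupport hx).exists_bound_of_continuous hdiv
    exact integrable_mul_of_memLp_top hβ.2.1 hZc hdiv.aestronglyMeasurable hA
      fun x hx => divergence_of_notMem_tsupport hx
  · obtain ⟨A, hA⟩ := hZc.exists_bound_of_continuous hZ.continuous
    simp_rw [PiLp.inner_apply]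
    refine integrable_finsetSum _ fun i _ => ?_
    have := integrable_mul_of_memLp_top (memLp_apply hβ.2.2 i) (a := fun x => Z x i) (A := A) hZc
      ((EuclideanSpace.proj (𝕜 := ℝ) i).continuous.comp hZ.continuous).aestronglyMeasurable
      (fun x => (PiLp.norm_apply_le _ i).trans (hA x))
      fun x hx => by simp [image_eq_zero_of_notMem_tsupport hx]
    simpa [mul_comm] using this

variable {n : ℕ} {Ω : Set (Euc (n + 1))} {z e : Euc (n + 1)} {ρ : ℝ} {L : ℝ≥0}
  {γ : Euc (n + 1) → ℝ}

/-- The weak gradient of `β` tested with the vector field `χ Z`, where `χ = k ((⟪x, e⟫ - γ x) / s)`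
is a cut-off function that vanishes near the graph of `γ`. As `γ` is only Lipschitz, `χ Z` is not
smooth, and `HasWeakGradient.integral_lipschitz` is needed. -/
theorem IsGraphChart.integral_cutoff (h : IsGraphChart Ω z e ρ L γ) (hΩ : IsOpen Ω)
    {β : Euc (n + 1) → ℝ} {Dβ : Euc (n + 1) → Euc (n + 1)} (hβ : IsW1Infty Ω β Dβ)
    {Z : Euc (n + 1) → Euc (n + 1)} (hZ : ContDiff ℝ 1 Z) (hZc : HasCompactSupport Z)
    (hZs : tsupport Z ⊆ Metric.ball z ρ) {k : ℝ → ℝ} {C : ℝ≥0} (hk : ContDiff ℝ 1 k)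
    (hk0 : ∀ t, 0 ≤ k t) (hk1 : ∀ t, k t ≤ 1) (hkz : ∀ t ≤ 1, k t = 0)
    (hkC : ∀ t, ‖deriv k t‖ₑ ≤ C) {s : ℝ} (hs : 0 < s) :
    ∫ x in Ω, k (s⁻¹ * (⟪x, e⟫ - γ x)) * (β x * divergence Z x + ⟪Dβ x, Z x⟫) =
      -∫ x in Ω, β x *
        (s⁻¹ * deriv k (s⁻¹ * (⟪x, e⟫ - γ x)) * ⟪Z x, e - gradient γ x⟫) := by
  have hγ := h.lipschitz.continuous
  set τ : Euc (n + 1) → ℝ := fun x => s⁻¹ * (⟪x, e⟫ - γ x) with hτ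
  have hτc : Continuous τ := by fun_prop
  set χ : Euc (n + 1) → ℝ := fun x => k (τ x) with hχ
  have hkL : LipschitzWith C k := lipschitzWith_of_nnnorm_deriv_le
    (hk.differentiable one_ne_zero) fun t => by exact_mod_cast hkC t
  obtain ⟨Lχ, hχL⟩ : ∃ Lχ, LipschitzWith Lχ χ := by
    have h1 : LipschitzWith 1 (fun x : Euc (n + 1) => ⟪x, e⟫) := by
      refine LipschitzWith.of_dist_le_mul fun x y => ?_
      rw [Real.dist_eq, ← inner_sub_left, NNReal.coe_one, one_mul, dist_eq_norm]
      simpa [h.norm_e] using abs_real_inner_le_norm (x - y) e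
    have h2 : LipschitzWith _ τ := (lipschitzWith_smul s⁻¹).comp (h1.sub h.lipschitz)
    exact ⟨_, hkL.comp h2⟩
  have hχb : ∀ x, ‖χ x‖ ≤ (1 : ℝ≥0) := fun x => by
    rw [Real.norm_of_nonneg (hk0 _)]; exact hk1 _
  obtain ⟨A, hA⟩ := hZc.exists_bound_of_continuous hZ.continuous
  have hA0 : 0 ≤ A := (norm_nonneg _).trans (hA 0)
  obtain ⟨LZ, hLZ⟩ := hZ.lipschitzWith_of_hasCompactSupport hZc one_ne_zero
  -- the test functions and their derivatives
  have hψL : ∀ i, ∃ L', LipschitzWith L' (fun x => χ x * Z x i) := fun i => by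
    refine ⟨_, lipschitzWith_mul_of_bound (B := A.toNNReal) hχL (g := fun x => Z x i) (Lg := LZ)
      (LipschitzWith.of_dist_le_mul fun x y => ?_) hχb fun x => ?_⟩
    · exact (PiLp.dist_apply_le _ _ i).trans (hLZ.dist_le_mul x y)
    · rw [Real.coe_toNNReal A hA0]
      exact (PiLp.norm_apply_le _ i).trans (hA x)
  have hψs : ∀ i, tsupport (fun x => χ x * Z x i) ⊆ tsupport Z ∩ {x | 1 ≤ τ x} := fun i => by
    refine closure_minimal (fun x hx => ⟨subset_tsupport _ ?_, ?_⟩)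
      ((isClosed_tsupport _).inter (isClosed_le continuous_const hτc))
    · intro h0
      simp [h0] at hx
    · by_contra h0
      rw [mem_ofPred_eq, not_le] at h0
      simp [hχ, hkz _ h0.le] at hx
  have hψc : ∀ i, HasCompactSupport (fun x => χ x * Z x i) := fun i =>
    HasCompactSupport.of_support_subset_isCompact hZc
      (fun x hx => (hψs i (subset_tsupport _ hx)).1)
  have hψΩ : ∀ i, tsupport (fun x => χ x * Z x i) ⊆ Ω := fun i x hx => by
    have h1 := hψs i hx
    rw [h.mem_iff x (hZs h1.1)]
    have h2 : (0 : ℝ) < s⁻¹ * (⟪x, e⟫ - γ x) := lt_of_lt_of_le one_pos h1.2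
    have := (mul_pos_iff_of_pos_left (inv_pos.2 hs)).1 h2
    linarith
  have key : ∀ i, _ := fun i => (hψL i).elim fun L' hL' =>
    hβ.1.integral_lipschitz hΩ hL' (hψc i) (hψΩ i) i
  have hder : ∀ᵐ x ∂(volume.restrict Ω), ∀ i,
      lineDeriv ℝ (fun x => χ x * Z x i) x (EuclideanSpace.single i 1) =
        χ x * fderiv ℝ Z x (EuclideanSpace.single i 1) i +
          s⁻¹ * deriv k (τ x) * (Z x i * (e - gradient γ x) i) := by
    filter_upwards [ae_restrict_of_ae (h.lipschitz.ae_differentiableAt (μ := volume))] with x hx i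
    have hZi : HasFDerivAt (fun x => Z x i)
        ((EuclideanSpace.proj (𝕜 := ℝ) i).comp (fderiv ℝ Z x)) x :=
      (EuclideanSpace.proj (𝕜 := ℝ) i).hasFDerivAt.comp x
        (hZ.differentiable one_ne_zero x).hasFDerivAt
    have hin : HasFDerivAt (fun x : Euc (n + 1) => ⟪x, e⟫)
        (InnerProductSpace.toDual ℝ (Euc (n + 1)) e) x := by
      have h1 := (InnerProductSpace.toDual ℝ (Euc (n + 1)) e).hasFDerivAt (x := x)
      refine h1.congr_of_eventuallyEq (Eventually.of_forall fun y => ?_)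
      simp [real_inner_comm]
    have hτd : HasFDerivAt τ (s⁻¹ • (InnerProductSpace.toDual ℝ (Euc (n + 1)) e - fderiv ℝ γ x)) x :=
      (hin.sub hx.hasFDerivAt).const_smul s⁻¹
    have hχd := (hk.differentiable one_ne_zero (τ x)).hasDerivAt.comp_hasFDerivAt x hτd
    have hd := hχd.mul hZi
    have e1 : InnerProductSpace.toDual ℝ (Euc (n + 1)) e (EuclideanSpace.single i 1) = e i := by
      rw [InnerProductSpace.toDual_apply_apply, EuclideanSpace.inner_single_right]; simp
    have e2 : fderiv ℝ γ x (EuclideanSpace.single i 1) = gradient γ x i := by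
      rw [← inner_gradient_left, EuclideanSpace.inner_single_right]; simp
    have := (hd.hasLineDerivAt (EuclideanSpace.single i 1)).lineDeriv
    refine this.trans ?_
    simp [hχ, e1, e2]
    ring
  have hint1 : ∀ i, Integrable (fun x => β x *
      lineDeriv ℝ (fun x => χ x * Z x i) x (EuclideanSpace.single i 1)) (volume.restrict Ω) := by
    intro i
    obtain ⟨L', hL'⟩ := hψL i
    refine integrable_mul_of_memLp_top hβ.2.1 (hψc i)
      (measurable_lineDeriv hL'.continuous).aestronglyMeasurable (A := L' * 1)
      (fun x => ?_) fun x hx => ?_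
    · have := norm_lineDeriv_le_of_lipschitz ℝ hL' (x₀ := x)
        (v := (EuclideanSpace.single i 1 : Euc (n + 1)))
      simpa using this
    · rw [notMem_tsupport_iff_eventuallyEq] at hx
      have h0 : fderiv ℝ (fun x => χ x * Z x i) x = 0 := by
        rw [hx.fderiv_eq]
        exact fderiv_const_apply (0 : ℝ)
      have hd : DifferentiableAt ℝ (fun x => χ x * Z x i) x :=
        hx.differentiableAt_iff.2 (differentiableAt_const (0 : ℝ))
      rw [hd.lineDeriv_eq_fderiv, h0, zero_apply]
  have hint2 : ∀ i, Integrable (fun x => χ x * Z x i * Dβ x i) (volume.restrict Ω) := by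
    intro i
    obtain ⟨L', hL'⟩ := hψL i
    obtain ⟨A', hA'⟩ := (hψc i).exists_bound_of_continuous hL'.continuous
    have := integrable_mul_of_memLp_top (memLp_apply hβ.2.2 i) (hψc i)
      hL'.continuous.aestronglyMeasurable hA'
      fun x hx => image_eq_zero_of_notMem_tsupport (f := fun x => χ x * Z x i) hx
    simpa only [mul_comm] using this
  have hsum : ∫ x in Ω, (∑ i, (β x *
      lineDeriv ℝ (fun x => χ x * Z x i) x (EuclideanSpace.single i 1) +
        χ x * Z x i * Dβ x i)) = 0 := by
    rw [integral_finsetSum _ fun i _ => by exact (hint1 i).add (hint2 i)]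
    refine Finset.sum_eq_zero fun i _ => ?_
    rw [integral_add (hint1 i) (hint2 i), key i, neg_add_cancel]
  have hpt : ∀ᵐ x ∂(volume.restrict Ω), (∑ i, (β x *
      lineDeriv ℝ (fun x => χ x * Z x i) x (EuclideanSpace.single i 1) +
        χ x * Z x i * Dβ x i)) = χ x * (β x * divergence Z x + ⟪Dβ x, Z x⟫) +
          β x * (s⁻¹ * deriv k (τ x) * ⟪Z x, e - gradient γ x⟫) := by
    filter_upwards [hder] with x hx
    simp_rw [hx, divergence, PiLp.inner_apply, Finset.mul_sum, ← Finset.sum_add_distrib,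
      Finset.mul_sum, ← Finset.sum_add_distrib]
    refine Finset.sum_congr rfl fun i _ => ?_
    simp
    ring
  rw [integral_congr_ae hpt, integral_add] at hsum
  · exact eq_neg_of_add_eq_zero_left hsum
  · exact (hβ.integrable_mul_divergence_add hZ hZc).bdd_mul (c := 1)
      hχL.continuous.aestronglyMeasurable (Eventually.of_forall fun x => hχb x)
  · have hm : Measurable fun x => s⁻¹ * deriv k (τ x) * ⟪Z x, e - gradient γ x⟫ :=
      ((((hk.continuous_deriv le_rfl).comp hτc).measurable).const_mul _).mul
        (hZ.continuous.measurable.inner (measurable_const.sub IsGraphChart.measurable_gradient))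
    refine integrable_mul_of_memLp_top hβ.2.1 hZc hm.aestronglyMeasurable
      (A := s⁻¹ * C * (A * (1 + L))) (fun x => ?_) fun x hx => by
        simp [image_eq_zero_of_notMem_tsupport hx]
    have h1 : ‖e - gradient γ x‖ ≤ 1 + L :=
      (norm_sub_le _ _).trans (by rw [h.norm_e]; gcongr; exact h.norm_gradient_le x)
    have h2 : ‖deriv k (τ x)‖ ≤ C := by exact_mod_cast hkC (τ x)
    have h3 : ‖⟪Z x, e - gradient γ x⟫‖ ≤ A * (1 + L) :=
      (norm_inner_le_norm _ _).trans (mul_le_mul (hA x) h1 (norm_nonneg _) hA0)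
    rw [norm_mul, norm_mul, Real.norm_of_nonneg (inv_pos.2 hs).le]
    gcongr

/-- The key estimate at the boundary: the functional `∫ (β div Z + ∇β · Z)` is bounded by the flux
of `Z` through the boundary. The constant does not depend on `Z`, so no trace of `β` is needed. -/
theorem IsGraphChart.exists_flux_bound (h : IsGraphChart Ω z e ρ L γ) (hΩ : IsOpen Ω)
    (c : HeightCoordinates e) {β : Euc (n + 1) → ℝ} {Dβ : Euc (n + 1) → Euc (n + 1)}
    (hβ : IsW1Infty Ω β Dβ) : ∃ C : ℝ≥0, ∀ Z : Euc (n + 1) → Euc (n + 1), ContDiff ℝ 1 Z →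
      HasCompactSupport Z → tsupport Z ⊆ Metric.ball z ρ →
      ‖∫ x in Ω, (β x * divergence Z x + ⟪Dβ x, Z x⟫)‖ₑ ≤
        C * ∫⁻ x, ‖⟪Z x, e - gradient γ x⟫‖ₑ ∂(c.graphMeasure γ (Metric.ball z ρ)) := by
  obtain ⟨k, C, hk, hk0, hk1, hkz, hk2, hkC, hkd⟩ := exists_smooth_step
  set b : ℝ≥0 := (eLpNorm β ∞ (volume.restrict Ω)).toNNReal with hb
  have hbβ : ∀ᵐ x ∂(volume.restrict Ω), ‖β x‖ₑ ≤ b := by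
    rw [hb, ENNReal.coe_toNNReal hβ.2.1.2.ne]
    exact ae_le_eLpNormEssSup
  -- the summand `1` makes the right-hand side infinite if the flux is infinite
  refine ⟨b * (2 * C) + 1, fun Z hZ hZc hZs => ?_⟩
  have hγ := h.lipschitz.continuous
  set N : Euc (n + 1) → Euc (n + 1) := fun x => e - gradient γ x with hN
  have hNe : ∀ (x : Euc (n + 1)) (t : ℝ), N (x + t • e) = N x := fun x t => by
    simp only [hN, h.gradient_add_smul]
  have hNm : Measurable N := measurable_const.sub IsGraphChart.measurable_gradient
  have hNL : ∀ x, ‖N x‖ ≤ 1 + L := fun x =>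
    (norm_sub_le _ _).trans (by rw [h.norm_e]; gcongr; exact h.norm_gradient_le x)
  have hF := hβ.integrable_mul_divergence_add hZ hZc
  have hG : Measurable fun y : Fin n → ℝ => c.shear γ (y, 0) :=
    ((c.continuous_shear hγ).comp (by fun_prop)).measurable
  have hflux : ∫⁻ x, ‖⟪Z x, N x⟫‖ₑ ∂(c.graphMeasure γ (Metric.ball z ρ)) =
      ∫⁻ y, ‖⟪Z (c.shear γ (y, 0)), N (c.shear γ (y, 0))⟫‖ₑ := by
    rw [HeightCoordinates.graphMeasure, lintegral_map (hZ.continuous.measurable.inner hNm).enorm hG]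
    refine setLIntegral_eq_of_support_subset (fun y hy => ?_)
    by_contra hyb
    refine hy ?_
    have : Z (c.shear γ (y, 0)) = 0 :=
      image_eq_zero_of_notMem_tsupport fun hh => hyb (hZs hh)
    simp [this]
  rw [hflux]
  set J := ∫⁻ y, ‖⟪Z (c.shear γ (y, 0)), N (c.shear γ (y, 0))⟫‖ₑ with hJ
  by_cases hJtop : J = ⊤
  · rw [hJtop, ENNReal.mul_top (by simp)]
    exact le_top
  -- as the layer shrinks to the boundary, the cut-off functions increase to one inside `Ω`
  have hlim : Tendsto (fun s => ∫ x in Ω, k (s⁻¹ * (⟪x, e⟫ - γ x)) *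
      (β x * divergence Z x + ⟪Dβ x, Z x⟫)) (𝓝[>] (0 : ℝ))
      (𝓝 (∫ x in Ω, (β x * divergence Z x + ⟪Dβ x, Z x⟫))) := by
    refine tendsto_integral_filter_of_dominated_convergence
      (fun x => ‖β x * divergence Z x + ⟪Dβ x, Z x⟫‖) (Eventually.of_forall fun s => ?_)
      (Eventually.of_forall fun s => Eventually.of_forall fun x => ?_) hF.norm ?_
    · have hc : Continuous fun x => k (s⁻¹ * (⟪x, e⟫ - γ x)) :=
        hk.continuous.comp (by fun_prop)
      exact hc.aestronglyMeasurable.mul hF.aestronglyMeasurable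
    · rw [norm_mul, Real.norm_of_nonneg (hk0 _)]
      exact mul_le_of_le_one_left (norm_nonneg _) (hk1 _)
    · filter_upwards [ae_restrict_mem hΩ.measurableSet] with x hx
      by_cases hxZ : x ∈ tsupport Z
      · have hpos : 0 < ⟪x, e⟫ - γ x := sub_pos.2 ((h.mem_iff x (hZs hxZ)).1 hx)
        have hev : ∀ᶠ s in 𝓝[>] (0 : ℝ), s < (⟪x, e⟫ - γ x) / 2 :=
          nhdsWithin_le_nhds (gt_mem_nhds (by positivity))
        refine tendsto_const_nhds.congr' ?_
        filter_upwards [hev, self_mem_nhdsWithin] with s hs hs0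
        have hs0' : (0 : ℝ) < s := hs0
        have : 2 ≤ s⁻¹ * (⟪x, e⟫ - γ x) := by
          rw [← div_eq_inv_mul, le_div_iff₀ hs0']
          linarith
        rw [hk2 _ this, one_mul]
      · simp [divergence_of_notMem_tsupport hxZ, image_eq_zero_of_notMem_tsupport hxZ]
  have hB : ∀ B : ℝ≥0∞, J < B →
      ‖∫ x in Ω, (β x * divergence Z x + ⟪Dβ x, Z x⟫)‖ₑ ≤ (b * (2 * C) : ℝ≥0) * B := by
    intro B hJB
    refine le_of_tendsto hlim.enorm ?_
    filter_upwards [c.eventually_lintegral_layer_le hγ h.invariant hZ.continuous hZc hNe hNm hNL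
      (hk.continuous_deriv le_rfl).measurable hkC hkd hJB, self_mem_nhdsWithin] with s hs hs0
    rw [h.integral_cutoff hΩ hβ hZ hZc hZs hk hk0 hk1 hkz hkC hs0, enorm_neg]
    calc ‖∫ x in Ω, β x * (s⁻¹ * deriv k (s⁻¹ * (⟪x, e⟫ - γ x)) * ⟪Z x, e - gradient γ x⟫)‖ₑ
        ≤ ∫⁻ x in Ω, ‖β x * (s⁻¹ * deriv k (s⁻¹ * (⟪x, e⟫ - γ x)) *
            ⟪Z x, e - gradient γ x⟫)‖ₑ := enorm_integral_le_lintegral_enorm _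
      _ ≤ ∫⁻ x in Ω, b * ‖s⁻¹ * deriv k (s⁻¹ * (⟪x, e⟫ - γ x)) * ⟪Z x, N x⟫‖ₑ := by
          refine lintegral_mono_ae ?_
          filter_upwards [hbβ] with x hx
          rw [enorm_mul]
          exact mul_le_mul_left hx _
      _ = b * ∫⁻ x in Ω, ‖s⁻¹ * deriv k (s⁻¹ * (⟪x, e⟫ - γ x)) * ⟪Z x, N x⟫‖ₑ :=
          lintegral_const_mul' _ _ ENNReal.coe_ne_top
      _ ≤ b * (2 * C * B) := by
          gcongr
          exact (setLIntegral_le_lintegral _ _).trans hs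
      _ = (b * (2 * C) : ℝ≥0) * B := by push_cast; ring
  have hne : (𝓝[>] J).NeBot := nhdsGT_neBot_of_exists_gt ⟨⊤, lt_top_iff_ne_top.2 hJtop⟩
  have hlimB : Tendsto (fun B : ℝ≥0∞ => ((b * (2 * C) : ℝ≥0) : ℝ≥0∞) * B) (𝓝[>] J)
      (𝓝 (((b * (2 * C) : ℝ≥0) : ℝ≥0∞) * J)) :=
    (ENNReal.Tendsto.const_mul tendsto_id (Or.inr ENNReal.coe_ne_top)).mono_left
      nhdsWithin_le_nhds
  refine (ge_of_tendsto hlimB ?_).trans ?_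
  · filter_upwards [self_mem_nhdsWithin] with B hJB using hB B hJB
  · gcongr
    exact le_self_add

end FluxBound

/-! ### Products of convergent sequences in `L²` -/

section L2

variable {X : Type*} [MeasurableSpace X] {μ : Measure X}

theorem eLpNorm_mul_le {f g : X → ℝ} (hf : AEStronglyMeasurable f μ)
    (hg : AEStronglyMeasurable g μ) :
    eLpNorm (fun x => f x * g x) 1 μ ≤ eLpNorm f 2 μ * eLpNorm g 2 μ := by
  have h : (fun x => f x * g x) = f • g := rfl
  rw [h]
  exact eLpNorm_smul_le_mul_eLpNorm (p := 2) (q := 2) (r := 1) hg hf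

theorem tendsto_eLpNorm_mul_sub {f g : X → ℝ} {fs gs : ℕ → X → ℝ} (hf : MemLp f 2 μ)
    (hg : MemLp g 2 μ) (hfs : ∀ n, AEStronglyMeasurable (fs n) μ)
    (hgs : ∀ n, AEStronglyMeasurable (gs n) μ)
    (hft : Tendsto (fun n => eLpNorm (fun x => fs n x - f x) 2 μ) atTop (𝓝 0))
    (hgt : Tendsto (fun n => eLpNorm (fun x => gs n x - g x) 2 μ) atTop (𝓝 0)) :
    Tendsto (fun n => eLpNorm (fun x => fs n x * gs n x - f x * g x) 1 μ) atTop (𝓝 0) := by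
  have hlim : Tendsto (fun n => eLpNorm (fun x => fs n x - f x) 2 μ *
      eLpNorm (fun x => gs n x - g x) 2 μ + eLpNorm f 2 μ * eLpNorm (fun x => gs n x - g x) 2 μ +
      eLpNorm (fun x => fs n x - f x) 2 μ * eLpNorm g 2 μ) atTop (𝓝 0) := by
    have h1 := ENNReal.Tendsto.mul hft (Or.inr ENNReal.zero_ne_top) hgt
      (Or.inr ENNReal.zero_ne_top)
    have h2 := ENNReal.Tendsto.const_mul hgt (Or.inr hf.2.ne)
    have h3 := ENNReal.Tendsto.mul_const hft (Or.inr hg.2.ne)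
    simpa using (h1.add h2).add h3
  refine tendsto_of_tendsto_of_tendsto_of_le_of_le tendsto_const_nhds hlim (fun _ => zero_le)
    fun n => ?_
  have hF : AEStronglyMeasurable (fun x => fs n x - f x) μ := (hfs n).sub hf.1
  have hG : AEStronglyMeasurable (fun x => gs n x - g x) μ := (hgs n).sub hg.1
  have heq : (fun x => fs n x * gs n x - f x * g x) = ((fun x => (fs n x - f x) * (gs n x - g x)) +
      fun x => f x * (gs n x - g x)) + fun x => (fs n x - f x) * g x := by
    ext x; simp only [Pi.add_apply]; ring
  rw [heq]
  refine (eLpNorm_add_le ((hF.mul hG).add (hf.1.mul hG)) (hF.mul hg.1) le_rfl).trans ?_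
  refine add_le_add ((eLpNorm_add_le (hF.mul hG) (hf.1.mul hG) le_rfl).trans ?_)
    (eLpNorm_mul_le hF hg.1)
  exact add_le_add (eLpNorm_mul_le hF hG) (eLpNorm_mul_le hf.1 hG)

theorem integrable_weight_mul {w f g : X → ℝ} (hw : MemLp w ⊤ μ) (hf : MemLp f 2 μ)
    (hg : MemLp g 2 μ) : Integrable (fun x => w x * (f x * g x)) μ :=
  (hf.integrable_mul hg).mul_of_top_right hw

theorem tendsto_integral_weight_mul {w f g : X → ℝ} {fs gs : ℕ → X → ℝ} (hw : MemLp w ⊤ μ)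
    (hf : MemLp f 2 μ) (hg : MemLp g 2 μ) (hfs : ∀ n, MemLp (fs n) 2 μ)
    (hgs : ∀ n, MemLp (gs n) 2 μ)
    (hft : Tendsto (fun n => eLpNorm (fun x => fs n x - f x) 2 μ) atTop (𝓝 0))
    (hgt : Tendsto (fun n => eLpNorm (fun x => gs n x - g x) 2 μ) atTop (𝓝 0)) :
    Tendsto (fun n => ∫ x, w x * (fs n x * gs n x) ∂μ) atTop
      (𝓝 (∫ x, w x * (f x * g x) ∂μ)) := by
  refine tendsto_integral_of_L1' _ (integrable_weight_mul hw hf hg).aestronglyMeasurable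
    (Eventually.of_forall fun n => integrable_weight_mul hw (hfs n) (hgs n)) ?_
  have h1 := tendsto_eLpNorm_mul_sub hf hg (fun n => (hfs n).1) (fun n => (hgs n).1) hft hgt
  have h2 := ENNReal.Tendsto.const_mul (a := eLpNorm w ⊤ μ) h1 (Or.inr hw.2.ne)
  rw [mul_zero] at h2
  refine tendsto_of_tendsto_of_tendsto_of_le_of_le tendsto_const_nhds h2 (fun _ => zero_le)
    fun n => ?_
  have heq : ((fun x => w x * (fs n x * gs n x)) - fun x => w x * (f x * g x)) =
      w • (fun x => fs n x * gs n x - f x * g x) := by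
    ext x; simp only [Pi.sub_apply, Pi.smul_apply', smul_eq_mul]; ring
  rw [heq]
  exact eLpNorm_smul_le_mul_eLpNorm (p := ⊤) (q := 1) (r := 1)
    (((hfs n).1.mul (hgs n).1).sub (hf.1.mul hg.1)) hw.1

end L2

/-! ### Integration by parts -/

/-- The vector field `ζ φ (ψ₁, …, ψ_d)`. -/
noncomputable def productField {d : ℕ} (ζ φ : Euc d → ℝ) (ψ : Fin d → Euc d → ℝ) (x : Euc d) :
    Euc d :=
  WithLp.toLp 2 fun i => ζ x * (φ x * ψ i x)

/-- The integrand `β div (ζ w p) + ∇β · (ζ w p)`, expanded by the product rule, where `G` stands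
for the gradient of `w` and `Dp i` for the gradient of `p i`. -/
noncomputable def fluxIntegrand {d : ℕ} (β : Euc d → ℝ) (Dβ : Euc d → Euc d) (w : Euc d → ℝ)
    (G : Euc d → Euc d) (p : Fin d → Euc d → ℝ) (Dp : Fin d → Euc d → Euc d) (ζ : Euc d → ℝ)
    (x : Euc d) : ℝ :=
  ∑ i, (β x * gradient ζ x i * (w x * p i x) + β x * ζ x * (G x i * p i x) +
    β x * ζ x * (w x * Dp i x i) + Dβ x i * ζ x * (w x * p i x))

section Flux

variable {d : ℕ}

theorem contDiff_productField {ζ φ : Euc d → ℝ} {ψ : Fin d → Euc d → ℝ} (hζ : ContDiff ℝ ∞ ζ)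
    (hφ : ContDiff ℝ ∞ φ) (hψ : ∀ i, ContDiff ℝ ∞ (ψ i)) :
    ContDiff ℝ 1 (productField ζ φ ψ) := by
  refine contDiff_euclidean.2 fun i => ?_
  exact (hζ.mul (hφ.mul (hψ i))).of_le (by simp)

theorem tsupport_productField_subset (ζ φ : Euc d → ℝ) (ψ : Fin d → Euc d → ℝ) :
    tsupport (productField ζ φ ψ) ⊆ tsupport ζ := by
  refine closure_mono fun x hx h0 => hx ?_
  ext i
  simp [productField, h0]

theorem gradient_apply_eq {f : Euc d → ℝ} (x : Euc d) (i : Fin d) :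
    gradient f x i = fderiv ℝ f x (EuclideanSpace.single i 1) := by
  rw [← inner_gradient_left, EuclideanSpace.inner_single_right]; simp

/-- The product rule for `div (ζ φ ψ)`. -/
theorem mul_divergence_productField {ζ φ : Euc d → ℝ} {ψ : Fin d → Euc d → ℝ}
    (hζ : ContDiff ℝ ∞ ζ) (hφ : ContDiff ℝ ∞ φ) (hψ : ∀ i, ContDiff ℝ ∞ (ψ i))
    (β : Euc d → ℝ) (Dβ : Euc d → Euc d) (x : Euc d) :
    β x * divergence (productField ζ φ ψ) x + ⟪Dβ x, productField ζ φ ψ x⟫ =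
      fluxIntegrand β Dβ φ (gradient φ) ψ (fun i => gradient (ψ i)) ζ x := by
  have hZ := (contDiff_productField hζ hφ hψ).differentiable one_ne_zero x
  have h1 : ∀ i, fderiv ℝ (productField ζ φ ψ) x (EuclideanSpace.single i 1) i =
      gradient ζ x i * (φ x * ψ i x) + ζ x * (gradient φ x i * ψ i x) +
        ζ x * (φ x * gradient (ψ i) x i) := by
    intro i
    have e1 : HasFDerivAt (fun x => productField ζ φ ψ x i)
        ((EuclideanSpace.proj (𝕜 := ℝ) i).comp (fderiv ℝ (productField ζ φ ψ) x)) x :=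
      (EuclideanSpace.proj (𝕜 := ℝ) i).hasFDerivAt.comp x hZ.hasFDerivAt
    have e2 := ((hζ.differentiable (by simp) x).hasFDerivAt).mul
      (((hφ.differentiable (by simp) x).hasFDerivAt).mul
        ((hψ i).differentiable (by simp) x).hasFDerivAt)
    have e3 := congrArg (fun T => T (EuclideanSpace.single i 1)) (e1.unique e2)
    simp only [gradient_apply_eq]
    refine e3.trans ?_
    simp
    ring
  simp_rw [divergence, h1, fluxIntegrand, PiLp.inner_apply, Finset.mul_sum,
    ← Finset.sum_add_distrib]
  refine Finset.sum_congr rfl fun i _ => ?_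
  simp [productField]
  ring

theorem memLp_restrict_of_continuous {F : Type*} [NormedAddCommGroup F]
    [SecondCountableTopology F] {Ω : Set (Euc d)}
    (hΩ : Bornology.IsBounded Ω) {f : Euc d → F} (hf : Continuous f) (p : ℝ≥0∞) :
    MemLp f p (volume.restrict Ω) := by
  obtain ⟨A, hA⟩ := hΩ.isCompact_closure.exists_bound_of_continuousOn hf.continuousOn
  have h1 : MemLp f p (volume.restrict (closure Ω)) := by
    have : IsFiniteMeasure (volume.restrict (closure Ω)) :=
      isFiniteMeasure_restrict.2 hΩ.isCompact_closure.measure_lt_top.ne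
    refine MemLp.of_bound hf.aestronglyMeasurable A ?_
    filter_upwards [ae_restrict_mem isClosed_closure.measurableSet] with x hx using hA x hx
  exact h1.mono_measure (Measure.restrict_mono subset_closure le_rfl)

theorem continuous_gradient {f : Euc d → ℝ} (hf : ContDiff ℝ ∞ f) : Continuous (gradient f) :=
  (InnerProductSpace.toDual ℝ (Euc d)).symm.continuous.comp (hf.continuous_fderiv (by simp))

theorem eLpNorm_apply_sub_le {μ : Measure (Euc d)} {F G : Euc d → Euc d} (i : Fin d) :
    eLpNorm (fun x => F x i - G x i) 2 μ ≤ eLpNorm (fun x => F x - G x) 2 μ :=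
  eLpNorm_mono fun x => PiLp.norm_apply_le (F x - G x) i

variable {Ω : Set (Euc d)} {β : Euc d → ℝ} {Dβ : Euc d → Euc d} {w : Euc d → ℝ}
  {G : Euc d → Euc d} {p : Fin d → Euc d → ℝ} {Dp : Fin d → Euc d → Euc d}

theorem integrable_fluxIntegrand_term (hΩ : Bornology.IsBounded Ω) (hβ : IsW1Infty Ω β Dβ)
    (hw : MemLp w 2 (volume.restrict Ω)) (hG : MemLp G 2 (volume.restrict Ω))
    (hp : ∀ i, MemLp (p i) 2 (volume.restrict Ω)) (hDp : ∀ i, MemLp (Dp i) 2 (volume.restrict Ω))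
    {ζ : Euc d → ℝ} (hζ : ContDiff ℝ ∞ ζ) (i : Fin d) :
    Integrable (fun x => β x * gradient ζ x i * (w x * p i x)) (volume.restrict Ω) ∧
    Integrable (fun x => β x * ζ x * (G x i * p i x)) (volume.restrict Ω) ∧
    Integrable (fun x => β x * ζ x * (w x * Dp i x i)) (volume.restrict Ω) ∧
    Integrable (fun x => Dβ x i * ζ x * (w x * p i x)) (volume.restrict Ω) := by
  have hζb : MemLp ζ ⊤ (volume.restrict Ω) := memLp_restrict_of_continuous hΩ hζ.continuous _
  have hζg : MemLp (fun x => gradient ζ x i) ⊤ (volume.restrict Ω) :=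
    memLp_apply (memLp_restrict_of_continuous hΩ (continuous_gradient hζ) _) i
  exact ⟨integrable_weight_mul (hζg.mul hβ.2.1) hw (hp i),
    integrable_weight_mul (hζb.mul hβ.2.1) (memLp_apply hG i) (hp i),
    integrable_weight_mul (hζb.mul hβ.2.1) hw (memLp_apply (hDp i) i),
    integrable_weight_mul (hζb.mul (memLp_apply hβ.2.2 i)) hw (hp i)⟩

theorem integrable_fluxIntegrand (hΩ : Bornology.IsBounded Ω) (hβ : IsW1Infty Ω β Dβ)
    (hw : MemLp w 2 (volume.restrict Ω)) (hG : MemLp G 2 (volume.restrict Ω))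
    (hp : ∀ i, MemLp (p i) 2 (volume.restrict Ω)) (hDp : ∀ i, MemLp (Dp i) 2 (volume.restrict Ω))
    {ζ : Euc d → ℝ} (hζ : ContDiff ℝ ∞ ζ) :
    Integrable (fluxIntegrand β Dβ w G p Dp ζ) (volume.restrict Ω) := by
  refine integrable_finsetSum _ fun i _ => ?_
  obtain ⟨h1, h2, h3, h4⟩ := integrable_fluxIntegrand_term hΩ hβ hw hG hp hDp hζ i
  exact ((h1.add h2).add h3).add h4

theorem integral_fluxIntegrand (hΩ : Bornology.IsBounded Ω) (hβ : IsW1Infty Ω β Dβ)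
    (hw : MemLp w 2 (volume.restrict Ω)) (hG : MemLp G 2 (volume.restrict Ω))
    (hp : ∀ i, MemLp (p i) 2 (volume.restrict Ω)) (hDp : ∀ i, MemLp (Dp i) 2 (volume.restrict Ω))
    {ζ : Euc d → ℝ} (hζ : ContDiff ℝ ∞ ζ) :
    ∫ x in Ω, fluxIntegrand β Dβ w G p Dp ζ x =
      ∑ i, ((∫ x in Ω, β x * gradient ζ x i * (w x * p i x)) +
        (∫ x in Ω, β x * ζ x * (G x i * p i x)) + (∫ x in Ω, β x * ζ x * (w x * Dp i x i)) +
        ∫ x in Ω, Dβ x i * ζ x * (w x * p i x)) := by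
  have h := integrable_fluxIntegrand_term hΩ hβ hw hG hp hDp hζ
  unfold fluxIntegrand
  rw [integral_finsetSum _ fun i _ => by
    exact (((h i).1.add (h i).2.1).add (h i).2.2.1).add (h i).2.2.2]
  refine Finset.sum_congr rfl fun i _ => ?_
  obtain ⟨h1, h2, h3, h4⟩ := h i
  rw [integral_add (by exact (h1.add h2).add h3) h4, integral_add (by exact h1.add h2) h3,
    integral_add h1 h2]

/-- The integrals are continuous with respect to `H¹`-convergence of both factors. -/
theorem tendsto_integral_fluxIntegrand (hΩ : Bornology.IsBounded Ω) (hβ : IsW1Infty Ω β Dβ)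
    (hw : MemLp w 2 (volume.restrict Ω)) (hG : MemLp G 2 (volume.restrict Ω))
    (hp : ∀ i, MemLp (p i) 2 (volume.restrict Ω)) (hDp : ∀ i, MemLp (Dp i) 2 (volume.restrict Ω))
    {ζ : Euc d → ℝ} (hζ : ContDiff ℝ ∞ ζ) {φ : ℕ → Euc d → ℝ} {ψ : Fin d → ℕ → Euc d → ℝ}
    (hφ : ∀ n, ContDiff ℝ ∞ (φ n)) (hψ : ∀ i n, ContDiff ℝ ∞ (ψ i n))
    (hφw : Tendsto (fun n => eLpNorm (fun x => φ n x - w x) 2 (volume.restrict Ω)) atTop (𝓝 0))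
    (hφG : Tendsto (fun n => eLpNorm (fun x => gradient (φ n) x - G x) 2 (volume.restrict Ω))
      atTop (𝓝 0))
    (hψp : ∀ i, Tendsto (fun n => eLpNorm (fun x => ψ i n x - p i x) 2 (volume.restrict Ω))
      atTop (𝓝 0))
    (hψD : ∀ i, Tendsto (fun n => eLpNorm (fun x => gradient (ψ i n) x - Dp i x) 2
      (volume.restrict Ω)) atTop (𝓝 0)) :
    Tendsto (fun n => ∫ x in Ω, fluxIntegrand β Dβ (φ n) (gradient (φ n)) (fun i => ψ i n)
      (fun i => gradient (ψ i n)) ζ x) atTop (𝓝 (∫ x in Ω, fluxIntegrand β Dβ w G p Dp ζ x)) := by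
  have m1 : ∀ n, MemLp (φ n) 2 (volume.restrict Ω) := fun n =>
    memLp_restrict_of_continuous hΩ (hφ n).continuous _
  have m2 : ∀ n, MemLp (gradient (φ n)) 2 (volume.restrict Ω) := fun n =>
    memLp_restrict_of_continuous hΩ (continuous_gradient (hφ n)) _
  have m3 : ∀ n i, MemLp (ψ i n) 2 (volume.restrict Ω) := fun n i =>
    memLp_restrict_of_continuous hΩ (hψ i n).continuous _
  have m4 : ∀ n i, MemLp (gradient (ψ i n)) 2 (volume.restrict Ω) := fun n i =>
    memLp_restrict_of_continuous hΩ (continuous_gradient (hψ i n)) _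
  rw [integral_fluxIntegrand hΩ hβ hw hG hp hDp hζ]
  simp_rw [fun n => integral_fluxIntegrand hΩ hβ (m1 n) (m2 n) (m3 n) (m4 n) hζ]
  have hζb : MemLp ζ ⊤ (volume.restrict Ω) := memLp_restrict_of_continuous hΩ hζ.continuous _
  refine tendsto_finsetSum _ fun i _ => ?_
  have hζg : MemLp (fun x => gradient ζ x i) ⊤ (volume.restrict Ω) :=
    memLp_apply (memLp_restrict_of_continuous hΩ (continuous_gradient hζ) _) i
  have hcomp : ∀ {F : ℕ → Euc d → Euc d} {F' : Euc d → Euc d},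
      Tendsto (fun n => eLpNorm (fun x => F n x - F' x) 2 (volume.restrict Ω)) atTop (𝓝 0) →
      Tendsto (fun n => eLpNorm (fun x => F n x i - F' x i) 2 (volume.restrict Ω)) atTop (𝓝 0) :=
    fun h => tendsto_of_tendsto_of_tendsto_of_le_of_le tendsto_const_nhds h (fun _ => zero_le)
      fun n => eLpNorm_apply_sub_le i
  refine ((Tendsto.add ?_ ?_).add ?_).add ?_
  · exact tendsto_integral_weight_mul (hζg.mul hβ.2.1) hw (hp i) m1 (fun n => m3 n i) hφw (hψp i)
  · exact tendsto_integral_weight_mul (hζb.mul hβ.2.1) (memLp_apply hG i) (hp i)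
      (fun n => memLp_apply (m2 n) i) (fun n => m3 n i) (hcomp hφG) (hψp i)
  · exact tendsto_integral_weight_mul (hζb.mul hβ.2.1) hw (memLp_apply (hDp i) i) m1
      (fun n => memLp_apply (m4 n i) i) hφw (hcomp (hψD i))
  · exact tendsto_integral_weight_mul (hζb.mul (memLp_apply hβ.2.2 i)) hw (hp i) m1
      (fun n => m3 n i) hφw (hψp i)

end Flux

/-- If the normal component of the field with boundary values `g h` vanishes, then the fluxes of the
approximating fields `ζ φₙ ψₙ` through the boundary tend to zero. -/
theorem IsGraphChart.tendsto_flux_zero {n : ℕ} {Ω : Set (Euc (n + 1))} {z e : Euc (n + 1)}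
    {ρ : ℝ} {L : ℝ≥0} {γ : Euc (n + 1) → ℝ} (hc : IsGraphChart Ω z e ρ L γ)
    (c : HeightCoordinates e) {g : Euc (n + 1) → ℝ} {h : Fin (n + 1) → Euc (n + 1) → ℝ}
    (hg : MemLp g 2 (surfaceMeasure Ω)) (hh : ∀ i, MemLp (h i) 2 (surfaceMeasure Ω))
    {φ : ℕ → Euc (n + 1) → ℝ} {ψ : Fin (n + 1) → ℕ → Euc (n + 1) → ℝ}
    (hφ : ∀ n, ContDiff ℝ ∞ (φ n)) (hψ : ∀ i n, ContDiff ℝ ∞ (ψ i n))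
    (hφg : Tendsto (fun n => eLpNorm (fun x => φ n x - g x) 2 (surfaceMeasure Ω)) atTop (𝓝 0))
    (hψh : ∀ i, Tendsto (fun n => eLpNorm (fun x => ψ i n x - h i x) 2 (surfaceMeasure Ω))
      atTop (𝓝 0))
    (hν : ∀ᵐ x ∂(surfaceMeasure Ω), ∀ ν, IsOuterUnitNormal Ω x ν →
      (∑ i, h i x * ν i) * g x = 0)
    {ζ : Euc (n + 1) → ℝ} (hζ : ContDiff ℝ ∞ ζ) (hζc : HasCompactSupport ζ) :
    Tendsto (fun m => ∫⁻ x, ‖⟪productField ζ (φ m) (fun i => ψ i m) x, e - gradient γ x⟫‖ₑ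
      ∂(c.graphMeasure γ (Metric.ball z ρ))) atTop (𝓝 0) := by
  set μ := c.graphMeasure γ (Metric.ball z ρ) with hμ
  have hle : μ ≤ surfaceMeasure Ω := hc.graphMeasure_le_surfaceMeasure c
  obtain ⟨A, hA⟩ := hζc.exists_bound_of_continuous hζ.continuous
  have hA0 : 0 ≤ A := (norm_nonneg _).trans (hA 0)
  have hN : ∀ x, ‖e - gradient γ x‖ ≤ 1 + L := fun x =>
    (norm_sub_le _ _).trans (by rw [hc.norm_e]; gcongr; exact hc.norm_gradient_le x)
  -- the flux density `g h · N` of the limit vanishes and can be subtracted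
  have hzero : ∀ᵐ x ∂μ, ∑ i, (e - gradient γ x) i * (g x * h i x) = 0 := by
    filter_upwards [hc.ae_graphMeasure c, hν.filter_mono (ae_mono hle)] with x hx hxν
    obtain ⟨h1, h2⟩ := hc.isOuterUnitNormal hx.1 hx.2.1 hx.2.2
    have h3 := hxν _ h2
    have h4 : (∑ i, h i x * (‖gradient γ x - e‖⁻¹ • (gradient γ x - e)) i) * g x =
        -‖gradient γ x - e‖⁻¹ * ∑ i, (e - gradient γ x) i * (g x * h i x) := by
      rw [Finset.sum_mul, Finset.mul_sum]
      refine Finset.sum_congr rfl fun i _ => ?_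
      simp
      ring
    rw [h4] at h3
    exact (mul_eq_zero.1 h3).resolve_left (neg_ne_zero.2 (inv_ne_zero h1.ne'))
  have hbound : ∀ m, ∫⁻ x, ‖⟪productField ζ (φ m) (fun i => ψ i m) x, e - gradient γ x⟫‖ₑ ∂μ ≤
      ∑ i, ENNReal.ofReal (A * (1 + L)) *
        eLpNorm (fun x => φ m x * ψ i m x - g x * h i x) 1 (surfaceMeasure Ω) := by
    intro m
    calc ∫⁻ x, ‖⟪productField ζ (φ m) (fun i => ψ i m) x, e - gradient γ x⟫‖ₑ ∂μ
        ≤ ∫⁻ x, ∑ i, ENNReal.ofReal (A * (1 + L)) * ‖φ m x * ψ i m x - g x * h i x‖ₑ ∂μ := by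
          refine lintegral_mono_ae ?_
          filter_upwards [hzero] with x hx
          have h1 : ⟪productField ζ (φ m) (fun i => ψ i m) x, e - gradient γ x⟫ =
              ∑ i, ζ x * (e - gradient γ x) i * (φ m x * ψ i m x - g x * h i x) := by
            have h2 : ⟪productField ζ (φ m) (fun i => ψ i m) x, e - gradient γ x⟫ =
                ⟪productField ζ (φ m) (fun i => ψ i m) x, e - gradient γ x⟫ -
                  ζ x * ∑ i, (e - gradient γ x) i * (g x * h i x) := by rw [hx]; ring
            rw [h2, PiLp.inner_apply, Finset.mul_sum, ← Finset.sum_sub_distrib]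
            refine Finset.sum_congr rfl fun i _ => ?_
            simp [productField]
            ring
          rw [h1]
          refine (enorm_sum_le _ _).trans (Finset.sum_le_sum fun i _ => ?_)
          rw [enorm_mul, ← ofReal_norm (ζ x * _)]
          gcongr
          rw [norm_mul]
          exact mul_le_mul (hA x) ((PiLp.norm_apply_le _ i).trans (hN x)) (norm_nonneg _) hA0
      _ ≤ ∫⁻ x, ∑ i, ENNReal.ofReal (A * (1 + L)) * ‖φ m x * ψ i m x - g x * h i x‖ₑ
            ∂(surfaceMeasure Ω) := lintegral_mono' hle le_rfl
      _ = _ := by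
          have hm : ∀ i, AEMeasurable (fun x => ‖φ m x * ψ i m x - g x * h i x‖ₑ)
              (surfaceMeasure Ω) := fun i =>
            (((hφ m).continuous.mul (hψ i m).continuous).aestronglyMeasurable.sub
              (hg.1.mul (hh i).1)).enorm
          rw [lintegral_finsetSum' _ fun i _ => (hm i).const_mul _]
          refine Finset.sum_congr rfl fun i _ => ?_
          rw [lintegral_const_mul'' _ (hm i), eLpNorm_one_eq_lintegral_enorm]
  refine tendsto_of_tendsto_of_tendsto_of_le_of_le tendsto_const_nhds ?_ (fun _ => zero_le) hbound
  have hlim : ∀ i, Tendsto (fun m => ENNReal.ofReal (A * (1 + L)) *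
      eLpNorm (fun x => φ m x * ψ i m x - g x * h i x) 1 (surfaceMeasure Ω)) atTop (𝓝 0) := by
    intro i
    have h1 := tendsto_eLpNorm_mul_sub hg (hh i)
      (fun m => (hφ m).continuous.aestronglyMeasurable)
      (fun m => (hψ i m).continuous.aestronglyMeasurable) hφg (hψh i)
    simpa using ENNReal.Tendsto.const_mul h1 (Or.inr ENNReal.ofReal_ne_top)
  simpa using tendsto_finsetSum Finset.univ fun i _ => hlim i

/-- For fields supported inside the domain there is no boundary contribution. -/
theorem integral_divergence_of_tsupport_subset {d : ℕ} {Ω : Set (Euc d)} (hΩ : IsOpen Ω)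
    {β : Euc d → ℝ} {Dβ : Euc d → Euc d} (hβ : IsW1Infty Ω β Dβ) {Z : Euc d → Euc d}
    (hZ : ContDiff ℝ 1 Z) (hZc : HasCompactSupport Z) (hZs : tsupport Z ⊆ Ω) :
    ∫ x in Ω, (β x * divergence Z x + ⟪Dβ x, Z x⟫) = 0 := by
  have hts : ∀ i, tsupport (fun x => Z x i) ⊆ tsupport Z := fun i =>
    closure_mono fun x hx h0 => hx (by simp [h0])
  have hcs : ∀ i, HasCompactSupport fun x => Z x i := fun i =>
    hZc.of_isClosed_subset (isClosed_tsupport _) (hts i)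
  have hZi : ∀ i, ContDiff ℝ 1 fun x => Z x i := fun i => contDiff_euclidean.1 hZ i
  have hder : ∀ x i, lineDeriv ℝ (fun x => Z x i) x (EuclideanSpace.single i 1) =
      fderiv ℝ Z x (EuclideanSpace.single i 1) i := fun x i => by
    have hd : HasFDerivAt (fun x => Z x i)
        ((EuclideanSpace.proj (𝕜 := ℝ) i).comp (fderiv ℝ Z x)) x :=
      (EuclideanSpace.proj (𝕜 := ℝ) i).hasFDerivAt.comp x
        (hZ.differentiable one_ne_zero x).hasFDerivAt
    exact (hd.hasLineDerivAt _).lineDeriv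
  have hc : ∀ i, Continuous fun x => fderiv ℝ Z x (EuclideanSpace.single i 1) i := fun i =>
    (EuclideanSpace.proj (𝕜 := ℝ) i).continuous.comp
      ((hZ.continuous_fderiv one_ne_zero).clm_apply continuous_const)
  have hz : ∀ i, ∀ x ∉ tsupport Z, fderiv ℝ Z x (EuclideanSpace.single i 1) i = 0 :=
    fun i x hx => by simp [fderiv_of_notMem_tsupport (𝕜 := ℝ) hx]
  have hi1 : ∀ i, Integrable (fun x => β x * fderiv ℝ Z x (EuclideanSpace.single i 1) i)
      (volume.restrict Ω) := fun i => by
    obtain ⟨A, hA⟩ := (HasCompactSupport.intro hZc (hz i)).exists_bound_of_continuous (hc i)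
    exact integrable_mul_of_memLp_top hβ.2.1 hZc (hc i).aestronglyMeasurable hA (hz i)
  have hi2 : ∀ i, Integrable (fun x => Z x i * Dβ x i) (volume.restrict Ω) := fun i => by
    obtain ⟨A, hA⟩ := (hcs i).exists_bound_of_continuous (hZi i).continuous
    have := integrable_mul_of_memLp_top (memLp_apply hβ.2.2 i) (hcs i)
      (hZi i).continuous.aestronglyMeasurable hA
      fun x hx => image_eq_zero_of_notMem_tsupport (f := fun x => Z x i) hx
    simpa only [mul_comm] using this
  have hpt : ∀ x, β x * divergence Z x + ⟪Dβ x, Z x⟫ =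
      ∑ i, (β x * fderiv ℝ Z x (EuclideanSpace.single i 1) i + Z x i * Dβ x i) := fun x => by
    simp [divergence, PiLp.inner_apply, Finset.mul_sum, Finset.sum_add_distrib]
  simp_rw [hpt]
  rw [integral_finsetSum _ fun i _ => by exact (hi1 i).add (hi2 i)]
  refine Finset.sum_eq_zero fun i _ => ?_
  obtain ⟨L, hL⟩ := (hZi i).lipschitzWith_of_hasCompactSupport (hcs i) one_ne_zero
  have key := hβ.1.integral_lipschitz hΩ hL (hcs i) ((hts i).trans hZs) i
  simp_rw [hder] at key
  rw [integral_add (hi1 i) (hi2 i), key, neg_add_cancel]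

theorem fluxIntegrand_sum {d : ℕ} {κ : Type*} (s : Finset κ) {β : Euc d → ℝ} {Dβ : Euc d → Euc d}
    {w : Euc d → ℝ} {G : Euc d → Euc d} {p : Fin d → Euc d → ℝ} {Dp : Fin d → Euc d → Euc d}
    {ζ : κ → Euc d → ℝ} (hζ : ∀ j, ContDiff ℝ ∞ (ζ j)) (x : Euc d) :
    fluxIntegrand β Dβ w G p Dp (fun x => ∑ j ∈ s, ζ j x) x =
      ∑ j ∈ s, fluxIntegrand β Dβ w G p Dp (ζ j) x := by
  have h1 : ∀ i, gradient (fun x => ∑ j ∈ s, ζ j x) x i =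
      ∑ j ∈ s, gradient (ζ j) x i := fun i => by
    simp_rw [gradient_apply_eq]
    rw [fderiv_fun_sum fun j _ => (hζ j).differentiable (by simp) x]
    simp
  unfold fluxIntegrand
  rw [Finset.sum_comm]
  refine Finset.sum_congr rfl fun i _ => ?_
  simp_rw [h1, Finset.sum_add_distrib, Finset.mul_sum, Finset.sum_mul]

section IntegrationByParts

open scoped Manifold

/-- Integration by parts on a Lipschitz domain: if the normal component of `w p` vanishes on the
boundary, then `∫ (β div (w p) + ∇β · (w p)) = 0`. -/
theorem IsLipschitzDomain.integral_by_parts {d : ℕ} (hd : 0 < d) {Ω : Set (Euc d)}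
    (hΩ : IsLipschitzDomain Ω) {β : Euc d → ℝ} {Dβ : Euc d → Euc d} (hβ : IsW1Infty Ω β Dβ)
    {w : Euc d → ℝ} {G : Euc d → Euc d} {p : Fin d → Euc d → ℝ} {Dp : Fin d → Euc d → Euc d}
    (hw : MemLp w 2 (volume.restrict Ω)) (hG : MemLp G 2 (volume.restrict Ω))
    (hp : ∀ i, MemLp (p i) 2 (volume.restrict Ω)) (hDp : ∀ i, MemLp (Dp i) 2 (volume.restrict Ω))
    {g : Euc d → ℝ} {h : Fin d → Euc d → ℝ} (htr : IsTrace Ω w G g)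
    (htr' : ∀ i, IsTrace Ω (p i) (Dp i) (h i))
    (hν : ∀ᵐ x ∂(surfaceMeasure Ω), ∀ ν, IsOuterUnitNormal Ω x ν →
      (∑ i, h i x * ν i) * g x = 0) :
    ∫ x in Ω, ∑ i, (β x * (G x i * p i x) + β x * (w x * Dp i x i) + Dβ x i * (w x * p i x))
      = 0 := by
  obtain ⟨n, rfl⟩ : ∃ n, d = n + 1 := ⟨d - 1, by omega⟩
  obtain ⟨hg, φ, hφ, hφw, hφG, hφg⟩ := htr
  choose hh ψ hψ hψp hψD hψh using htr'
  -- the identity localized to a small ball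
  have hloc : ∀ z ∈ closure Ω, ∃ ρ > 0, ∀ ζ : Euc (n + 1) → ℝ, ContDiff ℝ ∞ ζ →
      HasCompactSupport ζ → tsupport ζ ⊆ Metric.ball z ρ →
      ∫ x in Ω, fluxIntegrand β Dβ w G p Dp ζ x = 0 := by
    intro z hz
    -- it suffices that the identity holds asymptotically for the approximating smooth fields
    have hred : ∀ ζ : Euc (n + 1) → ℝ, ContDiff ℝ ∞ ζ →
        Tendsto (fun m => ‖∫ x in Ω, (β x * divergence (productField ζ (φ m) fun i => ψ i m) x +
          ⟪Dβ x, productField ζ (φ m) (fun i => ψ i m) x⟫)‖ₑ) atTop (𝓝 0) →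
        ∫ x in Ω, fluxIntegrand β Dβ w G p Dp ζ x = 0 := by
      intro ζ hζ hlim
      have h1 := (tendsto_integral_fluxIntegrand hΩ.isBounded hβ hw hG hp hDp hζ hφ hψ hφw hφG
        hψp hψD).enorm
      simp_rw [mul_divergence_productField hζ (hφ _) (fun i => hψ i _)] at hlim
      exact enorm_eq_zero.1 (tendsto_nhds_unique h1 hlim)
    have hsm : ∀ ζ : Euc (n + 1) → ℝ, ContDiff ℝ ∞ ζ → ∀ m,
        ContDiff ℝ 1 (productField ζ (φ m) fun i => ψ i m) := fun ζ hζ m =>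
      contDiff_productField hζ (hφ m) fun i => hψ i m
    have hcs : ∀ ζ : Euc (n + 1) → ℝ, HasCompactSupport ζ → ∀ m,
        HasCompactSupport (productField ζ (φ m) fun i => ψ i m) := fun ζ hζc m =>
      hζc.of_isClosed_subset (isClosed_tsupport _) (tsupport_productField_subset _ _ _)
    by_cases hzΩ : z ∈ Ω
    · obtain ⟨ρ, hρ, hb⟩ := Metric.isOpen_iff.1 hΩ.isOpen z hzΩ
      refine ⟨ρ, hρ, fun ζ hζ hζc hζs => hred ζ hζ ?_⟩
      simp_rw [fun m => integral_divergence_of_tsupport_subset hΩ.isOpen hβ (hsm ζ hζ m)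
        (hcs ζ hζc m) ((tsupport_productField_subset _ _ _).trans (hζs.trans hb))]
      simp
    · have hfr : z ∈ frontier Ω := ⟨hz, by rwa [hΩ.isOpen.interior_eq]⟩
      obtain ⟨e, ρ, L, γ, hρ, hc⟩ := hΩ.exists_chart hfr
      obtain ⟨c⟩ := nonempty_heightCoordinates hc.norm_e
      obtain ⟨C, hC⟩ := hc.exists_flux_bound hΩ.isOpen c hβ
      refine ⟨ρ, hρ, fun ζ hζ hζc hζs => hred ζ hζ ?_⟩
      have h1 := hc.tendsto_flux_zero c hg hh hφ hψ hφg hψh hν hζ hζc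
      have h2 := ENNReal.Tendsto.const_mul (a := (C : ℝ≥0∞)) h1 (Or.inr ENNReal.coe_ne_top)
      rw [mul_zero] at h2
      exact tendsto_of_tendsto_of_tendsto_of_le_of_le tendsto_const_nhds h2 (fun _ => zero_le)
        fun m => hC _ (hsm ζ hζ m) (hcs ζ hζc m)
          ((tsupport_productField_subset _ _ _).trans hζs)
  -- the local identities are summed with a partition of unity
  choose! ρ hρ hloc using hloc
  obtain ⟨t, htΩ, htc⟩ := hΩ.isBounded.isCompact_closure.elim_nhds_subcover
    (fun z => Metric.ball z (ρ z)) fun z hz => Metric.ball_mem_nhds z (hρ z hz)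
  obtain ⟨f, hf⟩ := SmoothPartitionOfUnity.exists_isSubordinate 𝓘(ℝ, Euc (n + 1))
    (isClosed_closure (s := Ω)) (fun z : t => Metric.ball (z : Euc (n + 1)) (ρ z))
    (fun z => Metric.isOpen_ball) (htc.trans (by simp [iUnion_subtype]))
  have hfs : ∀ j, ContDiff ℝ ∞ (f j) := fun j => (f j).contMDiff.contDiff
  have hfc : ∀ j, HasCompactSupport (f j) := fun j =>
    HasCompactSupport.of_support_subset_isCompact (isCompact_closedBall (j : Euc (n + 1)) (ρ j))
      (((subset_tsupport _).trans (hf j)).trans Metric.ball_subset_closedBall)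
  have hone : ∀ x ∈ closure Ω, ∑ j, f j x = 1 := fun x hx => by
    rw [← finsum_eq_sum_of_fintype]
    exact f.sum_eq_one hx
  have hsum : ∀ x ∈ Ω, ∑ j, fluxIntegrand β Dβ w G p Dp (f j) x =
      ∑ i, (β x * (G x i * p i x) + β x * (w x * Dp i x i) + Dβ x i * (w x * p i x)) := by
    intro x hx
    rw [← fluxIntegrand_sum _ hfs]
    have hev : (fun x => ∑ j, f j x) =ᶠ[𝓝 x] fun _ => (1 : ℝ) := by
      filter_upwards [hΩ.isOpen.mem_nhds hx] with y hy using hone y (subset_closure hy)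
    have hgr : ∀ i, gradient (fun x => ∑ j, f j x) x i = 0 := fun i => by
      rw [gradient_apply_eq, hev.fderiv_eq]
      simp
    refine Finset.sum_congr rfl fun i _ => ?_
    simp only [hgr, hone x (subset_closure hx)]
    ring
  rw [← setIntegral_congr_fun hΩ.isOpen.measurableSet hsum, integral_finsetSum _ fun j _ =>
    integrable_fluxIntegrand hΩ.isBounded hβ hw hG hp hDp (hfs j)]
  exact Finset.sum_eq_zero fun j _ => hloc j (htΩ j j.2) _ (hfs j) (hfc j) (hf j)

end IntegrationByParts

/-! ### The Poincaré inequality on convex sets -/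

theorem lintegral_sq_le {X : Type*} [MeasurableSpace X] {μ : Measure X} {f : X → ℝ≥0∞}
    (hf : AEMeasurable f μ) : (∫⁻ x, f x ∂μ) ^ 2 ≤ μ univ * ∫⁻ x, f x ^ 2 ∂μ := by
  have h := ENNReal.lintegral_mul_le_Lp_mul_Lq μ Real.HolderConjugate.two_two hf
    (aemeasurable_const (b := (1 : ℝ≥0∞)))
  simp only [Pi.mul_apply, mul_one, ENNReal.one_rpow, lintegral_const, one_mul] at h
  calc (∫⁻ x, f x ∂μ) ^ 2
      ≤ ((∫⁻ x, f x ^ (2 : ℝ) ∂μ) ^ (1 / (2 : ℝ)) * μ univ ^ (1 / (2 : ℝ))) ^ 2 := by gcongr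
    _ = μ univ * ∫⁻ x, f x ^ 2 ∂μ := by
        rw [mul_pow, ← ENNReal.rpow_natCast, ← ENNReal.rpow_natCast, ← ENNReal.rpow_mul,
          ← ENNReal.rpow_mul, mul_comm]
        norm_num

theorem lintegral_comp_add_smul {d : ℕ} {F : Euc d → ℝ≥0∞} (hF : Measurable F) (a : Euc d)
    {t : ℝ} (ht : t ≠ 0) :
    ∫⁻ x, F (a + t • x) = ENNReal.ofReal |(t ^ d)⁻¹| * ∫⁻ x, F x := by
  have h1 : Measurable fun x => F (a + x) := hF.comp (measurable_const_add a)
  have h2 := lintegral_map (μ := (volume : Measure (Euc d))) h1 (measurable_const_smul t)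
  rw [Measure.map_addHaar_smul _ ht, lintegral_smul_measure, lintegral_add_left_eq_self] at h2
  rw [← h2]
  simp

/-- The fundamental theorem of calculus along a segment, with the Cauchy-Schwarz inequality. -/
theorem enorm_sub_sq_le {d : ℕ} {φ : Euc d → ℝ} (hφ : ContDiff ℝ 1 φ) (x y : Euc d) :
    ‖φ x - φ y‖ₑ ^ 2 ≤
      ‖x - y‖ₑ ^ 2 * ∫⁻ t in Ioc (0 : ℝ) 1, ‖fderiv ℝ φ (y + t • (x - y))‖ₑ ^ 2 := by
  have hc : Continuous fun t : ℝ => fderiv ℝ φ (y + t • (x - y)) :=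
    (hφ.continuous_fderiv one_ne_zero).comp (by fun_prop)
  have hder : ∀ t ∈ uIcc (0 : ℝ) 1, HasDerivAt (fun t : ℝ => φ (y + t • (x - y)))
      (fderiv ℝ φ (y + t • (x - y)) (x - y)) t := fun t _ => by
    have h1 : HasDerivAt (fun t : ℝ => y + t • (x - y)) (x - y) t := by
      simpa using ((hasDerivAt_id t).smul_const (x - y)).const_add y
    exact (hφ.differentiable one_ne_zero _).hasFDerivAt.comp_hasDerivAt t h1
  have hftc := intervalIntegral.integral_eq_sub_of_hasDerivAt hder
    ((hc.clm_apply continuous_const).intervalIntegrable 0 1)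
  simp only [one_smul, zero_smul, add_zero, add_sub_cancel] at hftc
  rw [intervalIntegral.integral_of_le zero_le_one] at hftc
  rw [← hftc]
  have hm : Measurable fun t : ℝ => ‖fderiv ℝ φ (y + t • (x - y))‖ₑ :=
    (continuous_enorm.comp hc).measurable
  calc ‖∫ t in Ioc (0 : ℝ) 1, fderiv ℝ φ (y + t • (x - y)) (x - y)‖ₑ ^ 2
      ≤ (∫⁻ t in Ioc (0 : ℝ) 1, ‖fderiv ℝ φ (y + t • (x - y))‖ₑ * ‖x - y‖ₑ) ^ 2 := by
        gcongr
        refine (enorm_integral_le_lintegral_enorm _).trans (lintegral_mono fun t => ?_)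
        exact ContinuousLinearMap.le_opENorm _ _
    _ = ‖x - y‖ₑ ^ 2 * (∫⁻ t in Ioc (0 : ℝ) 1, ‖fderiv ℝ φ (y + t • (x - y))‖ₑ) ^ 2 := by
        rw [lintegral_mul_const _ hm, mul_pow, mul_comm]
    _ ≤ _ := by
        gcongr
        refine (lintegral_sq_le hm.aemeasurable).trans_eq ?_
        simp

/-- A change of variables along segments: of the two endpoints, the one with the larger weight is
used as the variable of integration, so the Jacobian is at most `2 ^ d`. -/
theorem lintegral_lintegral_segment_le {d : ℕ} {F : Euc d → ℝ≥0∞} (hF : Measurable F)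
    (O : Set (Euc d)) (t : ℝ) :
    ∫⁻ x in O, ∫⁻ y in O, F (y + t • (x - y)) ≤ 2 ^ d * volume O * ∫⁻ x, F x := by
  have key : ∀ s : ℝ, 1 / 2 ≤ s → ∀ a : Euc d,
      ∫⁻ x in O, F (a + s • x) ≤ 2 ^ d * ∫⁻ x, F x := fun s hs a => by
    refine (setLIntegral_le_lintegral _ _).trans ?_
    have hs0 : 0 < s := by linarith
    rw [lintegral_comp_add_smul hF a hs0.ne']
    gcongr
    rw [← inv_pow, abs_of_nonneg (by positivity), ENNReal.ofReal_pow (by positivity)]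
    gcongr
    rw [← ENNReal.ofReal_ofNat]
    refine ENNReal.ofReal_le_ofReal ?_
    rw [inv_le_comm₀ hs0 (by norm_num)]
    linarith
  have hconst : ∫⁻ _ in O, 2 ^ d * (∫⁻ x, F x) = 2 ^ d * volume O * ∫⁻ x, F x := by
    rw [setLIntegral_const]; ring
  rcases le_total (1 / 2) t with ht | ht
  · rw [lintegral_lintegral_swap, ← hconst]
    · refine lintegral_mono fun y => ?_
      have h := key t ht (y - t • y)
      refine le_of_eq_of_le (lintegral_congr fun x => ?_) h
      congr 1
      rw [smul_sub]
      abel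
    · exact (hF.comp (by fun_prop)).aemeasurable
  · rw [← hconst]
    refine lintegral_mono fun x => ?_
    have h := key (1 - t) (by linarith) (t • x)
    refine le_of_eq_of_le (lintegral_congr fun y => ?_) h
    congr 1
    rw [smul_sub, sub_smul, one_smul]
    abel

/-- The Poincaré inequality on a convex set in terms of differences of function values: these are
integrals of the gradient along segments, which stay in the set. -/
theorem lintegral_lintegral_sub_sq_le {d : ℕ} {O : Set (Euc d)} (hO : IsOpen O)
    (hconv : Convex ℝ O) {R : ℝ} (hR : ∀ x ∈ O, ∀ y ∈ O, dist x y ≤ R) {φ : Euc d → ℝ}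
    (hφ : ContDiff ℝ 1 φ) :
    ∫⁻ x in O, ∫⁻ y in O, ‖φ x - φ y‖ₑ ^ 2 ≤
      ENNReal.ofReal R ^ 2 * (2 ^ d * volume O * ∫⁻ x in O, ‖fderiv ℝ φ x‖ₑ ^ 2) := by
  set F : Euc d → ℝ≥0∞ := O.indicator fun x => ‖fderiv ℝ φ x‖ₑ ^ 2 with hF
  have hFm : Measurable F :=
    ((continuous_enorm.comp (hφ.continuous_fderiv one_ne_zero)).measurable.pow_const 2).indicator
      hO.measurableSet
  have hFO : ∫⁻ x in O, ‖fderiv ℝ φ x‖ₑ ^ 2 = ∫⁻ x, F x :=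
    (lintegral_indicator hO.measurableSet _).symm
  rw [hFO]
  have hm3 : Measurable fun q : Euc d × Euc d × ℝ => F (q.2.1 + q.2.2 • (q.1 - q.2.1)) :=
    hFm.comp (by fun_prop)
  have hm1 : ∀ x, Measurable fun q : Euc d × ℝ => F (q.1 + q.2 • (x - q.1)) := fun x =>
    hFm.comp (by fun_prop)
  calc ∫⁻ x in O, ∫⁻ y in O, ‖φ x - φ y‖ₑ ^ 2
      ≤ ∫⁻ x in O, ∫⁻ y in O, ENNReal.ofReal R ^ 2 *
          ∫⁻ t in Ioc (0 : ℝ) 1, F (y + t • (x - y)) := by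
        refine setLIntegral_mono' hO.measurableSet fun x hx =>
          setLIntegral_mono' hO.measurableSet fun y hy => (enorm_sub_sq_le hφ x y).trans ?_
        refine mul_le_mul' (pow_le_pow_left' ?_ 2) (setLIntegral_mono' measurableSet_Ioc
          fun t ht => ?_)
        · rw [← ofReal_norm, ← dist_eq_norm]
          exact ENNReal.ofReal_le_ofReal (hR x hx y hy)
        · have : y + t • (x - y) ∈ O := hconv.add_smul_sub_mem hy hx ⟨ht.1.le, ht.2⟩
          rw [hF, indicator_of_mem this]
    _ = ENNReal.ofReal R ^ 2 * ∫⁻ x in O, ∫⁻ y in O,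
          ∫⁻ t in Ioc (0 : ℝ) 1, F (y + t • (x - y)) := by
        simp_rw [lintegral_const_mul' _ _ (ENNReal.pow_ne_top ENNReal.ofReal_ne_top)]
    _ = ENNReal.ofReal R ^ 2 * ∫⁻ t in Ioc (0 : ℝ) 1, ∫⁻ x in O, ∫⁻ y in O,
          F (y + t • (x - y)) := by
        congr 1
        rw [lintegral_lintegral_swap (f := fun t x => ∫⁻ y in O, F (y + t • (x - y)))]
        · refine lintegral_congr fun x => ?_
          exact lintegral_lintegral_swap (hm1 x).aemeasurable
        · have : Measurable fun q : (ℝ × Euc d) × Euc d => F (q.2 + q.1.1 • (q.1.2 - q.2)) :=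
            hFm.comp (by fun_prop)
          exact this.lintegral_prod_right'.aemeasurable
    _ ≤ ENNReal.ofReal R ^ 2 * ∫⁻ _ in Ioc (0 : ℝ) 1, 2 ^ d * volume O * ∫⁻ x, F x := by
        gcongr with t
        exact lintegral_lintegral_segment_le hFm O t
    _ = _ := by simp

/-- The Poincaré inequality on a convex set `O`, with the mean value taken over a subset `B`. -/
theorem lintegral_sub_average_sq_le {d : ℕ} {O B : Set (Euc d)} (hO : IsOpen O)
    (hconv : Convex ℝ O) {R : ℝ} (hR : ∀ x ∈ O, ∀ y ∈ O, dist x y ≤ R) (hBO : B ⊆ O)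
    (hOfin : volume O ≠ ⊤) (hB0 : volume B ≠ 0) {φ : Euc d → ℝ} (hφ : ContDiff ℝ 1 φ)
    (hφB : IntegrableOn φ B) :
    volume B * ∫⁻ x in O, ‖φ x - ⨍ y in B, φ y‖ₑ ^ 2 ≤
      ENNReal.ofReal R ^ 2 * (2 ^ d * volume O * ∫⁻ x in O, ‖fderiv ℝ φ x‖ₑ ^ 2) := by
  have hBfin : volume B ≠ ⊤ := ne_top_of_le_ne_top hOfin (measure_mono hBO)
  refine le_trans ?_ (lintegral_lintegral_sub_sq_le hO hconv hR hφ)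
  rw [← lintegral_const_mul' _ _ hBfin]
  refine lintegral_mono fun x => ?_
  have hBr : volume.real B ≠ 0 := (measureReal_ne_zero_iff hBfin).2 hB0
  have hav : (volume.real B) * (φ x - ⨍ y in B, φ y) = ∫ y in B, (φ x - φ y) := by
    have : IsFiniteMeasure (volume.restrict B) := isFiniteMeasure_restrict.2 hBfin
    rw [integral_sub (integrable_const _) hφB, setAverage_eq, setIntegral_const]
    simp only [smul_eq_mul]
    field_simp
  have h1 : volume B * ‖φ x - ⨍ y in B, φ y‖ₑ = ‖∫ y in B, (φ x - φ y)‖ₑ := by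
    rw [← hav, enorm_mul, Real.enorm_of_nonneg measureReal_nonneg, ofReal_measureReal hBfin]
  have hm : Measurable fun y => ‖φ x - φ y‖ₑ :=
    (continuous_enorm.comp (continuous_const.sub hφ.continuous)).measurable
  have h2 : volume B * (volume B * ‖φ x - ⨍ y in B, φ y‖ₑ ^ 2) ≤
      volume B * ∫⁻ y in O, ‖φ x - φ y‖ₑ ^ 2 := by
    calc volume B * (volume B * ‖φ x - ⨍ y in B, φ y‖ₑ ^ 2)
        = (volume B * ‖φ x - ⨍ y in B, φ y‖ₑ) ^ 2 := by ring
      _ ≤ (∫⁻ y in B, ‖φ x - φ y‖ₑ) ^ 2 := by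
          rw [h1]
          gcongr
          exact enorm_integral_le_lintegral_enorm _
      _ ≤ volume B * ∫⁻ y in B, ‖φ x - φ y‖ₑ ^ 2 := by
          refine (lintegral_sq_le hm.aemeasurable).trans_eq ?_
          rw [Measure.restrict_apply_univ]
      _ ≤ volume B * ∫⁻ y in O, ‖φ x - φ y‖ₑ ^ 2 := by
          gcongr
  exact (ENNReal.mul_le_mul_iff_right hB0 hBfin).1 h2

/-! ### The data covering -/

namespace IsDataCovering

variable {d m : ℕ} {Ω : Set (Euc d)} {B K : Fin m → Set (Euc d)}

/-- The sets `K i` are only required to lie in the closure of the domain. -/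
theorem interior_subset_domain (h : IsDataCovering Ω B K) (hΩ : IsLipschitzDomain Ω) (i : Fin m) :
    interior (K i) ⊆ Ω :=
  (interior_mono (h.K_subset i)).trans_eq hΩ.interior_closure

theorem subset_interior (h : IsDataCovering Ω B K) (i : Fin m) : B i ⊆ interior (K i) :=
  (h.isOpen_B i).subset_interior_iff.2 (h.B_subset_K i)

/-- The boundary of a convex set is a null set. -/
theorem interior_ae_eq (h : IsDataCovering Ω B K) (i : Fin m) :
    (interior (K i) : Set (Euc d)) =ᵐ[volume] K i :=
  interior_ae_eq_of_null_frontier ((h.convex_K i).addHaar_frontier volume)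

theorem isBounded_K (h : IsDataCovering Ω B K) (hΩ : IsLipschitzDomain Ω) (i : Fin m) :
    Bornology.IsBounded (K i) :=
  hΩ.isBounded.closure.subset (h.K_subset i)

theorem diam_le (i : Fin m) (A : Fin m → Set (Euc d)) : Metric.diam (A i) ≤ maxDiam A :=
  le_ciSup (f := fun i => Metric.diam (A i)) (Set.finite_range _).bddAbove i

theorem ncard_le (K : Fin m → Set (Euc d)) {x : Euc d} (hx : x ∈ Ω) :
    {i | x ∈ K i}.ncard ≤ maxOverlap Ω K := by
  refine le_ciSup (f := fun x : Ω => {i | (x : Euc d) ∈ K i}.ncard) ⟨m, ?_⟩ ⟨x, hx⟩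
  rintro _ ⟨y, rfl⟩
  refine (Set.ncard_le_card _).trans_eq ?_
  simp

theorem volume_ne_top (h : IsDataCovering Ω B K) (hΩ : IsLipschitzDomain Ω) (i : Fin m) :
    volume (K i) ≠ ⊤ := (h.isBounded_K hΩ i).measure_lt_top.ne

theorem volume_B_ne_zero (h : IsDataCovering Ω B K) (i : Fin m) : volume (B i) ≠ 0 :=
  ((h.isOpen_B i).measure_pos volume (h.nonempty_B i)).ne'

theorem volume_B_ne_top (h : IsDataCovering Ω B K) (hΩ : IsLipschitzDomain Ω) (i : Fin m) :
    volume (B i) ≠ ⊤ := ne_top_of_le_ne_top (h.volume_ne_top hΩ i) (measure_mono (h.B_subset_K i))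

theorem volume_B_pos (h : IsDataCovering Ω B K) (hΩ : IsLipschitzDomain Ω) (i : Fin m) :
    0 < volume.real (B i) :=
  ENNReal.toReal_pos (h.volume_B_ne_zero i) (h.volume_B_ne_top hΩ i)

theorem volume_K_le (h : IsDataCovering Ω B K) (hΩ : IsLipschitzDomain Ω) {η : ℝ}
    (hη : mismatch B K ≤ η) (i : Fin m) :
    volume (K i) ≤ ENNReal.ofReal η * volume (B i) := by
  have hBpos := h.volume_B_pos hΩ i
  have hreal : volume.real (K i) ≤ η * volume.real (B i) := by
    unfold mismatch at hη
    split_ifs at hη with heq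
    · rw [← heq i]
      exact le_mul_of_one_le_left hBpos.le hη
    · have h1 : volume.real (K i) / volume.real (B i) ≤
          ⨆ i, volume.real (K i) / volume.real (B i) :=
        le_ciSup (f := fun i => volume.real (K i) / volume.real (B i))
          (Set.finite_range _).bddAbove i
      have h2 : 0 ≤ volume.real (K i) / volume.real (B i) := by positivity
      rw [← div_le_iff₀ hBpos]
      linarith
  rw [← ofReal_measureReal (h.volume_ne_top hΩ i), ← ofReal_measureReal (h.volume_B_ne_top hΩ i),
    ← ENNReal.ofReal_mul' hBpos.le]
  exact ENNReal.ofReal_le_ofReal hreal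

/-- Sets with overlap at most `M`: the sum of the integrals is at most `M` times the integral. -/
theorem sum_setLIntegral_le (hΩ : MeasurableSet Ω) {A : Fin m → Set (Euc d)}
    (hA : ∀ i, MeasurableSet (A i)) (hAK : ∀ i, A i ⊆ K i) (hAΩ : ∀ i, A i ⊆ Ω)
    {f : Euc d → ℝ≥0∞} (hf : AEMeasurable f (volume.restrict Ω)) :
    ∑ i, ∫⁻ x in A i, f x ≤ maxOverlap Ω K * ∫⁻ x in Ω, f x := by
  classical
  have h1 : ∀ i, ∫⁻ x in A i, f x = ∫⁻ x in Ω, (A i).indicator f x := fun i => by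
    rw [lintegral_indicator (hA i), Measure.restrict_restrict (hA i), inter_eq_left.2 (hAΩ i)]
  simp_rw [h1]
  rw [← lintegral_finsetSum' _ fun i _ => hf.indicator (hA i), ← lintegral_const_mul'' _ hf]
  refine setLIntegral_mono' hΩ fun x hx => ?_
  simp_rw [indicator_apply]
  rw [← Finset.sum_filter, Finset.sum_const, nsmul_eq_mul]
  gcongr
  refine le_trans ?_ (ncard_le K hx)
  rw [Set.ncard_eq_toFinset_card']
  refine Finset.card_le_card fun i hi => ?_
  simp only [Finset.mem_filter, Finset.mem_univ, true_and] at hi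
  simpa using hAK i hi

theorem setLIntegral_le_sum (h : IsDataCovering Ω B K) (f : Euc d → ℝ≥0∞) :
    ∫⁻ x in Ω, f x ≤ ∑ i, ∫⁻ x in interior (K i), f x := by
  have hcl : ∀ i, (closure (K i) : Set (Euc d)) =ᵐ[volume] interior (K i) := fun i =>
    (closure_ae_eq_of_null_frontier ((h.convex_K i).addHaar_frontier volume)).trans
      (h.interior_ae_eq i).symm
  calc ∫⁻ x in Ω, f x ≤ ∫⁻ x in ⋃ i, closure (K i), f x := lintegral_mono_set h.cover
    _ ≤ ∑' i, ∫⁻ x in closure (K i), f x := lintegral_iUnion_le _ _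
    _ = ∑ i, ∫⁻ x in interior (K i), f x := by
        rw [tsum_fintype]
        exact Finset.sum_congr rfl fun i _ => setLIntegral_congr (hcl i)

theorem nonempty_index (h : IsDataCovering Ω B K) (hΩ : IsLipschitzDomain Ω) :
    Nonempty (Fin m) := by
  obtain ⟨x, hx⟩ := hΩ.isConnected.nonempty
  obtain ⟨i, _⟩ := mem_iUnion.1 (h.cover hx)
  exact ⟨i⟩

theorem maxDiam_pos (h : IsDataCovering Ω B K) (hΩ : IsLipschitzDomain Ω) (hd : 0 < d) :
    0 < maxDiam K := by
  obtain ⟨i⟩ := h.nonempty_index hΩ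
  refine lt_of_lt_of_le ?_ (diam_le i K)
  by_contra hle
  have h0 : Metric.diam (K i) = 0 := le_antisymm (not_lt.1 hle) Metric.diam_nonneg
  have hsub : (K i).Subsingleton := fun x hx y hy => dist_le_zero.1
    ((Metric.dist_le_diam_of_mem (h.isBounded_K hΩ i) hx hy).trans_eq h0)
  have : Nonempty (Fin d) := ⟨⟨0, hd⟩⟩
  exact h.volume_B_ne_zero i ((hsub.anti (h.B_subset_K i)).measure_zero volume)

/-- The Poincaré inequality with respect to the data: the `L²`-norm is controlled by the gradient,
at the scale `maxDiam K`, and by the mean values over the sets `B i`. -/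
theorem sq_eLpNorm_le (h : IsDataCovering Ω B K) (hΩ : IsLipschitzDomain Ω) {η : ℝ}
    (hη : mismatch B K ≤ η) {φ : Euc d → ℝ} (hφ : ContDiff ℝ 1 φ) :
    ∫⁻ x in Ω, ‖φ x‖ₑ ^ 2 ≤
      2 * (ENNReal.ofReal (maxDiam K) ^ 2 * (2 ^ d * ENNReal.ofReal η)) * maxOverlap Ω K *
        (∫⁻ x in Ω, ‖fderiv ℝ φ x‖ₑ ^ 2) +
      2 * ENNReal.ofReal η * ∑ i, volume (B i) * ‖⨍ y in B i, φ y‖ₑ ^ 2 := by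
  have hm : Measurable fun x => ‖fderiv ℝ φ x‖ₑ ^ 2 :=
    (continuous_enorm.comp (hφ.continuous_fderiv one_ne_zero)).measurable.pow_const 2
  have hterm : ∀ i, ∫⁻ x in interior (K i), ‖φ x‖ₑ ^ 2 ≤
      2 * (ENNReal.ofReal (maxDiam K) ^ 2 * (2 ^ d * ENNReal.ofReal η)) *
        (∫⁻ x in interior (K i), ‖fderiv ℝ φ x‖ₑ ^ 2) +
      2 * ENNReal.ofReal η * (volume (B i) * ‖⨍ y in B i, φ y‖ₑ ^ 2) := by
    intro i
    have hvK : volume (interior (K i)) ≤ ENNReal.ofReal η * volume (B i) :=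
      (measure_mono interior_subset).trans (h.volume_K_le hΩ hη i)
    have hBi := h.volume_B_ne_top hΩ i
    have hb0 := h.volume_B_ne_zero i
    set a := ⨍ y in B i, φ y with ha
    have hdev : ∫⁻ x in interior (K i), ‖φ x - a‖ₑ ^ 2 ≤
        (ENNReal.ofReal (maxDiam K) ^ 2 * (2 ^ d * ENNReal.ofReal η)) *
          ∫⁻ x in interior (K i), ‖fderiv ℝ φ x‖ₑ ^ 2 := by
      have h1 := lintegral_sub_average_sq_le isOpen_interior (h.convex_K i).interior
        (R := maxDiam K) (fun x hx y hy => (Metric.dist_le_diam_of_mem (h.isBounded_K hΩ i)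
          (interior_subset hx) (interior_subset hy)).trans (diam_le i K))
        (h.subset_interior i) (ne_top_of_le_ne_top (h.volume_ne_top hΩ i)
          (measure_mono interior_subset)) hb0 hφ
        ((hφ.continuous.continuousOn.integrableOn_compact
          (h.isBounded_K hΩ i).isCompact_closure).mono_set
          ((h.B_subset_K i).trans subset_closure))
      have h2 : volume (B i) * ∫⁻ x in interior (K i), ‖φ x - a‖ₑ ^ 2 ≤
          volume (B i) * ((ENNReal.ofReal (maxDiam K) ^ 2 * (2 ^ d * ENNReal.ofReal η)) *
          ∫⁻ x in interior (K i), ‖fderiv ℝ φ x‖ₑ ^ 2) := by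
        refine h1.trans ?_
        calc _ ≤ ENNReal.ofReal (maxDiam K) ^ 2 * (2 ^ d * (ENNReal.ofReal η * volume (B i)) *
              ∫⁻ x in interior (K i), ‖fderiv ℝ φ x‖ₑ ^ 2) := by gcongr
          _ = _ := by ring
      exact (ENNReal.mul_le_mul_iff_right hb0 hBi).1 h2
    have hpt : ∀ x, ‖φ x‖ₑ ^ 2 ≤ 2 * ‖φ x - a‖ₑ ^ 2 + 2 * ‖a‖ₑ ^ 2 := fun x => by
      rw [← ofReal_norm, ← ofReal_norm, ← ofReal_norm, ← ENNReal.ofReal_pow (norm_nonneg _),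
        ← ENNReal.ofReal_pow (norm_nonneg _), ← ENNReal.ofReal_pow (norm_nonneg _),
        ← ENNReal.ofReal_ofNat 2, ← ENNReal.ofReal_mul (by norm_num),
        ← ENNReal.ofReal_mul (by norm_num), ← ENNReal.ofReal_add (by positivity) (by positivity)]
      refine ENNReal.ofReal_le_ofReal ?_
      simp only [Real.norm_eq_abs, sq_abs]
      nlinarith [sq_nonneg (φ x - 2 * a)]
    have hm' : Measurable fun x => ‖φ x - a‖ₑ ^ 2 :=
      (continuous_enorm.comp (hφ.continuous.sub continuous_const)).measurable.pow_const 2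
    calc ∫⁻ x in interior (K i), ‖φ x‖ₑ ^ 2
        ≤ ∫⁻ x in interior (K i), (2 * ‖φ x - a‖ₑ ^ 2 + 2 * ‖a‖ₑ ^ 2) := lintegral_mono hpt
      _ = 2 * (∫⁻ x in interior (K i), ‖φ x - a‖ₑ ^ 2) +
            2 * ‖a‖ₑ ^ 2 * volume (interior (K i)) := by
          rw [lintegral_add_right _ measurable_const, lintegral_const_mul _ hm',
            setLIntegral_const]
      _ ≤ 2 * ((ENNReal.ofReal (maxDiam K) ^ 2 * (2 ^ d * ENNReal.ofReal η)) *
            ∫⁻ x in interior (K i), ‖fderiv ℝ φ x‖ₑ ^ 2) +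
            2 * ‖a‖ₑ ^ 2 * (ENNReal.ofReal η * volume (B i)) := by gcongr
      _ = _ := by ring
  refine (h.setLIntegral_le_sum _).trans ((Finset.sum_le_sum fun i _ => hterm i).trans ?_)
  rw [Finset.sum_add_distrib, ← Finset.mul_sum, ← Finset.mul_sum]
  have hov := sum_setLIntegral_le (K := K) hΩ.isOpen.measurableSet
    (fun i => isOpen_interior.measurableSet) (fun i => interior_subset)
    (h.interior_subset_domain hΩ) hm.aemeasurable.restrict (A := fun i => interior (K i))
  rw [mul_assoc _ (maxOverlap Ω K : ℝ≥0∞)]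
  gcongr

end IsDataCovering

theorem sq_eLpNorm_two {X F : Type*} [MeasurableSpace X] [NormedAddCommGroup F] {μ : Measure X}
    (f : X → F) : eLpNorm f 2 μ ^ 2 = ∫⁻ x, ‖f x‖ₑ ^ 2 ∂μ := by
  rw [eLpNorm_eq_lintegral_rpow_enorm_toReal two_ne_zero ENNReal.ofNat_ne_top,
    ← ENNReal.rpow_natCast, ← ENNReal.rpow_mul]
  norm_num

theorem tendsto_eLpNorm_two {X F : Type*} [MeasurableSpace X] [NormedAddCommGroup F]
    {μ : Measure X} {f : X → F} {fs : ℕ → X → F} (hf : MemLp f 2 μ) (hfs : ∀ n, MemLp (fs n) 2 μ)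
    (h : Tendsto (fun n => eLpNorm (fun x => fs n x - f x) 2 μ) atTop (𝓝 0)) :
    Tendsto (fun n => eLpNorm (fs n) 2 μ) atTop (𝓝 (eLpNorm f 2 μ)) := by
  have h1 := (Lp.tendsto_Lp_iff_tendsto_eLpNorm'' fs hfs f hf).2 h
  simpa only [Lp.enorm_toLp] using h1.enorm

/-- The mean square of the data, `∑ i, |B i| (⨍_{B i} v)²`. -/
theorem dataForm_self {d m : ℕ} (B : Fin m → Set (Euc d)) (v : Euc d → ℝ) :
    dataForm B v v = ∑ i, volume.real (B i) * (⨍ x in B i, v x) ^ 2 := by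
  unfold dataForm
  exact Finset.sum_congr rfl fun i _ => by ring

/-- The Poincaré inequality with respect to the data for limits of smooth functions. -/
theorem IsDataCovering.sq_norm_le {d m : ℕ} {Ω : Set (Euc d)} {B K : Fin m → Set (Euc d)}
    (h : IsDataCovering Ω B K) (hΩ : IsLipschitzDomain Ω) {η : ℝ} (hη0 : 0 ≤ η)
    (hη : mismatch B K ≤ η) (hK : 0 ≤ maxDiam K) {v : L2Pair Ω} {g : Euc d → ℝ}
    (hv : IsTrace Ω v.1 v.2 g) :
    ‖v.1‖ ^ 2 ≤ 2 * (maxDiam K ^ 2 * (2 ^ d * η)) * maxOverlap Ω K * ‖v.2‖ ^ 2 +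
      2 * η * dataForm B v.1 v.1 := by
  obtain ⟨-, φ, hφ, hφv, hφG, -⟩ := hv
  have hb := hΩ.isBounded
  have m1 : ∀ n, MemLp (φ n) 2 (volume.restrict Ω) := fun n =>
    memLp_restrict_of_continuous hb (hφ n).continuous _
  have m2 : ∀ n, MemLp (gradient (φ n)) 2 (volume.restrict Ω) := fun n =>
    memLp_restrict_of_continuous hb (continuous_gradient (hφ n)) _
  have t1 := tendsto_eLpNorm_two (Lp.memLp v.1) m1 hφv
  have t2 := tendsto_eLpNorm_two (Lp.memLp v.2) m2 hφG
  have hfin : IsFiniteMeasure (volume.restrict Ω) :=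
    isFiniteMeasure_restrict.2 hb.measure_lt_top.ne
  have t3 : ∀ i, Tendsto (fun n => ⨍ x in B i, φ n x) atTop (𝓝 (⨍ x in B i, v.1 x)) := by
    intro i
    have hB := (h.isOpen_B i).measurableSet
    have hind : MemLp ((B i).indicator fun _ => (1 : ℝ)) ⊤ (volume.restrict Ω) :=
      (memLp_const (1 : ℝ)).indicator hB
    have h1 := tendsto_integral_weight_mul hind (Lp.memLp v.1) (memLp_const (1 : ℝ)) m1
      (fun _ => memLp_const (1 : ℝ)) hφv (gs := fun _ _ => 1) (by simp)
    have h2 : ∀ f : Euc d → ℝ, ∫ x in Ω, (B i).indicator (fun _ => (1 : ℝ)) x * (f x * 1) =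
        ∫ x in B i, f x := fun f => by
      have : (fun x => (B i).indicator (fun _ => (1 : ℝ)) x * (f x * 1)) = (B i).indicator f := by
        ext x
        by_cases hx : x ∈ B i <;> simp [hx]
      rw [this, integral_indicator hB, Measure.restrict_restrict hB,
        inter_eq_left.2 (h.B_subset i)]
    simp_rw [h2] at h1
    simp_rw [setAverage_eq]
    exact h1.const_smul _
  have hsm : ∀ n, eLpNorm (φ n) 2 (volume.restrict Ω) ^ 2 ≤
      ENNReal.ofReal (2 * (maxDiam K ^ 2 * (2 ^ d * η)) * maxOverlap Ω K) *
        eLpNorm (gradient (φ n)) 2 (volume.restrict Ω) ^ 2 +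
      ENNReal.ofReal (2 * η * dataForm B (φ n) (φ n)) := by
    intro n
    rw [sq_eLpNorm_two, sq_eLpNorm_two]
    have hgr : ∀ x, ‖gradient (φ n) x‖ₑ = ‖fderiv ℝ (φ n) x‖ₑ := fun x => by
      rw [← ofReal_norm, ← ofReal_norm, gradient, LinearIsometryEquiv.norm_map]
    simp_rw [hgr]
    refine (h.sq_eLpNorm_le hΩ hη ((hφ n).of_le (by simp))).trans_eq ?_
    congr 1
    · congr 1
      rw [ENNReal.ofReal_mul (by positivity), ENNReal.ofReal_mul (by norm_num),
        ENNReal.ofReal_mul (by positivity), ENNReal.ofReal_mul (by positivity),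
        ENNReal.ofReal_pow hK, ENNReal.ofReal_pow (by norm_num)]
      simp
    · rw [dataForm_self, ENNReal.ofReal_mul (by positivity), ENNReal.ofReal_mul (by norm_num),
        ENNReal.ofReal_sum_of_nonneg fun i _ => by positivity]
      congr 1
      · simp
      · refine Finset.sum_congr rfl fun i _ => ?_
        rw [ENNReal.ofReal_mul measureReal_nonneg, ofReal_measureReal (h.volume_B_ne_top hΩ i),
          ← sq_abs, ENNReal.ofReal_pow (abs_nonneg _), ← Real.norm_eq_abs, ofReal_norm]
  have hL : Tendsto (fun n => eLpNorm (φ n) 2 (volume.restrict Ω) ^ 2) atTop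
      (𝓝 (eLpNorm v.1 2 (volume.restrict Ω) ^ 2)) :=
    ((ENNReal.continuous_pow 2).tendsto _).comp t1
  have hR : Tendsto (fun n => ENNReal.ofReal (2 * (maxDiam K ^ 2 * (2 ^ d * η)) * maxOverlap Ω K) *
        eLpNorm (gradient (φ n)) 2 (volume.restrict Ω) ^ 2 +
      ENNReal.ofReal (2 * η * dataForm B (φ n) (φ n))) atTop
      (𝓝 (ENNReal.ofReal (2 * (maxDiam K ^ 2 * (2 ^ d * η)) * maxOverlap Ω K) *
        eLpNorm v.2 2 (volume.restrict Ω) ^ 2 + ENNReal.ofReal (2 * η * dataForm B v.1 v.1))) := by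
    refine Tendsto.add (ENNReal.Tendsto.const_mul (((ENNReal.continuous_pow 2).tendsto _).comp t2)
      (Or.inr ENNReal.ofReal_ne_top)) (ENNReal.tendsto_ofReal (Tendsto.const_mul _ ?_))
    simp_rw [dataForm_self]
    exact tendsto_finsetSum _ fun i _ => ((t3 i).pow 2).const_mul _
  have hfinal := le_of_tendsto_of_tendsto' hL hR hsm
  rw [← Lp.enorm_def, ← Lp.enorm_def, ← ofReal_norm, ← ofReal_norm,
    ← ENNReal.ofReal_pow (norm_nonneg _), ← ENNReal.ofReal_pow (norm_nonneg _),
    ← ENNReal.ofReal_mul (by positivity), ← ENNReal.ofReal_add (by positivity)] at hfinal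
  · refine (ENNReal.ofReal_le_ofReal_iff ?_).1 hfinal
    rw [dataForm_self]
    positivity
  · rw [dataForm_self]
    positivity

/-! ### The energy -/

section Forms

variable {d : ℕ} {Ω : Set (Euc d)}

theorem ae_norm_le_normLinfty {F : Type*} [NormedAddCommGroup F] {k : Euc d → F}
    (hk : MemLp k ⊤ (volume.restrict Ω)) : ∀ᵐ x ∂(volume.restrict Ω), ‖k x‖ ≤ normLinfty Ω k := by
  have h : ∀ᵐ x ∂(volume.restrict Ω), ‖k x‖ₑ ≤ eLpNorm k ⊤ (volume.restrict Ω) := by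
    rw [eLpNorm_exponent_top]
    exact ae_le_eLpNormEssSup
  filter_upwards [h] with x hx
  rw [← toReal_enorm]
  exact ENNReal.toReal_mono hk.2.ne hx

/-- A weighted Cauchy-Schwarz inequality. -/
theorem abs_integral_le_mul_norm {F F' : Type*} [NormedAddCommGroup F] [NormedAddCommGroup F']
    {X : Type*} [MeasurableSpace X] {μ : Measure X} {k : X → ℝ} {W : ℝ} (hW : 0 ≤ W)
    (f : Lp F 2 μ) (g : Lp F' 2 μ) (hk : ∀ᵐ x ∂μ, |k x| ≤ W * (‖f x‖ * ‖g x‖)) :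
    |∫ x, k x ∂μ| ≤ W * ‖f‖ * ‖g‖ := by
  have h1 := eLpNorm_mul_le (Lp.memLp f).1.norm (Lp.memLp g).1.norm
  rw [eLpNorm_norm, eLpNorm_norm, ← Lp.enorm_def, ← Lp.enorm_def] at h1
  have h2 : ‖∫ x, k x ∂μ‖ₑ ≤ ENNReal.ofReal W * (‖f‖ₑ * ‖g‖ₑ) := by
    calc ‖∫ x, k x ∂μ‖ₑ ≤ ∫⁻ x, ‖k x‖ₑ ∂μ := enorm_integral_le_lintegral_enorm _
      _ ≤ ∫⁻ x, ENNReal.ofReal W * ‖‖f x‖ * ‖g x‖‖ₑ ∂μ := by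
          refine lintegral_mono_ae ?_
          filter_upwards [hk] with x hx
          rw [← ofReal_norm, ← ofReal_norm, ← ENNReal.ofReal_mul hW]
          refine ENNReal.ofReal_le_ofReal ?_
          rwa [Real.norm_eq_abs, Real.norm_of_nonneg (by positivity)]
      _ = ENNReal.ofReal W * eLpNorm (fun x => ‖f x‖ * ‖g x‖) 1 μ := by
          rw [lintegral_const_mul' _ _ ENNReal.ofReal_ne_top, eLpNorm_one_eq_lintegral_enorm]
      _ ≤ _ := by gcongr
  rw [← ofReal_norm, ← ofReal_norm, ← ofReal_norm, ← ENNReal.ofReal_mul (norm_nonneg _),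
    ← ENNReal.ofReal_mul hW, ENNReal.ofReal_le_ofReal_iff (by positivity), Real.norm_eq_abs] at h2
  linarith

theorem sq_norm_eq_integral {F : Type*} [NormedAddCommGroup F] [InnerProductSpace ℝ F]
    {X : Type*} [MeasurableSpace X] {μ : Measure X} (f : Lp F 2 μ) :
    ‖f‖ ^ 2 = ∫ x, ‖f x‖ ^ 2 ∂μ := by
  rw [← real_inner_self_eq_norm_sq, L2.inner_def]
  simp_rw [real_inner_self_eq_norm_sq]

theorem IsDiffusionCoeff.memLp {α : Euc d → ℝ} {αmin αmax : ℝ}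
    (h : IsDiffusionCoeff Ω α αmin αmax) : MemLp α ⊤ (volume.restrict Ω) := by
  refine memLp_top_of_bound h.2.1 αmax ?_
  filter_upwards [h.2.2] with x hx
  rw [Real.norm_of_nonneg (h.1.le.trans hx.1)]
  exact hx.2

variable {α σ : Euc d → ℝ}

theorem integrable_pdeForm (hα : MemLp α ⊤ (volume.restrict Ω))
    (hσ : MemLp σ ⊤ (volume.restrict Ω)) (w v : L2Pair Ω) :
    Integrable (fun x => α x * ⟪w.2 x, v.2 x⟫ + σ x * w.1 x * v.1 x) (volume.restrict Ω) := by
  refine Integrable.add ((L2.integrable_inner w.2 v.2).mul_of_top_right hα) ?_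
  simpa only [mul_assoc] using integrable_weight_mul hσ (Lp.memLp w.1) (Lp.memLp v.1)

theorem pdeForm_add_add (hα : MemLp α ⊤ (volume.restrict Ω))
    (hσ : MemLp σ ⊤ (volume.restrict Ω)) (u e : L2Pair Ω) :
    pdeForm α σ (u + e) (u + e) =
      pdeForm α σ u u + 2 * pdeForm α σ u e + pdeForm α σ e e := by
  have i1 := integrable_pdeForm hα hσ u u
  have i2 := (integrable_pdeForm hα hσ u e).const_mul 2
  unfold pdeForm
  rw [← integral_const_mul, ← integral_add i1 i2,
    ← integral_add (by exact i1.add i2) (integrable_pdeForm hα hσ e e)]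
  refine integral_congr_ae ?_
  filter_upwards [Lp.coeFn_add u.1 e.1, Lp.coeFn_add u.2 e.2] with x h1 h2
  rw [Prod.fst_add, Prod.snd_add, h1, h2, Pi.add_apply, Pi.add_apply, inner_add_add_self]
  rw [real_inner_comm (e.2 x) (u.2 x)]
  ring

theorem pdeLoad_add (f : Lp ℝ 2 (volume.restrict Ω)) (u e : L2Pair Ω) :
    pdeLoad f (u + e) = pdeLoad f u + pdeLoad f e := by
  unfold pdeLoad
  rw [← integral_add (by exact (Lp.memLp f).integrable_mul (Lp.memLp u.1))
    (by exact (Lp.memLp f).integrable_mul (Lp.memLp e.1))]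
  refine integral_congr_ae ?_
  filter_upwards [Lp.coeFn_add u.1 e.1] with x h1
  rw [Prod.fst_add, h1, Pi.add_apply]
  ring

theorem setAverage_add {A : Set (Euc d)} (hA : A ⊆ Ω) (hfin : volume Ω ≠ ⊤)
    (u e : Lp ℝ 2 (volume.restrict Ω)) :
    ⨍ x in A, (u + e) x = (⨍ x in A, u x) + ⨍ x in A, e x := by
  have hf : IsFiniteMeasure (volume.restrict Ω) := isFiniteMeasure_restrict.2 hfin
  have hle : volume.restrict A ≤ volume.restrict Ω := Measure.restrict_mono hA le_rfl
  have hi : ∀ v : Lp ℝ 2 (volume.restrict Ω), IntegrableOn v A := fun v =>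
    ((Lp.memLp v).integrable (by norm_num)).mono_measure hle
  rw [setAverage_eq, setAverage_eq, setAverage_eq, ← smul_add, ← integral_add (hi u) (hi e)]
  congr 1
  refine integral_congr_ae ?_
  exact (Lp.coeFn_add u e).filter_mono (ae_mono hle)

variable {m : ℕ} {B : Fin m → Set (Euc d)}

/-- The objective is a quadratic functional: its expansion around a point `u`. -/
theorem objective_add (hα : MemLp α ⊤ (volume.restrict Ω))
    (hσ : MemLp σ ⊤ (volume.restrict Ω))
    (hB : ∀ i, B i ⊆ Ω) (hfin : volume Ω ≠ ⊤) (f : Lp ℝ 2 (volume.restrict Ω)) (δ : ℝ)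
    (b : Fin m → ℝ) (u e : L2Pair Ω) :
    objective α σ f δ B b (u + e) = objective α σ f δ B b u
      - (augmentedLoad f δ B b e - augmentedForm α σ δ B u e)
      + 1 / 2 * augmentedForm α σ δ B e e := by
  have h1 : dataForm B (u + e).1 (u + e).1 =
      dataForm B u.1 u.1 + 2 * dataForm B u.1 e.1 + dataForm B e.1 e.1 := by
    unfold dataForm
    rw [Finset.mul_sum, ← Finset.sum_add_distrib, ← Finset.sum_add_distrib]
    refine Finset.sum_congr rfl fun i _ => ?_
    rw [Prod.fst_add, setAverage_add (hB i) hfin]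
    ring
  have h2 : dataLoad B b (u + e).1 = dataLoad B b u.1 + dataLoad B b e.1 := by
    unfold dataLoad
    rw [← Finset.sum_add_distrib]
    refine Finset.sum_congr rfl fun i _ => ?_
    rw [Prod.fst_add, setAverage_add (hB i) hfin]
    ring
  unfold objective augmentedForm augmentedLoad
  rw [h1, h2, pdeForm_add_add hα hσ, pdeLoad_add]
  ring

theorem IsDiffusionCoeff.le_pdeForm {αmin αmax : ℝ} (hα : IsDiffusionCoeff Ω α αmin αmax)
    (hσ : IsReactionCoeff Ω σ) (e : L2Pair Ω) : αmin * ‖e.2‖ ^ 2 ≤ pdeForm α σ e e := by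
  rw [sq_norm_eq_integral, ← integral_const_mul]
  refine integral_mono_ae ((Lp.memLp e.2).norm.integrable_sq.const_mul _)
    (integrable_pdeForm hα.memLp hσ.1 e e) ?_
  filter_upwards [hα.2.2, hσ.2] with x h1 h2
  rw [real_inner_self_eq_norm_sq]
  have := mul_nonneg h2 (mul_self_nonneg (e.1 x))
  have := mul_le_mul_of_nonneg_right h1.1 (sq_nonneg ‖e.2 x‖)
  linarith

theorem IsDiffusionCoeff.pdeForm_le {αmin αmax : ℝ} (hα : IsDiffusionCoeff Ω α αmin αmax)
    (hσ : IsReactionCoeff Ω σ) (e : L2Pair Ω) :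
    pdeForm α σ e e ≤ αmax * ‖e.2‖ ^ 2 + normLinfty Ω σ * ‖e.1‖ ^ 2 := by
  have i1 := (Lp.memLp e.2).norm.integrable_sq.const_mul αmax
  have i2 := (Lp.memLp e.1).norm.integrable_sq.const_mul (normLinfty Ω σ)
  rw [sq_norm_eq_integral, sq_norm_eq_integral, ← integral_const_mul, ← integral_const_mul,
    ← integral_add i1 i2]
  refine integral_mono_ae (integrable_pdeForm hα.memLp hσ.1 e e) (i1.add i2) ?_
  filter_upwards [hα.2.2, ae_norm_le_normLinfty hσ.1] with x h1 h2
  rw [real_inner_self_eq_norm_sq, Real.norm_eq_abs, sq_abs]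
  have h3 := mul_le_mul_of_nonneg_right ((le_abs_self _).trans h2) (sq_nonneg (e.1 x))
  have h4 := mul_le_mul_of_nonneg_right h1.2 (sq_nonneg ‖e.2 x‖)
  linarith

theorem dataForm_self_nonneg (B : Fin m → Set (Euc d)) (v : Euc d → ℝ) : 0 ≤ dataForm B v v := by
  rw [dataForm_self]
  positivity

/-- Averaging is a contraction in mean square, up to the overlap. -/
theorem IsDataCovering.dataForm_le {K : Fin m → Set (Euc d)} (h : IsDataCovering Ω B K)
    (hΩ : IsLipschitzDomain Ω) (v : Lp ℝ 2 (volume.restrict Ω)) :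
    dataForm B v v ≤ maxOverlap Ω K * ‖v‖ ^ 2 := by
  have hfin := hΩ.isBounded.measure_lt_top (μ := volume) |>.ne
  have hm : AEMeasurable (fun x => ‖v x‖ₑ) (volume.restrict Ω) := (Lp.memLp v).1.enorm
  have h1 : ∀ i, volume (B i) * ‖⨍ x in B i, v x‖ₑ ^ 2 ≤ ∫⁻ x in B i, ‖v x‖ₑ ^ 2 := by
    intro i
    have hb0 := h.volume_B_ne_zero i
    have hbt := h.volume_B_ne_top hΩ i
    refine (ENNReal.mul_le_mul_iff_right hb0 hbt).1 ?_
    calc volume (B i) * (volume (B i) * ‖⨍ x in B i, v x‖ₑ ^ 2)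
        = (volume (B i) * ‖⨍ x in B i, v x‖ₑ) ^ 2 := by ring
      _ = ‖∫ x in B i, v x‖ₑ ^ 2 := by
          rw [setAverage_eq, smul_eq_mul, enorm_mul, ← mul_assoc,
            Real.enorm_of_nonneg (inv_nonneg.2 measureReal_nonneg), Measure.real,
            ← ENNReal.toReal_inv, ENNReal.ofReal_toReal (ENNReal.inv_ne_top.2 hb0),
            ENNReal.mul_inv_cancel hb0 hbt, one_mul]
      _ ≤ (∫⁻ x in B i, ‖v x‖ₑ) ^ 2 := by
          gcongr
          exact enorm_integral_le_lintegral_enorm _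
      _ ≤ volume (B i) * ∫⁻ x in B i, ‖v x‖ₑ ^ 2 := by
          refine (lintegral_sq_le (hm.mono_measure
            (Measure.restrict_mono (h.B_subset i) le_rfl))).trans_eq ?_
          rw [Measure.restrict_apply_univ]
  have h2 := (Finset.sum_le_sum fun i (_ : i ∈ Finset.univ) => h1 i).trans
    (sum_setLIntegral_le hΩ.isOpen.measurableSet (fun i => (h.isOpen_B i).measurableSet)
      h.B_subset_K h.B_subset (hm.pow_const 2))
  have h3 : ∑ i, volume (B i) * ‖⨍ x in B i, v x‖ₑ ^ 2 = ENNReal.ofReal (dataForm B v v) := by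
    rw [dataForm_self, ENNReal.ofReal_sum_of_nonneg fun i _ => by positivity]
    refine Finset.sum_congr rfl fun i _ => ?_
    rw [ENNReal.ofReal_mul measureReal_nonneg, ofReal_measureReal (h.volume_B_ne_top hΩ i),
      ← sq_abs, ENNReal.ofReal_pow (abs_nonneg _), ← Real.norm_eq_abs, ofReal_norm]
  rw [h3, ← sq_eLpNorm_two, ← Lp.enorm_def, ← ofReal_norm, ← ENNReal.ofReal_pow (norm_nonneg _),
    ← ENNReal.ofReal_natCast, ← ENNReal.ofReal_mul (by positivity)] at h2
  exact (ENNReal.ofReal_le_ofReal_iff (by positivity)).1 h2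

theorem IsDataCovering.sum_volume_le {K : Fin m → Set (Euc d)} (h : IsDataCovering Ω B K)
    (hΩ : IsLipschitzDomain Ω) :
    ∑ i, volume.real (B i) ≤ maxOverlap Ω K * volume.real Ω := by
  have hfin := hΩ.isBounded.measure_lt_top (μ := volume) |>.ne
  have h1 := sum_setLIntegral_le (K := K) hΩ.isOpen.measurableSet
    (fun i => (h.isOpen_B i).measurableSet) h.B_subset_K h.B_subset
    (aemeasurable_const (b := (1 : ℝ≥0∞)))
  simp only [lintegral_const, one_mul, Measure.restrict_apply_univ] at h1
  have h2 := ENNReal.toReal_mono (ENNReal.mul_ne_top (ENNReal.natCast_ne_top _) hfin) h1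
  rw [ENNReal.toReal_sum fun i _ => h.volume_B_ne_top hΩ i, ENNReal.toReal_mul,
    ENNReal.toReal_natCast] at h2
  exact h2

end Forms

/-! ### The residual -/

section Residual

variable {d : ℕ} {Ω : Set (Euc d)}

theorem norm_le_normH2 (u : L2Pair Ω) (D2u : Fin d → Lp (Euc d) 2 (volume.restrict Ω)) :
    ‖u.1‖ ≤ normH2 u D2u ∧ ‖u.2‖ ≤ normH2 u D2u ∧ ∀ i, ‖D2u i‖ ≤ normH2 u D2u := by
  have hs : ∀ i, ‖D2u i‖ ^ 2 ≤ ∑ i, ‖D2u i‖ ^ 2 := fun i =>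
    Finset.single_le_sum (f := fun i => ‖D2u i‖ ^ 2) (fun _ _ => sq_nonneg _) (Finset.mem_univ i)
  have h0 : 0 ≤ ∑ i, ‖D2u i‖ ^ 2 := Finset.sum_nonneg fun _ _ => sq_nonneg _
  refine ⟨Real.le_sqrt_of_sq_le ?_, Real.le_sqrt_of_sq_le ?_, fun i => Real.le_sqrt_of_sq_le ?_⟩
  · nlinarith [sq_nonneg ‖u.2‖]
  · nlinarith [sq_nonneg ‖u.1‖]
  · nlinarith [sq_nonneg ‖u.1‖, sq_nonneg ‖u.2‖, hs i]

/-- Integration by parts for the perturbation `∫ β ∇u · ∇e` of the diffusion term. -/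
theorem integral_perturbation_eq (hd : 0 < d) (hΩ : IsLipschitzDomain Ω) {β : Euc d → ℝ}
    {Dβ : Euc d → Euc d} (hβ : IsW1Infty Ω β Dβ) {V : Set (L2Pair Ω)} {u : L2Pair Ω}
    {D2u : Fin d → Lp (Euc d) 2 (volume.restrict Ω)} (hbd : BoundaryTermsVanish V u D2u)
    {e : L2Pair Ω} (he : e ∈ V) :
    ∫ x in Ω, β x * ⟪u.2 x, e.2 x⟫ =
      -((∑ i, ∫ x in Ω, β x * (e.1 x * D2u i x i)) + ∫ x in Ω, e.1 x * ⟪Dβ x, u.2 x⟫) := by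
  obtain ⟨g, h, htr, htr', hν⟩ := hbd e he
  have hibp := hΩ.integral_by_parts hd hβ (Lp.memLp e.1) (Lp.memLp e.2)
    (fun i => memLp_apply (Lp.memLp u.2) i) (fun i => Lp.memLp (D2u i)) htr htr' hν
  have i1 : Integrable (fun x => β x * ⟪u.2 x, e.2 x⟫) (volume.restrict Ω) :=
    (L2.integrable_inner u.2 e.2).mul_of_top_right hβ.2.1
  have i2 : ∀ i, Integrable (fun x => β x * (e.1 x * D2u i x i)) (volume.restrict Ω) := fun i =>
    integrable_weight_mul hβ.2.1 (Lp.memLp e.1) (memLp_apply (Lp.memLp (D2u i)) i)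
  have i3 : Integrable (fun x => e.1 x * ⟪Dβ x, u.2 x⟫) (volume.restrict Ω) := by
    have : (fun x => e.1 x * ⟪Dβ x, u.2 x⟫) = fun x => ∑ i, Dβ x i * (e.1 x * u.2 x i) := by
      ext x
      rw [PiLp.inner_apply, Finset.mul_sum]
      refine Finset.sum_congr rfl fun i _ => ?_
      simp
      ring
    rw [this]
    exact integrable_finsetSum _ fun i _ => integrable_weight_mul (memLp_apply hβ.2.2 i)
      (Lp.memLp e.1) (memLp_apply (Lp.memLp u.2) i)
  have hpt : ∀ x, ∑ i, (β x * (e.2 x i * u.2 x i) + β x * (e.1 x * D2u i x i) +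
      Dβ x i * (e.1 x * u.2 x i)) =
      β x * ⟪u.2 x, e.2 x⟫ + (∑ i, β x * (e.1 x * D2u i x i)) + e.1 x * ⟪Dβ x, u.2 x⟫ := by
    intro x
    simp_rw [PiLp.inner_apply, Finset.mul_sum, Finset.sum_add_distrib]
    congr 1
    refine Finset.sum_congr rfl fun i _ => ?_
    simp
    ring
  simp_rw [hpt] at hibp
  have i4 := integrable_finsetSum Finset.univ fun i _ => i2 i
  rw [integral_add (by exact i1.add i4) i3, integral_add i1 i4, integral_finsetSum _
    fun i _ => i2 i] at hibp
  linarith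

/-- The part of the residual that is caused by the inexact coefficients and load. As the
perturbation of the diffusion term is integrated by parts, only the `L²`-norm of `e` enters, and
not that of its gradient: this is where one power of `R` in the error estimate is gained. -/
theorem abs_pde_residual_le (hd : 0 < d) (hΩ : IsLipschitzDomain Ω) {α σ α' σ' : Euc d → ℝ}
    (hα : MemLp α ⊤ (volume.restrict Ω)) (hσ : MemLp σ ⊤ (volume.restrict Ω))
    (hα' : MemLp α' ⊤ (volume.restrict Ω)) (hσ' : MemLp σ' ⊤ (volume.restrict Ω))
    {f f' : Lp ℝ 2 (volume.restrict Ω)} {Dβ : Euc d → Euc d}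
    (hβ : IsW1Infty Ω (fun x => α' x - α x) Dβ) {V : Set (L2Pair Ω)} {u : L2Pair Ω}
    {D2u : Fin d → Lp (Euc d) 2 (volume.restrict Ω)} (hbd : BoundaryTermsVanish V u D2u)
    {U : ℝ} (hU : normH2 u D2u ≤ U) {e : L2Pair Ω} (he : e ∈ V)
    (hue : pdeForm α σ u e = pdeLoad f e) :
    |pdeLoad f' e - pdeForm α' σ' u e| ≤ (1 + (d + 2) * U) *
      (‖f' - f‖ + normLinfty Ω (fun x => σ' x - σ x) +
        normW1Infty Ω (fun x => α' x - α x) Dβ) * ‖e.1‖ := by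
  obtain ⟨hU1, hU2, hU3⟩ := norm_le_normH2 u D2u
  set W := normW1Infty Ω (fun x => α' x - α x) Dβ with hWdef
  set Nσ := normLinfty Ω (fun x => σ' x - σ x) with hNσ
  have hNσ0 : 0 ≤ Nσ := ENNReal.toReal_nonneg
  have hW0 : 0 ≤ W := le_max_of_le_left ENNReal.toReal_nonneg
  have hf : pdeLoad f' e - pdeLoad f e = ∫ x in Ω, (f' - f) x * e.1 x := by
    unfold pdeLoad
    rw [← integral_sub (by exact (Lp.memLp f').integrable_mul (Lp.memLp e.1))
      (by exact (Lp.memLp f).integrable_mul (Lp.memLp e.1))]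
    refine integral_congr_ae ?_
    filter_upwards [Lp.coeFn_sub f' f] with x hx
    rw [hx, Pi.sub_apply]
    ring
  have i1 : Integrable (fun x => (α' x - α x) * ⟪u.2 x, e.2 x⟫) (volume.restrict Ω) :=
    (L2.integrable_inner u.2 e.2).mul_of_top_right hβ.2.1
  have i2 : Integrable (fun x => (σ' x - σ x) * (u.1 x * e.1 x)) (volume.restrict Ω) :=
    integrable_weight_mul (hσ'.sub hσ) (Lp.memLp u.1) (Lp.memLp e.1)
  have ha : pdeForm α' σ' u e - pdeForm α σ u e = (∫ x in Ω, (α' x - α x) * ⟪u.2 x, e.2 x⟫) +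
      ∫ x in Ω, (σ' x - σ x) * (u.1 x * e.1 x) := by
    unfold pdeForm
    rw [← integral_sub (integrable_pdeForm hα' hσ' u e) (integrable_pdeForm hα hσ u e),
      ← integral_add i1 i2]
    refine integral_congr_ae (Eventually.of_forall fun x => ?_)
    ring
  have hid : pdeLoad f' e - pdeForm α' σ' u e = (∫ x in Ω, (f' - f) x * e.1 x) -
      (∫ x in Ω, (σ' x - σ x) * (u.1 x * e.1 x)) +
      (∑ i, ∫ x in Ω, (α' x - α x) * (e.1 x * D2u i x i)) +
        ∫ x in Ω, e.1 x * ⟪Dβ x, u.2 x⟫ := by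
    rw [integral_perturbation_eq hd hΩ hβ hbd he] at ha
    linarith
  have b1 : |∫ x in Ω, (f' - f) x * e.1 x| ≤ 1 * ‖f' - f‖ * ‖e.1‖ := by
    refine abs_integral_le_mul_norm zero_le_one _ _ (Eventually.of_forall fun x => ?_)
    rw [one_mul, abs_mul, Real.norm_eq_abs, Real.norm_eq_abs]
  have b2 : |∫ x in Ω, (σ' x - σ x) * (u.1 x * e.1 x)| ≤ Nσ * ‖u.1‖ * ‖e.1‖ := by
    refine abs_integral_le_mul_norm hNσ0 _ _ ?_
    filter_upwards [ae_norm_le_normLinfty (hσ'.sub hσ)] with x hx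
    rw [abs_mul, abs_mul, Real.norm_eq_abs, Real.norm_eq_abs]
    exact mul_le_mul_of_nonneg_right hx (by positivity)
  have b3 : ∀ i, |∫ x in Ω, (α' x - α x) * (e.1 x * D2u i x i)| ≤ W * ‖e.1‖ * ‖D2u i‖ := by
    intro i
    refine abs_integral_le_mul_norm hW0 _ _ ?_
    filter_upwards [ae_norm_le_normLinfty hβ.2.1] with x hx
    rw [abs_mul, abs_mul]
    exact mul_le_mul (hx.trans (le_max_left _ _))
      (mul_le_mul_of_nonneg_left (PiLp.norm_apply_le (D2u i x) i) (abs_nonneg _))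
      (by positivity) hW0
  have b4 : |∫ x in Ω, e.1 x * ⟪Dβ x, u.2 x⟫| ≤ W * ‖e.1‖ * ‖u.2‖ := by
    refine abs_integral_le_mul_norm hW0 _ _ ?_
    filter_upwards [ae_norm_le_normLinfty hβ.2.2] with x hx
    rw [abs_mul, ← Real.norm_eq_abs]
    calc ‖e.1 x‖ * |⟪Dβ x, u.2 x⟫| ≤ ‖e.1 x‖ * (W * ‖u.2 x‖) := by
          gcongr
          exact (abs_real_inner_le_norm _ _).trans (mul_le_mul_of_nonneg_right
            (hx.trans (le_max_right _ _)) (norm_nonneg _))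
      _ = _ := by ring
  have b3' : |∑ i, ∫ x in Ω, (α' x - α x) * (e.1 x * D2u i x i)| ≤ d * (W * ‖e.1‖ * U) := by
    refine (Finset.abs_sum_le_sum_abs _ _).trans ?_
    refine (Finset.sum_le_card_nsmul _ _ (W * ‖e.1‖ * U) fun i _ => (b3 i).trans ?_).trans_eq ?_
    · have := (hU3 i).trans hU
      gcongr
    · simp
  have hU0 : 0 ≤ U := (norm_nonneg _).trans (hU1.trans hU)
  have b2' : Nσ * ‖u.1‖ * ‖e.1‖ ≤ Nσ * U * ‖e.1‖ := by
    have := hU1.trans hU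
    gcongr
  have b4' : W * ‖e.1‖ * ‖u.2‖ ≤ W * ‖e.1‖ * U := by
    have := hU2.trans hU
    gcongr
  rw [hid]
  have htri : ∀ a b c k : ℝ, |a - b + c + k| ≤ |a| + |b| + |c| + |k| := fun a b c k =>
    (abs_add_le _ _).trans (add_le_add_left ((abs_add_le _ _).trans
      (add_le_add_left (abs_sub a b) _)) _)
  refine (htri _ _ _ _).trans ?_
  have hd0 : (0 : ℝ) ≤ d := Nat.cast_nonneg d
  have p1 : 0 ≤ U * ‖f' - f‖ * ‖e.1‖ := by positivity
  have p2 : 0 ≤ U * Nσ * ‖e.1‖ := by positivity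
  have p3 : 0 ≤ U * W * ‖e.1‖ := by positivity
  have p4 : 0 ≤ Nσ * ‖e.1‖ := by positivity
  have p5 : 0 ≤ W * ‖e.1‖ := by positivity
  have q1 := mul_nonneg hd0 p1
  have q2 := mul_nonneg hd0 p2
  calc _ ≤ ‖f' - f‖ * ‖e.1‖ + Nσ * U * ‖e.1‖ + d * (W * ‖e.1‖ * U) + W * ‖e.1‖ * U := by
        linarith
    _ ≤ _ := by nlinarith

/-- The part of the residual that is caused by replacing local averages by point values: they
differ by at most the oscillation `U r^lam` of a Hölder continuous function. -/
theorem abs_data_residual_le {m : ℕ} {B K : Fin m → Set (Euc d)} (h : IsDataCovering Ω B K)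
    (hΩ : IsLipschitzDomain Ω) {u : Lp ℝ 2 (volume.restrict Ω)} {uc : Euc d → ℝ} {H lam : ℝ≥0}
    (huc : (u : Euc d → ℝ) =ᵐ[volume.restrict Ω] uc) (hH : HolderOnWith H lam uc (closure Ω))
    {p : Fin m → Euc d} (hp : ∀ i, p i ∈ B i) {U : ℝ} (hU : (H : ℝ) ≤ U)
    (e : Lp ℝ 2 (volume.restrict Ω)) :
    |dataLoad B (fun i => uc (p i)) e - dataForm B u e| ≤
      U * maxDiam B ^ (lam : ℝ) * Real.sqrt (maxOverlap Ω K * volume.real Ω) *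
        Real.sqrt (dataForm B e e) := by
  have hU0 : 0 ≤ U := H.coe_nonneg.trans hU
  have hΩf := hΩ.isBounded.measure_lt_top (μ := volume) |>.ne
  have hfin : IsFiniteMeasure (volume.restrict Ω) := isFiniteMeasure_restrict.2 hΩf
  have hdev : ∀ i, |uc (p i) - ⨍ x in B i, u x| ≤ U * maxDiam B ^ (lam : ℝ) := by
    intro i
    have hbt := h.volume_B_ne_top hΩ i
    have hbpos := h.volume_B_pos hΩ i
    have hfinB : IsFiniteMeasure (volume.restrict (B i)) := isFiniteMeasure_restrict.2 hbt
    have hle : volume.restrict (B i) ≤ volume.restrict Ω :=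
      Measure.restrict_mono (h.B_subset i) le_rfl
    have hui : IntegrableOn u (B i) :=
      ((Lp.memLp u).integrable (by norm_num)).mono_measure hle
    have hBb : Bornology.IsBounded (B i) := hΩ.isBounded.subset (h.B_subset i)
    have hcl : ∀ x ∈ B i, x ∈ closure Ω := fun x hx => subset_closure (h.B_subset i hx)
    have h1 : volume.real (B i) * (uc (p i) - ⨍ x in B i, u x) = ∫ x in B i, (uc (p i) - u x) := by
      rw [integral_sub (integrable_const _) hui, setAverage_eq, setIntegral_const]
      simp only [smul_eq_mul]
      field_simp
    have h2 : ‖∫ x in B i, (uc (p i) - u x)‖ ≤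
        U * maxDiam B ^ (lam : ℝ) * volume.real (B i) := by
      refine norm_setIntegral_le_of_norm_le_const_ae hbt.lt_top ?_
      filter_upwards [huc.filter_mono (ae_mono hle),
        ae_restrict_mem (h.isOpen_B i).measurableSet] with x hx hxB
      rw [hx, ← dist_eq_norm]
      refine (hH.dist_le (hcl _ (hp i)) (hcl _ hxB)).trans ?_
      have h3 : dist (p i) x ≤ maxDiam B :=
        (Metric.dist_le_diam_of_mem hBb (hp i) hxB).trans (IsDataCovering.diam_le i B)
      gcongr
    rw [← h1, norm_mul, Real.norm_of_nonneg hbpos.le, mul_comm, Real.norm_eq_abs] at h2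
    exact le_of_mul_le_mul_right h2 hbpos
  have hbr : 0 ≤ maxDiam B := by
    obtain ⟨i⟩ := h.nonempty_index hΩ
    exact Metric.diam_nonneg.trans (IsDataCovering.diam_le i B)
  have hcs : ∑ i, volume.real (B i) * |⨍ x in B i, e x| ≤
      Real.sqrt (∑ i, volume.real (B i)) * Real.sqrt (dataForm B e e) := by
    have := Real.sum_mul_le_sqrt_mul_sqrt Finset.univ (fun i => Real.sqrt (volume.real (B i)))
      (fun i => Real.sqrt (volume.real (B i)) * |⨍ x in B i, e x|)
    simp_rw [← mul_assoc, Real.mul_self_sqrt measureReal_nonneg, mul_pow,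
      Real.sq_sqrt measureReal_nonneg, sq_abs] at this
    rwa [← dataForm_self] at this
  calc |dataLoad B (fun i => uc (p i)) e - dataForm B u e|
      = |∑ i, (uc (p i) - ⨍ x in B i, u x) * (volume.real (B i) * ⨍ x in B i, e x)| := by
        unfold dataLoad dataForm
        rw [← Finset.sum_sub_distrib]
        congr 1
        exact Finset.sum_congr rfl fun i _ => by ring
    _ ≤ ∑ i, U * maxDiam B ^ (lam : ℝ) * (volume.real (B i) * |⨍ x in B i, e x|) := by
        refine (Finset.abs_sum_le_sum_abs _ _).trans (Finset.sum_le_sum fun i _ => ?_)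
        rw [abs_mul, abs_mul, abs_of_nonneg (measureReal_nonneg (μ := volume) (s := B i))]
        exact mul_le_mul_of_nonneg_right (hdev i) (by positivity)
    _ ≤ U * maxDiam B ^ (lam : ℝ) *
          (Real.sqrt (∑ i, volume.real (B i)) * Real.sqrt (dataForm B e e)) := by
        rw [← Finset.mul_sum]
        gcongr
    _ ≤ _ := by
        rw [mul_assoc _ (Real.sqrt (_ * _))]
        gcongr
        exact h.sum_volume_le hΩ

end Residual

/-! ### The error estimate -/

/-- If a quadratic functional is smaller at distance `x` than at distance `y` from a point with
residual at most `ε`, then `x ≤ y + 2 ε`. -/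
theorem le_add_of_quadratic_le {x y ε p q : ℝ} (hy : 0 ≤ y) (hε : 0 ≤ ε)
    (hp : |p| ≤ ε * x) (hq : |q| ≤ ε * y) (h : 1 / 2 * x ^ 2 - p ≤ 1 / 2 * y ^ 2 - q) :
    x ≤ y + 2 * ε := by
  by_contra hlt
  rw [not_le] at hlt
  have h1 := abs_le.1 hp
  have h2 := abs_le.1 hq
  nlinarith [mul_pos (sub_pos.2 hlt) (by linarith : 0 < x + y)]

namespace IsDataCovering

variable {d m : ℕ} {Ω : Set (Euc d)} {B K : Fin m → Set (Euc d)}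

theorem mismatch_nonneg (B K : Fin m → Set (Euc d)) : 0 ≤ mismatch B K := by
  unfold mismatch
  split_ifs
  · exact zero_le_one
  · exact mul_nonneg (by norm_num) (Real.iSup_nonneg fun i => by positivity)

theorem maxDiam_le (h : IsDataCovering Ω B K) (hΩ : IsLipschitzDomain Ω) {D : ℝ}
    (hD : Metric.diam Ω ≤ D) : maxDiam K ≤ D := by
  have := h.nonempty_index hΩ
  refine ciSup_le fun i => ?_
  refine (Metric.diam_mono (h.K_subset i) hΩ.isBounded.closure).trans ?_
  rwa [Metric.diam_closure]

/-- The well-balanced range of `δ` in terms of `R² M`. -/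
theorem mul_le_of_mem_Icc {δ θ a : ℝ}
    (hδ : δ ∈ Icc (θ * referenceWeight Ω K a) (θ⁻¹ * referenceWeight Ω K a))
    (hθ : 0 < θ) (ha : 0 < a) :
    δ * (θ * (Real.pi ^ 2 * a)) ≤ maxDiam K ^ 2 * maxOverlap Ω K ∧
      maxDiam K ^ 2 * maxOverlap Ω K ≤ δ * (Real.pi ^ 2 * a / θ) := by
  have hρ : 0 < Real.pi ^ 2 * a := by positivity
  obtain ⟨h1, h2⟩ := hδ
  unfold referenceWeight at h1 h2
  constructor
  · rw [← div_eq_inv_mul, le_div_iff₀ hθ, le_div_iff₀ hρ] at h2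
    linarith
  · rw [← mul_div_assoc, div_le_iff₀ hρ] at h1
    rw [← mul_div_assoc, le_div_iff₀ hθ]
    linarith

/-- The energy controls the `L²`-norm at the scale `R = maxDiam K`. -/
theorem sq_norm_le_energy (h : IsDataCovering Ω B K) (hΩ : IsLipschitzDomain Ω) (hd : 0 < d)
    {α σ : Euc d → ℝ} {αmin αmax : ℝ} (hα : IsDiffusionCoeff Ω α αmin αmax)
    (hσ : IsReactionCoeff Ω σ) {η M₀ θ δ : ℝ} (hη : mismatch B K ≤ η)
    (hM : (maxOverlap Ω K : ℝ) ≤ M₀) (hθ : 0 < θ) (hδ0 : 0 < δ)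
    (hδ : δ ∈ Icc (θ * referenceWeight Ω K αmin) (θ⁻¹ * referenceWeight Ω K αmin))
    {e : L2Pair Ω} {g : Euc d → ℝ} (he : IsTrace Ω e.1 e.2 g) :
    ‖e.1‖ ^ 2 ≤ (2 * (2 ^ d * η) * M₀ / αmin + 2 * η * M₀ / (θ * (Real.pi ^ 2 * αmin))) *
      maxDiam K ^ 2 * augmentedForm α σ δ B e e := by
  have hR := h.maxDiam_pos hΩ hd
  have hη0 : 0 ≤ η := (mismatch_nonneg B K).trans hη
  have hP := h.sq_norm_le hΩ hη0 hη hR.le he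
  have ha : 0 < αmin := hα.1
  have hM0 : 0 ≤ M₀ := (Nat.cast_nonneg _).trans hM
  have hρ : 0 < θ * (Real.pi ^ 2 * αmin) := by positivity
  obtain ⟨h1, -⟩ := mul_le_of_mem_Icc hδ hθ ha
  have hb := dataForm_self_nonneg B e.1
  have hE : αmin * ‖e.2‖ ^ 2 + δ⁻¹ * dataForm B e.1 e.1 ≤ augmentedForm α σ δ B e e := by
    unfold augmentedForm
    linarith [hα.le_pdeForm hσ e]
  have hδb : 0 ≤ δ⁻¹ * dataForm B e.1 e.1 := by positivity
  have hg : 0 ≤ αmin * ‖e.2‖ ^ 2 := by positivity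
  -- gradient part and data part of the energy
  have e1 : 2 * (maxDiam K ^ 2 * (2 ^ d * η)) * maxOverlap Ω K * ‖e.2‖ ^ 2 ≤
      2 * (2 ^ d * η) * M₀ / αmin * maxDiam K ^ 2 * (αmin * ‖e.2‖ ^ 2) := by
    calc 2 * (maxDiam K ^ 2 * (2 ^ d * η)) * maxOverlap Ω K * ‖e.2‖ ^ 2
        ≤ 2 * (maxDiam K ^ 2 * (2 ^ d * η)) * M₀ * ‖e.2‖ ^ 2 := by gcongr
      _ = _ := by field_simp
  have e2 : 2 * η * dataForm B e.1 e.1 ≤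
      2 * η * M₀ / (θ * (Real.pi ^ 2 * αmin)) * maxDiam K ^ 2 * (δ⁻¹ * dataForm B e.1 e.1) := by
    have h3 : δ ≤ maxDiam K ^ 2 * M₀ / (θ * (Real.pi ^ 2 * αmin)) := by
      rw [le_div_iff₀ hρ]
      exact h1.trans (by gcongr)
    calc 2 * η * dataForm B e.1 e.1 = 2 * η * δ * (δ⁻¹ * dataForm B e.1 e.1) := by field_simp
      _ ≤ 2 * η * (maxDiam K ^ 2 * M₀ / (θ * (Real.pi ^ 2 * αmin))) *
            (δ⁻¹ * dataForm B e.1 e.1) := by gcongr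
      _ = _ := by ring
  have hc1 : 0 ≤ 2 * (2 ^ d * η) * M₀ / αmin * maxDiam K ^ 2 := by positivity
  have hc2 : 0 ≤ 2 * η * M₀ / (θ * (Real.pi ^ 2 * αmin)) * maxDiam K ^ 2 := by positivity
  have e3 := mul_le_mul_of_nonneg_left
    ((le_add_of_nonneg_right hδb).trans hE : αmin * ‖e.2‖ ^ 2 ≤ _) hc1
  have e4 := mul_le_mul_of_nonneg_left
    ((le_add_of_nonneg_left hg).trans hE : δ⁻¹ * dataForm B e.1 e.1 ≤ _) hc2
  rw [add_mul, add_mul]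
  linarith

/-- The energy norm is bounded by the scaled `H¹`-norm. -/
theorem energy_le (h : IsDataCovering Ω B K) (hΩ : IsLipschitzDomain Ω) (hd : 0 < d)
    {α σ : Euc d → ℝ} {αmin αmax : ℝ} (hα : IsDiffusionCoeff Ω α αmin αmax)
    (hσ : IsReactionCoeff Ω σ) {S D θ δ : ℝ} (hS : normLinfty Ω σ ≤ S)
    (hD : Metric.diam Ω ≤ D) (hθ : 0 < θ) (hδ0 : 0 < δ)
    (hδ : δ ∈ Icc (θ * referenceWeight Ω K αmin) (θ⁻¹ * referenceWeight Ω K αmin))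
    (hαmax : 0 ≤ αmax) (y : L2Pair Ω) :
    maxDiam K * Real.sqrt (augmentedForm α σ δ B y y) ≤
      Real.sqrt (αmax + S * D ^ 2 + Real.pi ^ 2 * αmin / θ) *
        (maxDiam K * ‖y.2‖ + ‖y.1‖) := by
  have hR := h.maxDiam_pos hΩ hd
  have hRD := h.maxDiam_le hΩ hD
  have ha : 0 < αmin := hα.1
  have hσ0 : 0 ≤ normLinfty Ω σ := ENNReal.toReal_nonneg
  have hS0 : 0 ≤ S := le_trans ENNReal.toReal_nonneg hS
  obtain ⟨-, h2⟩ := mul_le_of_mem_Icc hδ hθ ha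
  have hρ : 0 ≤ Real.pi ^ 2 * αmin / θ := by positivity
  have e1 := hα.pdeForm_le hσ y
  have e2 := h.dataForm_le hΩ y.1
  have e3 : maxDiam K ^ 2 * (δ⁻¹ * dataForm B y.1 y.1) ≤
      Real.pi ^ 2 * αmin / θ * ‖y.1‖ ^ 2 := by
    calc maxDiam K ^ 2 * (δ⁻¹ * dataForm B y.1 y.1)
        ≤ maxDiam K ^ 2 * (δ⁻¹ * (maxOverlap Ω K * ‖y.1‖ ^ 2)) := by gcongr
      _ = δ⁻¹ * (maxDiam K ^ 2 * maxOverlap Ω K) * ‖y.1‖ ^ 2 := by ring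
      _ ≤ δ⁻¹ * (δ * (Real.pi ^ 2 * αmin / θ)) * ‖y.1‖ ^ 2 := by gcongr
      _ = _ := by field_simp
  have e4 : maxDiam K ^ 2 * (normLinfty Ω σ * ‖y.1‖ ^ 2) ≤ S * D ^ 2 * ‖y.1‖ ^ 2 := by
    calc maxDiam K ^ 2 * (normLinfty Ω σ * ‖y.1‖ ^ 2) ≤ D ^ 2 * (S * ‖y.1‖ ^ 2) := by gcongr
      _ = _ := by ring
  set k := αmax + S * D ^ 2 + Real.pi ^ 2 * αmin / θ with hk
  have hk1 : αmax ≤ k := by rw [hk]; nlinarith [mul_nonneg hS0 (sq_nonneg D)]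
  have hk2 : S * D ^ 2 + Real.pi ^ 2 * αmin / θ ≤ k := by rw [hk]; linarith
  have hk0 : 0 ≤ k := hαmax.trans hk1
  have hsq : maxDiam K ^ 2 * augmentedForm α σ δ B y y ≤
      k * (maxDiam K * ‖y.2‖ + ‖y.1‖) ^ 2 := by
    have e5 := mul_le_mul_of_nonneg_left e1 (sq_nonneg (maxDiam K))
    have e6 := mul_le_mul_of_nonneg_right hk1 (sq_nonneg (maxDiam K * ‖y.2‖))
    have e7 := mul_le_mul_of_nonneg_right hk2 (sq_nonneg ‖y.1‖)
    have e8 : 0 ≤ k * (2 * (maxDiam K * ‖y.2‖ * ‖y.1‖)) := by positivity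
    unfold augmentedForm
    nlinarith
  rw [← Real.sqrt_sq hR.le, ← Real.sqrt_mul (sq_nonneg _), Real.sqrt_sq hR.le]
  refine (Real.sqrt_le_sqrt hsq).trans_eq ?_
  rw [Real.sqrt_mul hk0, Real.sqrt_sq (by positivity)]

end IsDataCovering

theorem volume_real_le_closedBall {d : ℕ} {Ω : Set (Euc d)} (hΩ : IsLipschitzDomain Ω) {D : ℝ}
    (hD : Metric.diam Ω ≤ D) : volume.real Ω ≤ volume.real (Metric.closedBall (0 : Euc d) D) := by
  obtain ⟨z, hz⟩ := hΩ.isConnected.nonempty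
  have hsub : Ω ⊆ Metric.closedBall z D := fun x hx =>
    (Metric.dist_le_diam_of_mem hΩ.isBounded hx hz).trans hD
  have h1 := measureReal_mono (μ := volume) hsub measure_closedBall_lt_top.ne
  rwa [Measure.real, Measure.real, Measure.addHaar_closedBall_center] at h1

section Estimate

variable {d m : ℕ} {Ω : Set (Euc d)} {B : Fin m → Set (Euc d)}

/-- The residual in the dual of the energy norm. -/
theorem abs_residual_le {α σ : Euc d → ℝ} {f : Lp ℝ 2 (volume.restrict Ω)} {δ : ℝ} (hδ : 0 < δ)
    {b : Fin m → ℝ} {u e : L2Pair Ω} {T k c : ℝ} (hT : 0 ≤ T) (hk : 0 ≤ k)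
    (hpde : |pdeLoad f e - pdeForm α σ u e| ≤ T * ‖e.1‖)
    (hdata : |dataLoad B b e.1 - dataForm B u.1 e.1| ≤ k * Real.sqrt (dataForm B e.1 e.1))
    (hc : ‖e.1‖ ≤ c * Real.sqrt (augmentedForm α σ δ B e e)) (he : 0 ≤ pdeForm α σ e e) :
    |augmentedLoad f δ B b e - augmentedForm α σ δ B u e| ≤
      (T * c + k / Real.sqrt δ) * Real.sqrt (augmentedForm α σ δ B e e) := by
  have hs : 0 < Real.sqrt δ := Real.sqrt_pos.2 hδ
  have h1 : Real.sqrt (dataForm B e.1 e.1) ≤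
      Real.sqrt δ * Real.sqrt (augmentedForm α σ δ B e e) := by
    rw [← Real.sqrt_mul hδ.le]
    refine Real.sqrt_le_sqrt ?_
    unfold augmentedForm
    rw [mul_add, mul_inv_cancel_left₀ hδ.ne']
    exact le_add_of_nonneg_left (mul_nonneg hδ.le he)
  have h2 : augmentedLoad f δ B b e - augmentedForm α σ δ B u e =
      (pdeLoad f e - pdeForm α σ u e) + δ⁻¹ * (dataLoad B b e.1 - dataForm B u.1 e.1) := by
    unfold augmentedLoad augmentedForm
    ring
  have h3 : δ⁻¹ * (k * (Real.sqrt δ * Real.sqrt (augmentedForm α σ δ B e e))) =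
      k / Real.sqrt δ * Real.sqrt (augmentedForm α σ δ B e e) := by
    nth_rewrite 1 [← Real.mul_self_sqrt hδ.le]
    field_simp
  rw [h2]
  calc _ ≤ |pdeLoad f e - pdeForm α σ u e| +
        δ⁻¹ * |dataLoad B b e.1 - dataForm B u.1 e.1| := by
        refine (abs_add_le _ _).trans_eq ?_
        rw [abs_mul, abs_of_pos (inv_pos.2 hδ)]
    _ ≤ T * (c * Real.sqrt (augmentedForm α σ δ B e e)) +
        δ⁻¹ * (k * (Real.sqrt δ * Real.sqrt (augmentedForm α σ δ B e e))) := by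
        refine add_le_add (hpde.trans (by gcongr)) ?_
        gcongr
        exact hdata.trans (by gcongr)
    _ = _ := by
        rw [h3]
        ring

/-- A minimizer of the objective over a set is, in the energy norm, closer to `u` than any other
element of the set, up to twice the norm of the residual of `u`. -/
theorem sqrt_energy_le_of_minimizer {α σ : Euc d → ℝ} {f : Lp ℝ 2 (volume.restrict Ω)} {δ : ℝ}
    (hα : MemLp α ⊤ (volume.restrict Ω)) (hσ : MemLp σ ⊤ (volume.restrict Ω))
    (hB : ∀ i, B i ⊆ Ω) (hfin : volume Ω ≠ ⊤) {b : Fin m → ℝ} {u w v : L2Pair Ω} {ε : ℝ}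
    (hε : 0 ≤ ε)
    (hwv : objective α σ f δ B b w ≤ objective α σ f δ B b v)
    (hw0 : 0 ≤ augmentedForm α σ δ B (w - u) (w - u))
    (hv0 : 0 ≤ augmentedForm α σ δ B (v - u) (v - u))
    (hw : |augmentedLoad f δ B b (w - u) - augmentedForm α σ δ B u (w - u)| ≤
      ε * Real.sqrt (augmentedForm α σ δ B (w - u) (w - u)))
    (hv : |augmentedLoad f δ B b (v - u) - augmentedForm α σ δ B u (v - u)| ≤
      ε * Real.sqrt (augmentedForm α σ δ B (v - u) (v - u))) :
    Real.sqrt (augmentedForm α σ δ B (w - u) (w - u)) ≤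
      Real.sqrt (augmentedForm α σ δ B (v - u) (v - u)) + 2 * ε := by
  refine le_add_of_quadratic_le (Real.sqrt_nonneg _) hε hw hv ?_
  have h1 := objective_add hα hσ hB hfin f δ b u (w - u)
  have h2 := objective_add hα hσ hB hfin f δ b u (v - u)
  rw [add_sub_cancel] at h1 h2
  rw [Real.sq_sqrt hw0, Real.sq_sqrt hv0]
  linarith

/-- The error estimate in terms of the constants `s`, `c₂`, `c₃` that relate the energy norm to
the `L²`-norm, the scaled `H¹`-norm and the regularization parameter. -/
theorem norm_sub_le_of_minimizer (hd : 0 < d) (hΩ : IsLipschitzDomain Ω)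
    {V : Submodule ℝ (L2Pair Ω)} {α σ α' σ' : Euc d → ℝ} {αmin αmax αmin' αmax' : ℝ}
    {f f' : Lp ℝ 2 (volume.restrict Ω)}
    (hα : IsDiffusionCoeff Ω α αmin αmax) (hσ : IsReactionCoeff Ω σ)
    (hα' : IsDiffusionCoeff Ω α' αmin' αmax') (hσ' : IsReactionCoeff Ω σ') {Dβ : Euc d → Euc d}
    (hβ : IsW1Infty Ω (fun x => α' x - α x) Dβ) {u : L2Pair Ω} (huV : u ∈ V)
    (hu : ∀ v ∈ V, pdeForm α σ u v = pdeLoad f v)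
    {D2u : Fin d → Lp (Euc d) 2 (volume.restrict Ω)} {U : ℝ} (hHU : normH2 u D2u ≤ U)
    (hbd : BoundaryTermsVanish (V : Set (L2Pair Ω)) u D2u)
    {uc : Euc d → ℝ} {H lam : ℝ≥0} (huc : (u.1 : Euc d → ℝ) =ᵐ[volume.restrict Ω] uc)
    (hH : HolderOnWith H lam uc (closure Ω)) (hHU' : (H : ℝ) ≤ U)
    {K : Fin m → Set (Euc d)} (hBK : IsDataCovering Ω B K) {p : Fin m → Euc d}
    (hp : ∀ i, p i ∈ B i) {δ : ℝ} (hδ : 0 < δ) {s c₂ c₃ : ℝ} (hs0 : 0 ≤ s) (hc₃0 : 0 ≤ c₃)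
    (hs : ∀ e ∈ V, ‖e.1‖ ≤ s * maxDiam K * Real.sqrt (augmentedForm α' σ' δ B e e))
    (hc₂ : ∀ y : L2Pair Ω, maxDiam K * Real.sqrt (augmentedForm α' σ' δ B y y) ≤
      c₂ * (maxDiam K * ‖y.2‖ + ‖y.1‖))
    (hc₃ : maxDiam K ^ 2 * maxOverlap Ω K * volume.real Ω ≤ δ * c₃ ^ 2)
    {w v : L2Pair Ω} (hw : w ∈ V) (hv : v ∈ V)
    (hwv : objective α' σ' f' δ B (fun i => uc (p i)) w ≤
      objective α' σ' f' δ B (fun i => uc (p i)) v) :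
    ‖w.1 - u.1‖ ≤ 2 * s ^ 2 * (1 + (d + 2) * U) * maxDiam K ^ 2 *
        (‖f' - f‖ + normLinfty Ω (fun x => σ' x - σ x)
          + normW1Infty Ω (fun x => α' x - α x) Dβ) +
      2 * s * U * c₃ * maxDiam B ^ (lam : ℝ) +
      s * c₂ * (maxDiam K * ‖v.2 - u.2‖ + ‖v.1 - u.1‖) := by
  have hΩf := hΩ.isBounded.measure_lt_top (μ := volume) |>.ne
  have hR := hBK.maxDiam_pos hΩ hd
  have hr : 0 ≤ maxDiam B := Real.iSup_nonneg fun _ => Metric.diam_nonneg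
  have hU0 : 0 ≤ U := H.coe_nonneg.trans hHU'
  set T₀ : ℝ := ‖f' - f‖ + normLinfty Ω (fun x => σ' x - σ x)
    + normW1Infty Ω (fun x => α' x - α x) Dβ with hT₀
  have hT₀0 : 0 ≤ T₀ := add_nonneg (add_nonneg (norm_nonneg _) ENNReal.toReal_nonneg)
    (le_max_of_le_left ENNReal.toReal_nonneg)
  set T : ℝ := (1 + (d + 2) * U) * T₀ with hT
  have hT0 : 0 ≤ T := by positivity
  set k : ℝ := U * maxDiam B ^ (lam : ℝ) * Real.sqrt (maxOverlap Ω K * volume.real Ω) with hk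
  have hk0 : 0 ≤ k := by positivity
  have ha := hα'.1
  have hpos : ∀ e : L2Pair Ω, 0 ≤ pdeForm α' σ' e e := fun e =>
    le_trans (by positivity) (hα'.le_pdeForm hσ' e)
  have hQ0 : ∀ e : L2Pair Ω, 0 ≤ augmentedForm α' σ' δ B e e := fun e =>
    add_nonneg (hpos e) (mul_nonneg (inv_nonneg.2 hδ.le) (dataForm_self_nonneg B e.1))
  have hres : ∀ e ∈ V, |augmentedLoad f' δ B (fun i => uc (p i)) e
      - augmentedForm α' σ' δ B u e| ≤
      (T * (s * maxDiam K) + k / Real.sqrt δ) * Real.sqrt (augmentedForm α' σ' δ B e e) :=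
    fun e he => abs_residual_le hδ hT0 hk0
      (abs_pde_residual_le hd hΩ hα.memLp hσ.1 hα'.memLp hσ'.1 hβ hbd hHU he (hu e he))
      (abs_data_residual_le hBK hΩ huc hH hp hHU' e.1) (hs e he) (hpos e)
  have hε0 : 0 ≤ T * (s * maxDiam K) + k / Real.sqrt δ := by positivity
  -- the lower bound on `δ` absorbs the factor `δ⁻¹` of the data term
  have hkR : maxDiam K * (k / Real.sqrt δ) ≤ U * maxDiam B ^ (lam : ℝ) * c₃ := by
    have h3 : maxDiam K * Real.sqrt (maxOverlap Ω K * volume.real Ω) ≤ Real.sqrt δ * c₃ := by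
      rw [← Real.sqrt_sq hc₃0, ← Real.sqrt_mul hδ.le]
      refine Real.le_sqrt_of_sq_le ?_
      rwa [mul_pow, Real.sq_sqrt (by positivity), ← mul_assoc]
    rw [← mul_div_assoc, div_le_iff₀ (Real.sqrt_pos.2 hδ), hk]
    calc _ = U * maxDiam B ^ (lam : ℝ) *
          (maxDiam K * Real.sqrt (maxOverlap Ω K * volume.real Ω)) := by ring
      _ ≤ U * maxDiam B ^ (lam : ℝ) * (Real.sqrt δ * c₃) := by gcongr
      _ = _ := by ring
  have he : w - u ∈ V := V.sub_mem hw huV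
  have h1 := sqrt_energy_le_of_minimizer hα'.memLp hσ'.1 hBK.B_subset hΩf hε0 hwv
    (hQ0 _) (hQ0 _) (hres _ he) (hres _ (V.sub_mem hv huV))
  have h2 := hc₂ (v - u)
  have h4 := hs _ he
  rw [Prod.fst_sub] at h4
  rw [Prod.fst_sub, Prod.snd_sub] at h2
  generalize Real.sqrt (augmentedForm α' σ' δ B (w - u) (w - u)) = q at h1 h4
  generalize Real.sqrt (augmentedForm α' σ' δ B (v - u) (v - u)) = q' at h1 h2
  calc ‖w.1 - u.1‖ ≤ s * maxDiam K * q := h4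
    _ ≤ s * maxDiam K * (q' + 2 * (T * (s * maxDiam K) + k / Real.sqrt δ)) := by gcongr
    _ = s * (maxDiam K * q') + 2 * s ^ 2 * T * maxDiam K ^ 2 +
        2 * s * (maxDiam K * (k / Real.sqrt δ)) := by ring
    _ ≤ s * (c₂ * (maxDiam K * ‖v.2 - u.2‖ + ‖v.1 - u.1‖)) + 2 * s ^ 2 * T * maxDiam K ^ 2 +
        2 * s * (U * maxDiam B ^ (lam : ℝ) * c₃) :=
      add_le_add (add_le_add (mul_le_mul_of_nonneg_left h2 hs0) le_rfl)
        (mul_le_mul_of_nonneg_left hkR (by positivity))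
    _ = _ := by ring

end Estimate

end PDELearning
/-- The quantities quantified before `C` are the only ones on which `C` depends: the dimension,
the bounds `αmin'`, `αmax'`, `S` for the inexact coefficients, bounds `D` for the diameter of the
domain and `U` for the norms of `u`, and the bounds `η₀`, `M₀`, `θ` expressing that the (family of)
problems is non-degenerate and well-balanced. Primes mark the inexact problem. -/
theorem mainTheorem3 (d : ℕ) (hd : 0 < d) (αmin' αmax' S D U η₀ M₀ θ : ℝ)
    (hθ : 0 < θ ∧ θ ≤ 1) :
    ∃ C : ℝ, 0 < C ∧
      -- the domain, the space `V`, the exact and the inexact PDE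
      ∀ (Ω : Set (Euc d)), IsLipschitzDomain Ω → Metric.diam Ω ≤ D →
      ∀ (V : Submodule ℝ (L2Pair Ω)), IsClosed (V : Set (L2Pair Ω)) →
        (V : Set (L2Pair Ω)) ⊆ sobolevH1 Ω → sobolevH10 Ω ⊆ (V : Set (L2Pair Ω)) →
      ∀ (α σ : Euc d → ℝ) (αmin αmax : ℝ) (f : Lp ℝ 2 (volume.restrict Ω)),
        IsDiffusionCoeff Ω α αmin αmax → IsReactionCoeff Ω σ →
        IsCoerciveOn (pdeForm (Ω := Ω) α σ) (V : Set (L2Pair Ω)) →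
      ∀ (α' σ' : Euc d → ℝ) (f' : Lp ℝ 2 (volume.restrict Ω)),
        IsDiffusionCoeff Ω α' αmin' αmax' → IsReactionCoeff Ω σ' → normLinfty Ω σ' ≤ S →
      -- the coefficients `α` differ by an element of `W^{1,∞}(Ω)`
      ∀ (Dβ : Euc d → Euc d), IsW1Infty Ω (fun x => α' x - α x) Dβ →
      -- the solution `u ∈ H²(Ω) ∩ C^{0,lam}` of the exact PDE; `uc` is its continuous version
      ∀ (u : L2Pair Ω), u ∈ V → (∀ v ∈ V, pdeForm α σ u v = pdeLoad f v) →
      ∀ (D2u : Fin d → Lp (Euc d) 2 (volume.restrict Ω)),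
        HasWeakHessian Ω u D2u → normH2 u D2u ≤ U →
        BoundaryTermsVanish (V : Set (L2Pair Ω)) u D2u →
      ∀ (uc : Euc d → ℝ) (H lam : ℝ≥0), (u.1 : Euc d → ℝ) =ᵐ[volume.restrict Ω] uc →
        0 < lam → lam ≤ 1 → HolderOnWith H lam uc (closure Ω) → (H : ℝ) ≤ U →
      -- the non-degenerate data term with point values as data, and the well-balanced `δ`
      ∀ (m : ℕ) (B K : Fin m → Set (Euc d)), IsDataCovering Ω B K →
        mismatch B K ≤ η₀ → (maxOverlap Ω K : ℝ) ≤ M₀ →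
      ∀ (p : Fin m → Euc d), (∀ i, p i ∈ B i) →
      ∀ δ : ℝ, 0 < δ →
        δ ∈ Set.Icc (θ * referenceWeight Ω K αmin') (θ⁻¹ * referenceWeight Ω K αmin') →
      -- a minimizer in a subset `Vh` of `V`
      ∀ (Vh : Set (L2Pair Ω)), Vh ⊆ (V : Set (L2Pair Ω)) →
      ∀ uh ∈ Vh,
        (∀ v ∈ Vh, objective α' σ' f' δ B (fun i => uc (p i)) uh
          ≤ objective α' σ' f' δ B (fun i => uc (p i)) v) →
      ‖uh.1 - u.1‖ ≤
        C * maxDiam K ^ 2 *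
            (‖f' - f‖ + normLinfty Ω (fun x => σ' x - σ x)
              + normW1Infty Ω (fun x => α' x - α x) Dβ)
          + C * maxDiam B ^ (lam : ℝ)
          + C * ⨅ v : Vh, (maxDiam K * ‖(v : L2Pair Ω).2 - u.2‖ + ‖(v : L2Pair Ω).1 - u.1‖) := by
  by_cases hsgn : 0 < αmin' ∧ 0 ≤ αmax' ∧ 0 ≤ S ∧ 0 ≤ D ∧ 0 ≤ U ∧ 0 ≤ η₀ ∧ 0 ≤ M₀
  swap
  · -- negative bounds are not satisfied by any problem
    refine ⟨1, one_pos, fun Ω hΩ hD V _ _ _ α σ αmin αmax f _ _ _ α' σ' f' hα' _ hS Dβ _ u _ _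
      D2u _ _ _ uc H lam _ _ _ _ hHU m B K _ hη hM => absurd ?_ hsgn⟩
    have hne : (ae (volume.restrict Ω)).NeBot := by
      rw [ae_neBot, Ne, Measure.restrict_eq_zero]
      exact (hΩ.isOpen.measure_pos volume hΩ.isConnected.nonempty).ne'
    obtain ⟨x, hx⟩ := hα'.2.2.exists
    exact ⟨hα'.1, hα'.1.le.trans (hx.1.trans hx.2), le_trans ENNReal.toReal_nonneg hS,
      Metric.diam_nonneg.trans hD, H.coe_nonneg.trans hHU,
      (IsDataCovering.mismatch_nonneg B K).trans hη, (Nat.cast_nonneg _).trans hM⟩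
  obtain ⟨ha, hamax, hS0, hD0, hU0, hη0, hM0⟩ := hsgn
  obtain ⟨hθ0, -⟩ := hθ
  have hρ : 0 < Real.pi ^ 2 * αmin' := by positivity
  set c₁ : ℝ := 2 * (2 ^ d * η₀) * M₀ / αmin' + 2 * η₀ * M₀ / (θ * (Real.pi ^ 2 * αmin'))
    with hc₁
  set c₂ : ℝ := Real.sqrt (αmax' + S * D ^ 2 + Real.pi ^ 2 * αmin' / θ) with hc₂
  set c₃ : ℝ := Real.sqrt (Real.pi ^ 2 * αmin' / θ *
    volume.real (Metric.closedBall (0 : Euc d) D)) with hc₃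
  have hc₁0 : 0 ≤ c₁ := by positivity
  have hc₂0 : 0 ≤ c₂ := Real.sqrt_nonneg _
  have hc₃0 : 0 ≤ c₃ := Real.sqrt_nonneg _
  have hs₁0 : 0 ≤ Real.sqrt c₁ := Real.sqrt_nonneg _
  set A : ℝ := Real.sqrt c₁ * c₂ with hA
  set A₁ : ℝ := 2 * c₁ * (1 + (d + 2) * U) with hA₁
  set A₂ : ℝ := 2 * Real.sqrt c₁ * U * c₃ with hA₂
  have hA0 : 0 ≤ A := by positivity
  have hA₁0 : 0 ≤ A₁ := by positivity
  have hA₂0 : 0 ≤ A₂ := by positivity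
  refine ⟨A + A₁ + A₂ + 1, by positivity, ?_⟩
  intro Ω hΩ hD V _ _ _ α σ αmin αmax f hα hσ _ α' σ' f' hα' hσ' hS Dβ hβ u huV hu D2u _ hHU hbd
    uc H lam huc _ _ hH hHU' m B K hBK hη hM p hp δ hδ0 hδ Vh hVh uh huh hmin
  have hR := hBK.maxDiam_pos hΩ hd
  have hr : 0 ≤ maxDiam B := Real.iSup_nonneg fun _ => Metric.diam_nonneg
  have hmain : ∀ v : Vh, ‖uh.1 - u.1‖ ≤ A₁ * maxDiam K ^ 2 * (‖f' - f‖
      + normLinfty Ω (fun x => σ' x - σ x) + normW1Infty Ω (fun x => α' x - α x) Dβ)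
      + A₂ * maxDiam B ^ (lam : ℝ)
      + A * (maxDiam K * ‖(v : L2Pair Ω).2 - u.2‖ + ‖(v : L2Pair Ω).1 - u.1‖) := by
    rintro ⟨v, hv⟩
    rw [hA₁, ← Real.sq_sqrt hc₁0]
    refine norm_sub_le_of_minimizer hd hΩ hα hσ hα' hσ' hβ huV hu hHU hbd huc hH hHU' hBK hp hδ0
      hs₁0 hc₃0 (fun e he => ?_) (hBK.energy_le hΩ hd hα' hσ' hS hD hθ0 hδ0 hδ hamax) ?_
      (hVh huh) (hVh hv) (hmin v hv)
    · obtain ⟨g, -, hg, -⟩ := hbd e he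
      refine (Real.le_sqrt_of_sq_le
        (hBK.sq_norm_le_energy hΩ hd hα' hσ' hη hM hθ0 hδ0 hδ hg)).trans_eq ?_
      rw [Real.sqrt_mul (by positivity), Real.sqrt_mul (by positivity), Real.sqrt_sq hR.le]
    · have h1 := (IsDataCovering.mul_le_of_mem_Icc hδ hθ0 ha).2
      have h2 := volume_real_le_closedBall hΩ hD
      rw [hc₃, Real.sq_sqrt (by positivity), ← mul_assoc]
      gcongr
  have hT₀0 : 0 ≤ ‖f' - f‖ + normLinfty Ω (fun x => σ' x - σ x)
      + normW1Infty Ω (fun x => α' x - α x) Dβ :=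
    add_nonneg (add_nonneg (norm_nonneg _) ENNReal.toReal_nonneg)
      (le_max_of_le_left ENNReal.toReal_nonneg)
  clear_value A A₁ A₂
  generalize maxDiam K = R at hmain hR ⊢
  generalize ‖f' - f‖ + normLinfty Ω (fun x => σ' x - σ x)
      + normW1Infty Ω (fun x => α' x - α x) Dβ = T₀ at hmain hT₀0 ⊢
  have : Nonempty Vh := ⟨⟨uh, huh⟩⟩
  have hinf0 : 0 ≤ ⨅ v : Vh, (R * ‖(v : L2Pair Ω).2 - u.2‖ + ‖(v : L2Pair Ω).1 - u.1‖) :=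
    Real.iInf_nonneg fun v => by positivity
  have hinf : ‖uh.1 - u.1‖ - (A₁ * R ^ 2 * T₀ + A₂ * maxDiam B ^ (lam : ℝ)) ≤
      A * ⨅ v : Vh, (R * ‖(v : L2Pair Ω).2 - u.2‖ + ‖(v : L2Pair Ω).1 - u.1‖) := by
    rw [Real.mul_iInf_of_nonneg hA0]
    exact le_ciInf fun v => sub_le_iff_le_add'.2 (hmain v)
  have hrl : 0 ≤ maxDiam B ^ (lam : ℝ) := Real.rpow_nonneg hr _
  generalize (⨅ v : Vh, (R * ‖(v : L2Pair Ω).2 - u.2‖ + ‖(v : L2Pair Ω).1 - u.1‖)) = I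
    at hinf hinf0 ⊢
  generalize maxDiam B ^ (lam : ℝ) = r at hinf hrl ⊢
  generalize ‖uh.1 - u.1‖ = N at hinf ⊢
  have e1 := mul_le_mul_of_nonneg_right (by linarith : A₁ ≤ A + A₁ + A₂ + 1)
    (mul_nonneg (sq_nonneg R) hT₀0)
  have e2 := mul_le_mul_of_nonneg_right (by linarith : A₂ ≤ A + A₁ + A₂ + 1) hrl
  have e3 := mul_le_mul_of_nonneg_right (by linarith : A ≤ A + A₁ + A₂ + 1) hinf0
  rw [← mul_assoc, ← mul_assoc] at e1
  linarith
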